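/- Let $p$ be a prime. For a commutative ring $k$, an associative unital $k$-algebra $A$ and an $A$-bimodule $M$ on which $k$ acts through $A$ symmetrically, let $\mathrm{Shukla}^n(A/k,M)$ be the $n$-th Hochschild cohomology of $P$ with coefficients in $M$ (the cohomology of the total complex of the bicomplex $\mathrm{Hom}_k(P^{\otimes_k *},M)$), where $P\to A$ is a weak equivalence (an isomorphism in homology) from a quasi-free chain $k$-algebra $P$. A pair $(g,h)$ of a ring homomorphism $g:A\to A'$ and an additive map $h:M'\to M$ with $h(g(a)m')=a\,h(m')$ and $h(m'g(a))=h(m')\,a$ induces homomorphisms $\mathrm{Shukla}^n(A'/k,M')\to\mathrm{Shukla}^n(A/k,M)$ when $g$ is $k$-linear, and $\mathsf H^0(A',M')\to\mathsf H^0(A,M)$, where $\mathsf H^0(A,M)=\{m\in M: am=ma \text{ for all } a\in A\}$. A crossed extension $0\to M\to C_1\to C_0\to A\to 0$ of $k$-algebras (an exact sequence in which $\partial:C_1\to C_0$ is a homomorphism of $C_0$-bimodules with $\partial(x)y=x\partial(y)$, $C_0\to A$ is a homomorphism of $k$-algebras, and $M\to C_1$ is $C_0$-bilinear) has a class in $\mathrm{Shukla}^3(A/k,M)$: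 it is represented by the component in $M$ of a lift $P\to (M\to C_1\to C_0)$ of the identity of $A$ to a morphism of chain algebras. Now let $A$ be an associative unital $\mathbb F_p$-algebra and $M$ an $A$-bimodule, and put $\mathbb K=\mathbb Z/p^2\mathbb Z$. Let $$b^3:\mathrm{Shukla}^3(A/\mathbb K,M)\to \mathrm{Shukla}^3(A/\mathbb Z,M)$$ be the base-change homomorphism, induced by the change of ground ring $\mathbb Z\to\mathbb K$. Let $\mathbb Z[A]$ be the free abelian group on symbols $[a]$, $a\in A$, modulo $[0]=0$, with the multiplication $[a][b]=[ab]$; let $R(A)$ be the kernel of the ring homomorphism $\eta:\mathbb Z[A]\to A$, $[a]\mapsto a$. The canonical crossed extension is the crossed extension of $\mathbb K$-algebras $$(\sigma)_A:\qquad 0\to A\xrightarrow{\ i\ } R(A)/p^2R(A)\xrightarrow{\ \sigma\ }\mathbb K[A]\xrightarrow{\ \eta\ } A\to 0,\qquad i(x)=\sum_{j=0}^{p-1}p\,\langle jx,x\rangle,$$ where $\mathbb K[A]=\mathbb Z[A]/p^2\mathbb Z[A]$, $\langle x,y\rangle=[x]+[y]-[x+y]$ and $\sigma$ is induced by the inclusion.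 For $m\in \mathsf H^0(A,M)$ let $f_m:A\to M$ be the bimodule homomorphism with $f_m(1)=m$. Then there is an isomorphism $$\psi_{A,M}:\mathrm{Shukla}^3(A/\mathbb K,M)\ \cong\ \mathrm{Shukla}^3(A/\mathbb Z,M)\oplus \mathsf H^0(A,M),$$ natural in $(A,M)$ with respect to the pairs $(g,h)$ above, whose first component is $b^3$ and such that $\psi_{A,M}\big((f_m)_*(\sigma)_A\big)=(0,m)$ for every $m\in\mathsf H^0(A,M)$. In particular $b^3$ is split surjective, and $m\mapsto (f_m)_*(\sigma)_A$ is an isomorphism of $\mathsf H^0(A,M)$ onto the kernel of $b^3$. -/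

import Mathlib

open MulOpposite

universe v v' w w' u u' t t'

namespace ShuklaCohomology


/-- A chain algebra over `K`: a `K`-algebra graded by the natural numbers with a differential of
degree `-1` that satisfies the Leibniz rule `d (x * y) = d x * y + (-1) ^ |x| * x * d y`. -/
structure ChainAlgebra (K : Type v) [CommRing K] where
  carrier : Type w
  [ring : Ring carrier]
  [algebra : Algebra K carrier]
  grading : ℕ → Submodule K carrier
  [graded : GradedAlgebra grading]
  d : carrier →ₗ[K] carrier
  d_mem : ∀ n, ∀ x ∈ grading (n + 1), d x ∈ grading n
  d_zero : ∀ x ∈ grading 0, d x = 0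
  d_d : ∀ x, d (d x) = 0
  leibniz : ∀ n, ∀ x ∈ grading n, ∀ y, d (x * y) = d x * y + (-1) ^ n * (x * d y)

attribute [instance] ChainAlgebra.ring ChainAlgebra.algebra ChainAlgebra.graded

/-- A chain algebra over `K` together with a morphism of chain algebras to the `K`-algebra `A`,
regarded as a chain algebra concentrated in degree `0`. -/
structure ChainAlgebraOver (K : Type v) [CommRing K] (A : Type u) [Ring A] [Algebra K A]
    extends ChainAlgebra.{v, w} K where
  ε : carrier →ₐ[K] A
  ε_pos : ∀ n, ∀ x ∈ grading (n + 1), ε x = 0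
  ε_d : ∀ x, ε (d x) = 0

namespace ChainAlgebraOver

section

variable {K : Type v} [CommRing K] {A : Type u} [Ring A] [Algebra K A]

/-- The morphism to `A` is a weak equivalence: it induces an isomorphism in homology. -/
structure IsWeakEquivalence (P : ChainAlgebraOver.{v, w} K A) : Prop where
  surjective : ∀ a, ∃ x ∈ P.grading 0, P.ε x = a
  exact_zero : ∀ x ∈ P.grading 0, P.ε x = 0 → ∃ y ∈ P.grading 1, P.d y = x
  exact_succ : ∀ n, ∀ x ∈ P.grading (n + 1), P.d x = 0 → ∃ y ∈ P.grading (n + 2), P.d y = x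

/-- The underlying graded algebra is free: it is the free algebra on a family of homogeneous
elements. -/
def IsQuasiFree (P : ChainAlgebraOver.{v, w} K A) : Prop :=
  ∃ (X : Type w) (deg : X → ℕ) (x : X → P.carrier), (∀ i, x i ∈ P.grading (deg i)) ∧
    Function.Bijective (FreeAlgebra.lift K x)

/-- The grading involution `x ↦ (-1) ^ |x| * x`. -/
noncomputable def sign (P : ChainAlgebraOver.{v, w} K A) : P.carrier →+ P.carrier :=
  (DirectSum.toAddMonoid fun n => (-1 : ℤ) ^ n • (P.grading n).toAddSubgroup.subtype).comp
    (DirectSum.decomposeAddEquiv P.grading).toAddMonoidHom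

theorem sign_of_mem (P : ChainAlgebraOver.{v, w} K A) {n : ℕ} {x : P.carrier}
    (hx : x ∈ P.grading n) : P.sign x = (-1 : ℤ) ^ n • x := by
  simp only [sign, AddMonoidHom.comp_apply]
  have : (DirectSum.decomposeAddEquiv P.grading).toAddMonoidHom x
      = DirectSum.of (fun n => P.grading n) n ⟨x, hx⟩ := DirectSum.decompose_of_mem _ hx
  rw [this]
  erw [DirectSum.toAddMonoid_of]
  rfl

/-- Families of maps `f n : P ^ n → M`, one for each `n`. -/
abbrev RawCochain (P : ChainAlgebraOver.{v, w} K A) (M : Type t) : Type (max w t) :=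
  ∀ n : ℕ, (Fin n → P.carrier) → M

variable (P : ChainAlgebraOver.{v, w} K A) (M : Type t) [AddCommGroup M] [Module A M]

/-- The Hochschild cochains of total degree `N` with coefficients in a bimodule `M`: families
`f n` of `K`-multilinear maps `P ^ n → M` (that is, of `K`-linear maps `P ⊗ ⋯ ⊗ P → M`) such that
`f n` is concentrated on the part of `P ⊗ ⋯ ⊗ P` of chain degree `N - n`. The ring `K` acts on `M`
through `K → A`. -/
def cochains (N : ℕ) : AddSubgroup (P.RawCochain M) where
  carrier := {f |
    (∀ n (r : Fin n → P.carrier) (i : Fin n) (x y : P.carrier),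
      f n (Function.update r i (x + y))
        = f n (Function.update r i x) + f n (Function.update r i y)) ∧
    (∀ n (r : Fin n → P.carrier) (i : Fin n) (k : K) (x : P.carrier),
      f n (Function.update r i (k • x)) = algebraMap K A k • f n (Function.update r i x)) ∧
    (∀ n (deg : Fin n → ℕ) (r : Fin n → P.carrier), (∀ i, r i ∈ P.grading (deg i)) →
      n + ∑ i, deg i ≠ N → f n r = 0)}
  zero_mem' := by simp
  add_mem' := by
    rintro f g ⟨hf₁, hf₂, hf₃⟩ ⟨hg₁, hg₂, hg₃⟩
    refine ⟨fun n r i x y => ?_, fun n r i k x => ?_, fun n deg r hr hn => ?_⟩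
    · simp only [Pi.add_apply, hf₁, hg₁]; abel
    · simp only [Pi.add_apply, hf₂, hg₂, smul_add]
    · simp only [Pi.add_apply, hf₃ n deg r hr hn, hg₃ n deg r hr hn, add_zero]
  neg_mem' := by
    rintro f ⟨hf₁, hf₂, hf₃⟩
    refine ⟨fun n r i x y => ?_, fun n r i k x => ?_, fun n deg r hr hn => ?_⟩
    · simp only [Pi.neg_apply, hf₁]; abel
    · simp only [Pi.neg_apply, hf₂, smul_neg]
    · simp only [Pi.neg_apply, hf₃ n deg r hr hn, neg_zero]

variable [Module Aᵐᵒᵖ M]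

/-- The Hochschild coboundary of a map of `n` variables; `P` acts on `M` through `ε`. -/
def hochschildCoboundary (n : ℕ) (f : (Fin n → P.carrier) → M) (r : Fin (n + 1) → P.carrier) : M :=
  P.ε (r 0) • f (fun i => r i.succ)
    + ∑ i : Fin n, (-1 : ℤ) ^ (i.1 + 1) • f (Fin.contractNth i.castSucc (· * ·) r)
    + (-1 : ℤ) ^ (n + 1) • op (P.ε (r (Fin.last n))) • f (fun i => r i.castSucc)

/-- The composite of a map of `n` variables with the differential of `P ⊗ ⋯ ⊗ P`,
`d (r₁ ⊗ ⋯ ⊗ rₙ) = ∑ i, ± r₁ ⊗ ⋯ ⊗ d rᵢ ⊗ ⋯ ⊗ rₙ`, with the sign `(-1) ^ (|r₁| + ⋯ + |rᵢ₋₁|)`. -/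
noncomputable def internalCoboundary (n : ℕ) (f : (Fin n → P.carrier) → M)
    (r : Fin n → P.carrier) : M :=
  ∑ i : Fin n, f (fun j => if j < i then P.sign (r j) else if j = i then P.d (r j) else r j)

/-- The differential of the total complex of the Hochschild bicomplex. -/
noncomputable def differential : P.RawCochain M →+ P.RawCochain M where
  toFun f
    | 0, _ => 0
    | n + 1, r => P.hochschildCoboundary M n (f n) r
        + (-1 : ℤ) ^ (n + 1) • P.internalCoboundary M (n + 1) (f (n + 1)) r
  map_zero' := by
    funext n r
    cases n <;> simp [hochschildCoboundary, internalCoboundary]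
  map_add' f g := by
    funext n r
    cases n with
    | zero => simp
    | succ n =>
      simp only [hochschildCoboundary, internalCoboundary, Pi.add_apply, smul_add,
        Finset.sum_add_distrib]
      abel

/-- The cocycles of total degree `N`. -/
noncomputable def cocycles (N : ℕ) : AddSubgroup (P.RawCochain M) :=
  P.cochains M N ⊓ (P.differential M).ker

/-- The coboundaries of total degree `N`. -/
noncomputable def coboundaries : ℕ → AddSubgroup (P.RawCochain M)
  | 0 => ⊥
  | N + 1 => (P.cochains M N).map (P.differential M)

/-- The Hochschild cohomology of a chain algebra `P` over `A` with coefficients in an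
`A`-bimodule `M`. -/
abbrev HochschildCohomology (N : ℕ) : Type (max w t) :=
  P.cocycles M N ⧸ (P.coboundaries M N).addSubgroupOf (P.cocycles M N)

end

end ChainAlgebraOver

/-- A homomorphism of rings `g : A → A'` with a compatible homomorphism `h : M' → M` from an
`A'`-bimodule to an `A`-bimodule. -/
structure BimoduleHom (A : Type u) [Ring A] (M : Type t) [AddCommGroup M] [Module A M]
    [Module Aᵐᵒᵖ M] (A' : Type u') [Ring A'] (M' : Type t') [AddCommGroup M'] [Module A' M']
    [Module A'ᵐᵒᵖ M'] where
  g : A →+* A'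
  h : M' →+ M
  map_smul : ∀ (a : A) (m : M'), h (g a • m) = a • h m
  map_op_smul : ∀ (a : A) (m : M'), h (op (g a) • m) = op a • h m

namespace ChainAlgebraOver

section Maps

variable {K : Type v} [CommRing K] {A : Type u} [Ring A] [Algebra K A]
  {K' : Type v'} [CommRing K'] {A' : Type u'} [Ring A'] [Algebra K' A'] [Algebra K K']

/-- A morphism from a chain algebra over `K` to a chain algebra over the `K`-algebra `K'` that
lies over a ring homomorphism `g`. -/
structure Hom (P : ChainAlgebraOver.{v, w} K A) (Q : ChainAlgebraOver.{v', w'} K' A')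
    (g : A →+* A') where
  toRingHom : P.carrier →+* Q.carrier
  map_algebraMap : ∀ k : K, toRingHom (algebraMap K P.carrier k)
    = algebraMap K' Q.carrier (algebraMap K K' k)
  map_mem : ∀ n, ∀ x ∈ P.grading n, toRingHom x ∈ Q.grading n
  map_d : ∀ x, toRingHom (P.d x) = Q.d (toRingHom x)
  map_ε : ∀ x, Q.ε (toRingHom x) = g (P.ε x)

variable {P : ChainAlgebraOver.{v, w} K A} {Q : ChainAlgebraOver.{v', w'} K' A'}
  {M : Type t} [AddCommGroup M] [Module A M] [Module Aᵐᵒᵖ M]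
  {M' : Type t'} [AddCommGroup M'] [Module A' M'] [Module A'ᵐᵒᵖ M']

theorem Hom.map_sign {g : A →+* A'} (F : P.Hom Q g) (x : P.carrier) :
    F.toRingHom (P.sign x) = Q.sign (F.toRingHom x) := by
  induction x using DirectSum.Decomposition.inductionOn P.grading with
  | zero => simp
  | homogeneous m =>
    rw [P.sign_of_mem m.2, Q.sign_of_mem (F.map_mem _ _ m.2), map_zsmul]
  | add m m' h h' => simp only [map_add, h, h']

/-- The map of cochains `f ↦ h ∘ f ∘ F` induced by a morphism of chain algebras. -/
def Hom.cochainMap (φ : BimoduleHom A M A' M') (F : P.Hom Q φ.g) :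
    Q.RawCochain M' →+ P.RawCochain M where
  toFun f n r := φ.h (f n (F.toRingHom ∘ r))
  map_zero' := by funext n r; simp
  map_add' f f' := by funext n r; simp

theorem Hom.cochainMap_mem (φ : BimoduleHom A M A' M') (F : P.Hom Q φ.g) {N : ℕ}
    {f : Q.RawCochain M'} (hf : f ∈ Q.cochains M' N) :
    F.cochainMap φ f ∈ P.cochains M N := by
  obtain ⟨h₁, h₂, h₃⟩ := hf
  refine ⟨fun n r i x y => ?_, fun n r i k x => ?_, fun n deg r hr hn => ?_⟩
  · change φ.h (f n (F.toRingHom ∘ _)) = φ.h (f n (F.toRingHom ∘ _)) + φ.h (f n (F.toRingHom ∘ _))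
    simp only [Function.comp_update, map_add, h₁]
  · change φ.h (f n (F.toRingHom ∘ _)) = _ • φ.h (f n (F.toRingHom ∘ _))
    have key : algebraMap K' A' (algebraMap K K' k) = φ.g (algebraMap K A k) := by
      have := F.map_ε (algebraMap K P.carrier k)
      rwa [F.map_algebraMap, AlgHom.commutes, AlgHom.commutes] at this
    rw [Function.comp_update, Function.comp_update, Algebra.smul_def, map_mul, F.map_algebraMap,
      ← Algebra.smul_def, h₂, key, φ.map_smul]
  · change φ.h (f n (F.toRingHom ∘ _)) = 0
    rw [h₃ n deg (F.toRingHom ∘ r) (fun i => F.map_mem _ _ (hr i)) hn, map_zero]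

theorem Hom.cochainMap_differential (φ : BimoduleHom A M A' M') (F : P.Hom Q φ.g)
    (f : Q.RawCochain M') :
    P.differential M (F.cochainMap φ f) = F.cochainMap φ (Q.differential M' f) := by
  have hint : ∀ (n : ℕ) (r : Fin n → P.carrier),
      P.internalCoboundary M n (F.cochainMap φ f n) r
        = φ.h (Q.internalCoboundary M' n (f n) (F.toRingHom ∘ r)) := by
    intro n r
    simp only [internalCoboundary, map_sum]
    refine Finset.sum_congr rfl fun i _ => ?_
    change φ.h (f n _) = φ.h (f n _)
    congr 2
    funext j
    simp only [Function.comp_apply]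
    split_ifs
    · exact F.map_sign _
    · exact F.map_d _
    · rfl
  funext n r
  cases n with
  | zero => exact (map_zero φ.h).symm
  | succ n =>
    change P.hochschildCoboundary M n (F.cochainMap φ f n) r
        + (-1 : ℤ) ^ (n + 1) • P.internalCoboundary M (n + 1) (F.cochainMap φ f (n + 1)) r
      = φ.h (Q.hochschildCoboundary M' n (f n) (F.toRingHom ∘ r)
        + (-1 : ℤ) ^ (n + 1) • Q.internalCoboundary M' (n + 1) (f (n + 1)) (F.toRingHom ∘ r))
    rw [hint, map_add, map_zsmul]
    congr 1
    simp only [hochschildCoboundary, map_add, map_sum, map_zsmul, Function.comp_apply, F.map_ε,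
      φ.map_smul, φ.map_op_smul]
    congr 2
    refine Finset.sum_congr rfl fun i _ => ?_
    congr 1
    change φ.h (f n (F.toRingHom ∘ _)) = φ.h (f n _)
    rw [Fin.comp_contractNth _ (· * ·) (map_mul F.toRingHom)]

/-- The homomorphism induced on Hochschild cohomology by a morphism of chain algebras. -/
noncomputable def Hom.cohomologyMap (φ : BimoduleHom A M A' M') (F : P.Hom Q φ.g) (N : ℕ) :
    Q.HochschildCohomology M' N →+ P.HochschildCohomology M N :=
  QuotientAddGroup.map _ _
    (((F.cochainMap φ).comp (Q.cocycles M' N).subtype).codRestrict (P.cocycles M N) fun f =>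
      ⟨F.cochainMap_mem φ f.2.1, by
        change P.differential M (F.cochainMap φ f) = 0
        rw [F.cochainMap_differential, show Q.differential M' f = 0 from f.2.2, map_zero]⟩)
    (by
      rintro ⟨f, hf⟩ hb
      cases N with
      | zero =>
        have : f = 0 := hb
        subst this
        exact show F.cochainMap φ 0 = 0 from map_zero _
      | succ N =>
        obtain ⟨e, he, hef⟩ := hb
        exact ⟨F.cochainMap φ e, F.cochainMap_mem φ he,
          (F.cochainMap_differential φ e).trans (congrArg _ hef)⟩)

end Maps

end ChainAlgebraOver

section FreeResolution

/-! ### Twisted derivations of free algebras -/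

section Twisted

variable {K : Type v} [CommRing K] {G : Type u} (deg : G → ℕ) (δ : G → FreeAlgebra K G)

/-- Auxiliary algebra homomorphism `x ↦ !![τ x, D x; 0, x]`, where `τ` is the grading involution
and `D` the twisted derivation extending `δ`. -/
noncomputable def twistedMatrix :
    FreeAlgebra K G →ₐ[K] Matrix (Fin 2) (Fin 2) (FreeAlgebra K G) :=
  FreeAlgebra.lift K fun g =>
    !![(-1) ^ deg g * FreeAlgebra.ι K g, δ g; 0, FreeAlgebra.ι K g]

/-- The derivation `D` of the free algebra with `D g = δ g` on generators and
`D (x * y) = D x * y + (-1) ^ |x| * x * D y`. -/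
noncomputable def twistedDerivation : FreeAlgebra K G →ₗ[K] FreeAlgebra K G where
  toFun x := twistedMatrix deg δ x 0 1
  map_add' x y := by simp
  map_smul' k x := by simp

/-- The product of the generators in a list. -/
noncomputable def word (l : List G) : FreeAlgebra K G := (l.map (FreeAlgebra.ι K)).prod

/-- The total degree of a list of generators. -/
def wordDeg (l : List G) : ℕ := (l.map deg).sum

/-- The span of the products of generators of total degree `n`. -/
def freeGrading (n : ℕ) : Submodule K (FreeAlgebra K G) :=
  Submodule.span K {x | ∃ l, wordDeg deg l = n ∧ word l = x}

theorem twistedMatrix_ι (g : G) : twistedMatrix (K := K) deg δ (FreeAlgebra.ι K g)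
    = !![(-1) ^ deg g * FreeAlgebra.ι K g, δ g; 0, FreeAlgebra.ι K g] := by
  simp [twistedMatrix]

theorem twistedMatrix_lower (x : FreeAlgebra K G) :
    twistedMatrix deg δ x 1 0 = 0 ∧ twistedMatrix deg δ x 1 1 = x := by
  induction x with
  | grade0 r => simp [Matrix.algebraMap_matrix_apply]
  | grade1 g => simp [twistedMatrix_ι]
  | mul a b ha hb => simp [Matrix.mul_apply, Fin.sum_univ_two, ha, hb]
  | add a b ha hb => simp [ha, hb]

theorem twistedDerivation_ι (g : G) :
    twistedDerivation deg δ (FreeAlgebra.ι K g) = δ g := by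
  simp [twistedDerivation, twistedMatrix_ι]

theorem twistedDerivation_mul (x y : FreeAlgebra K G) :
    twistedDerivation deg δ (x * y) = twistedDerivation deg δ x * y
      + twistedMatrix deg δ x 0 0 * twistedDerivation deg δ y := by
  simp [twistedDerivation, Matrix.mul_apply, Fin.sum_univ_two, (twistedMatrix_lower deg δ y).2,
    add_comm]

theorem twistedDerivation_one : twistedDerivation (K := K) deg δ 1 = 0 := by
  simp [twistedDerivation]

theorem twistedMatrix_word (l : List G) :
    twistedMatrix (K := K) deg δ (word l) 0 0 = (-1) ^ wordDeg deg l * word l := by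
  induction l with
  | nil => simp [word, wordDeg]
  | cons g l ih =>
    have : word (K := K) (g :: l) = FreeAlgebra.ι K g * word l := by simp [word]
    rw [this, map_mul, Matrix.mul_apply, Fin.sum_univ_two, ih, (twistedMatrix_lower deg δ _).1,
      twistedMatrix_ι]
    have hc : (-1 : FreeAlgebra K G) ^ wordDeg deg l * FreeAlgebra.ι K g
        = FreeAlgebra.ι K g * (-1) ^ wordDeg deg l :=
      ((Commute.neg_one_left _).pow_left _).eq
    simp only [Matrix.of_apply, Matrix.cons_val', Matrix.cons_val_zero, Matrix.cons_val_fin_one,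
      mul_zero, add_zero, wordDeg, List.map_cons, List.sum_cons, pow_add]
    simp only [wordDeg] at hc
    rw [mul_assoc, ← mul_assoc (FreeAlgebra.ι K g), ← hc]
    simp only [mul_assoc]

theorem twistedMatrix_of_mem {n : ℕ} {x : FreeAlgebra K G} (hx : x ∈ freeGrading deg n) :
    twistedMatrix deg δ x 0 0 = (-1) ^ n * x := by
  induction hx using Submodule.span_induction with
  | mem x h => obtain ⟨l, rfl, rfl⟩ := h; exact twistedMatrix_word deg δ l
  | zero => simp
  | add x y _ _ hx hy => simp [hx, hy, mul_add]
  | smul a x _ hx => simp [hx]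

theorem word_mem (l : List G) : word l ∈ freeGrading (K := K) deg (wordDeg deg l) :=
  Submodule.subset_span ⟨l, rfl, rfl⟩

theorem ι_mem (g : G) : FreeAlgebra.ι K g ∈ freeGrading (K := K) deg (deg g) :=
  Submodule.subset_span ⟨[g], by simp [wordDeg], by simp [word]⟩

instance freeGradedMonoid : SetLike.GradedMonoid (freeGrading (K := K) deg) where
  one_mem := Submodule.subset_span ⟨[], by simp [wordDeg], by simp [word]⟩
  mul_mem m n x y hx hy := by
    induction hx using Submodule.span_induction with
    | zero => simp
    | add x x' _ _ hx hx' => rw [add_mul]; exact add_mem hx hx'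
    | smul a x _ hx => rw [smul_mul_assoc]; exact Submodule.smul_mem _ _ hx
    | mem x h =>
      obtain ⟨l, rfl, rfl⟩ := h
      induction hy using Submodule.span_induction with
      | zero => simp
      | add x x' _ _ hx hx' => rw [mul_add]; exact add_mem hx hx'
      | smul a x _ hx => rw [mul_smul_comm]; exact Submodule.smul_mem _ _ hx
      | mem y h =>
        obtain ⟨l', rfl, rfl⟩ := h
        exact Submodule.subset_span ⟨l ++ l', by simp [wordDeg], by simp [word]⟩

/-- The decomposition of the free algebra by degree. -/
noncomputable def freeDecompose :
    FreeAlgebra K G →ₐ[K] DirectSum ℕ fun n => freeGrading (K := K) deg n :=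
  FreeAlgebra.lift K fun g =>
    DirectSum.of (fun n => freeGrading (K := K) deg n) (deg g) ⟨FreeAlgebra.ι K g, ι_mem deg g⟩

theorem freeDecompose_word (l : List G) : freeDecompose (K := K) deg (word l)
    = DirectSum.of (fun n => freeGrading (K := K) deg n) (wordDeg deg l)
      ⟨word l, word_mem deg l⟩ := by
  induction l with
  | nil =>
    exact (congrArg _ (show word (K := K) ([] : List G) = 1 by simp [word])).trans (map_one _)
  | cons g l ih =>
    have : word (K := K) (g :: l) = FreeAlgebra.ι K g * word l := by simp [word]
    refine (congrArg _ this).trans ?_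
    rw [map_mul, ih]
    simp only [freeDecompose, FreeAlgebra.lift_ι_apply]
    rw [DirectSum.of_mul_of]
    exact DirectSum.of_eq_of_gradedMonoid_eq (Sigma.subtype_ext
      (by change deg g + wordDeg deg l = wordDeg deg (g :: l); simp [wordDeg]) this.symm)

noncomputable instance freeGraded : GradedAlgebra (freeGrading (K := K) deg) :=
  GradedAlgebra.ofAlgHom _ (freeDecompose deg)
    (by
      ext g
      simp [freeDecompose])
    (by
      rintro n ⟨x, hx⟩
      change freeDecompose deg x = _
      induction hx using Submodule.span_induction with
      | mem x h =>
        obtain ⟨l, rfl, rfl⟩ := h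
        exact freeDecompose_word deg l
      | zero => rw [map_zero]; exact (map_zero (DirectSum.of _ n)).symm
      | add x y hx hy h h' =>
        rw [map_add, h, h', ← map_add]; rfl
      | smul a x hx h =>
        rw [map_smul, h]
        exact (map_smul (DirectSum.lof K ℕ (fun n => freeGrading (K := K) deg n) n) a ⟨x, hx⟩).symm)

/-- The component of degree `n - 1`, which is zero for `n = 0`. -/
def predGrading : ℕ → Submodule K (FreeAlgebra K G)
  | 0 => ⊥
  | n + 1 => freeGrading deg n

theorem predGrading_mul {m n : ℕ} {x y : FreeAlgebra K G} (hx : x ∈ predGrading deg m)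
    (hy : y ∈ freeGrading deg n) : x * y ∈ predGrading deg (m + n) := by
  cases m with
  | zero =>
    have : x = 0 := hx
    simp [this]
  | succ m =>
    rw [show m + 1 + n = m + n + 1 by omega]
    exact SetLike.mul_mem_graded (A := freeGrading (K := K) deg) hx hy

theorem mul_predGrading {m n : ℕ} {x y : FreeAlgebra K G} (hx : x ∈ freeGrading deg m)
    (hy : y ∈ predGrading deg n) : x * y ∈ predGrading deg (m + n) := by
  cases n with
  | zero =>
    have : y = 0 := hy
    simp [this]
  | succ n => exact SetLike.mul_mem_graded (A := freeGrading (K := K) deg) hx hy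

theorem neg_one_pow_mul_mem {n : ℕ} (m : ℕ) {x : FreeAlgebra K G}
    (hx : x ∈ freeGrading deg n) : (-1) ^ m * x ∈ freeGrading deg n := by
  rcases neg_one_pow_eq_or (FreeAlgebra K G) m with h | h <;> simp [h, hx]

theorem twistedDerivation_mem (hδ : ∀ g, δ g ∈ predGrading deg (deg g)) {n : ℕ}
    {x : FreeAlgebra K G} (hx : x ∈ freeGrading deg n) :
    twistedDerivation deg δ x ∈ predGrading deg n := by
  induction hx using Submodule.span_induction with
  | zero => simp
  | add x y _ _ h h' => rw [map_add]; exact add_mem h h'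
  | smul a x _ h => rw [map_smul]; exact Submodule.smul_mem _ _ h
  | mem x h =>
    obtain ⟨l, rfl, rfl⟩ := h
    induction l with
    | nil =>
      rw [show word (K := K) ([] : List G) = 1 by simp [word], twistedDerivation_one]
      exact zero_mem _
    | cons g l ih =>
      rw [show word (K := K) (g :: l) = FreeAlgebra.ι K g * word l by simp [word],
        show wordDeg deg (g :: l) = deg g + wordDeg deg l by simp [wordDeg],
        twistedDerivation_mul, twistedDerivation_ι, twistedMatrix_of_mem deg δ (ι_mem deg g)]
      exact add_mem (predGrading_mul deg (hδ g) (word_mem deg l))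
        (mul_predGrading deg (neg_one_pow_mul_mem deg _ (ι_mem deg g)) ih)

theorem mem_span_word (x : FreeAlgebra K G) :
    x ∈ Submodule.span K (Set.range (word (K := K) (G := G))) := by
  induction x using DirectSum.Decomposition.inductionOn
    (freeGrading (K := K) fun _ : G => 0) with
  | zero => exact zero_mem _
  | add x y h h' => exact add_mem h h'
  | homogeneous x =>
    exact Submodule.span_mono (by rintro _ ⟨l, -, rfl⟩; exact ⟨l, rfl⟩) x.2

theorem twistedDerivation_twistedDerivation (hδ : ∀ g, δ g ∈ predGrading deg (deg g))
    (hδδ : ∀ g, twistedDerivation deg δ (δ g) = 0) (x : FreeAlgebra K G) :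
    twistedDerivation deg δ (twistedDerivation deg δ x) = 0 := by
  induction mem_span_word x using Submodule.span_induction with
  | zero => simp
  | add x y _ _ h h' => simp [h, h']
  | smul a x _ h => simp [h]
  | mem x h =>
    obtain ⟨l, rfl⟩ := h
    induction l with
    | nil =>
      rw [show word (K := K) ([] : List G) = 1 by simp [word], twistedDerivation_one, map_zero]
    | cons g l ih =>
      have hs : ∀ (n : ℕ) (y : FreeAlgebra K G), twistedDerivation deg δ ((-1) ^ n * y)
          = (-1) ^ n * twistedDerivation deg δ y := by
        intro n y
        rcases neg_one_pow_eq_or (FreeAlgebra K G) n with h | h <;> simp [h]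
      rw [show word (K := K) (g :: l) = FreeAlgebra.ι K g * word l by simp [word],
        twistedDerivation_mul, twistedDerivation_ι, twistedMatrix_of_mem deg δ (ι_mem deg g),
        map_add, twistedDerivation_mul, hδδ, mul_assoc, hs, twistedDerivation_mul,
        twistedDerivation_ι, ih, twistedMatrix_of_mem deg δ (ι_mem deg g)]
      have h := hδ g
      cases hg : deg g with
      | zero =>
        rw [hg] at h
        have h0 : δ g = 0 := h
        simp [h0, twistedMatrix]
      | succ n =>
        rw [hg] at h
        rw [twistedMatrix_of_mem deg δ (n := n) h, pow_succ]
        simp [mul_assoc]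

/-- The chain algebra structure on a free algebra given by a differential on generators. -/
noncomputable def freeChainAlgebra (hδ : ∀ g, δ g ∈ predGrading deg (deg g))
    (hδδ : ∀ g, twistedDerivation deg δ (δ g) = 0) : ChainAlgebra K where
  carrier := FreeAlgebra K G
  grading := freeGrading deg
  d := twistedDerivation deg δ
  d_mem n x hx := twistedDerivation_mem deg δ hδ hx
  d_zero x hx := twistedDerivation_mem deg δ hδ hx
  d_d := twistedDerivation_twistedDerivation deg δ hδ hδδ
  leibniz n x hx y := by
    rw [twistedDerivation_mul, twistedMatrix_of_mem deg δ hx, mul_assoc]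

end Twisted

/-! ### A quasi-free chain algebra that is weakly equivalent to a given algebra -/

/-- Generators: one generator of degree `0` for each element of `A`, and one generator of degree
`n + 1` for each formal linear combination of words in generators (only those that represent
cycles of degree `n` will be used). -/
inductive Gen (K : Type v) (A : Type u) : Type (max u v)
  | base : A → Gen K A
  | cell : ℕ → List (K × List (Gen K A)) → Gen K A

namespace Gen

variable {K : Type v} [CommRing K] {A : Type u} [Ring A] [Algebra K A]

/-- The degree of a generator. -/
def deg : Gen K A → ℕ
  | base _ => 0
  | cell n _ => n + 1

/-- The linear combination of words that a list represents. -/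
noncomputable def eval {G : Type*} (z : List (K × List G)) : FreeAlgebra K G :=
  (z.map fun q => q.1 • word q.2).sum

/-- The differential on generators. -/
noncomputable def diff : Gen K A → FreeAlgebra K (Gen K A)
  | base _ => 0
  | cell _ z => eval z

/-- The augmentation on generators. -/
def augGen : Gen K A → A
  | base a => a
  | cell _ _ => 0

/-- The generators that are attached to kill cycles. -/
inductive Valid : Gen K A → Prop
  | base (a : A) : Valid (base a)
  | cell (n : ℕ) (z : List (K × List (Gen K A)))
      (hv : ∀ q ∈ z, ∀ g ∈ q.2, Valid g)
      (hdeg : ∀ q ∈ z, wordDeg deg q.2 = n)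
      (hd : twistedDerivation deg diff (eval z) = 0)
      (hε : FreeAlgebra.lift K (augGen (K := K) (A := A)) (eval z) = 0) : Valid (cell n z)

/-- The set of generators of the resolution. -/
abbrev VGen (K : Type v) [CommRing K] (A : Type u) [Ring A] [Algebra K A] : Type (max u v) :=
  {g : Gen K A // Valid g}

open Classical in
/-- The projection of the free algebra on all generators to that on the valid ones. -/
noncomputable def proj : FreeAlgebra K (Gen K A) →ₐ[K] FreeAlgebra K (VGen K A) :=
  FreeAlgebra.lift K fun g => if h : Valid g then FreeAlgebra.ι K ⟨g, h⟩ else 0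

/-- The inclusion of the free algebra on the valid generators. -/
noncomputable def incl : FreeAlgebra K (VGen K A) →ₐ[K] FreeAlgebra K (Gen K A) :=
  FreeAlgebra.lift K fun g => FreeAlgebra.ι K g.1

/-- The degree of a valid generator. -/
def vdeg (g : VGen K A) : ℕ := deg g.1

/-- The differential of a valid generator. -/
noncomputable def vdiff (g : VGen K A) : FreeAlgebra K (VGen K A) := proj (diff g.1)

theorem proj_incl (x : FreeAlgebra K (VGen K A)) : proj (incl x) = x := by
  have : (proj (K := K) (A := A)).comp incl = AlgHom.id K _ := by
    ext g
    simp [proj, incl, g.2]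
  exact DFunLike.congr_fun this x

theorem incl_word (l : List (VGen K A)) :
    incl (word l) = word (K := K) (l.map Subtype.val) := by
  simp only [word, map_list_prod, List.map_map]
  congr 1
  refine List.map_congr_left fun g _ => ?_
  simp [incl]

theorem proj_word_mem (l : List (Gen K A)) (hl : ∀ g ∈ l, Valid g) :
    ∃ l' : List (VGen K A), l'.map Subtype.val = l :=
  ⟨l.attachWith _ hl, by simp⟩

theorem incl_proj_eval (z : List (K × List (Gen K A))) (hz : ∀ q ∈ z, ∀ g ∈ q.2, Valid g) :
    incl (proj (eval z)) = eval z := by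
  induction z with
  | nil => simp [eval]
  | cons q z ih =>
    have hq : eval (q :: z) = q.1 • word q.2 + eval z := by simp [eval]
    obtain ⟨l, hl⟩ := proj_word_mem q.2 (hz q (by simp))
    rw [hq, map_add, map_add, ih fun q hq => hz q (by simp [hq]), map_smul, map_smul, ← hl,
      ← incl_word, proj_incl]

theorem incl_vdiff (g : VGen K A) : incl (vdiff g) = diff g.1 := by
  obtain ⟨g, hg⟩ := g
  cases hg with
  | base a => simp [vdiff, diff]
  | cell n z hv hdeg hd hε => exact incl_proj_eval z hv

theorem vdiff_mem (g : VGen K A) : vdiff g ∈ predGrading vdeg (vdeg g) := by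
  obtain ⟨g, hg⟩ := g
  cases hg with
  | base a => simp [vdiff, diff]
  | cell n z hv hdeg hd hε =>
    change proj (eval z) ∈ freeGrading vdeg n
    rw [eval, map_list_sum]
    refine list_sum_mem ?_
    intro x hx
    rw [List.map_map] at hx
    obtain ⟨q, hq, rfl⟩ := List.mem_map.1 hx
    obtain ⟨l, hl⟩ := proj_word_mem q.2 (hv q hq)
    have hw : proj (word (K := K) q.2) = word l := by rw [← hl, ← incl_word, proj_incl]
    simp only [Function.comp_apply, map_smul, hw]
    refine Submodule.smul_mem _ _ (Submodule.subset_span ⟨l, ?_, rfl⟩)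
    rw [← hdeg q hq, ← hl]
    simp only [wordDeg, List.map_map]
    rfl

theorem incl_twistedDerivation (x : FreeAlgebra K (VGen K A)) :
    incl (twistedDerivation vdeg vdiff x) = twistedDerivation deg diff (incl x) := by
  induction mem_span_word x using Submodule.span_induction with
  | zero => simp
  | add x y _ _ h h' => simp [h, h']
  | smul a x _ h => simp [h]
  | mem x h =>
    obtain ⟨l, rfl⟩ := h
    induction l with
    | nil =>
      rw [show word (K := K) ([] : List (VGen K A)) = 1 by simp [word], twistedDerivation_one,
        map_zero, map_one, twistedDerivation_one]
    | cons g l ih =>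
      rw [show word (K := K) (g :: l) = FreeAlgebra.ι K g * word l by simp [word],
        twistedDerivation_mul, map_mul, twistedDerivation_mul, map_add, map_mul, map_mul, ih,
        show incl (FreeAlgebra.ι K g) = FreeAlgebra.ι K g.1 by simp [incl],
        twistedDerivation_ι, twistedDerivation_ι, incl_vdiff, twistedMatrix_ι, twistedMatrix_ι]
      simp [incl, vdeg]

/-- The augmentation on valid generators. -/
noncomputable def aug : FreeAlgebra K (VGen K A) →ₐ[K] A :=
  FreeAlgebra.lift K fun g => augGen g.1

theorem lift_augGen_incl (x : FreeAlgebra K (VGen K A)) :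
    FreeAlgebra.lift K (augGen (K := K) (A := A)) (incl x) = aug x := by
  have : (FreeAlgebra.lift K (augGen (K := K) (A := A))).comp incl = aug := by
    ext g
    simp [incl, aug]
  exact DFunLike.congr_fun this x

theorem aug_pos (n : ℕ) (x : FreeAlgebra K (VGen K A)) (hx : x ∈ freeGrading vdeg (n + 1)) :
    aug x = 0 := by
  induction hx using Submodule.span_induction with
  | zero => simp
  | add x y _ _ h h' => simp [h, h']
  | smul a x _ h => simp [h]
  | mem x h =>
    obtain ⟨l, hl, rfl⟩ := h
    have : ∃ g ∈ l, vdeg g ≠ 0 := by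
      by_contra! hc
      have : wordDeg vdeg l = 0 := by
        simp only [wordDeg]
        refine List.sum_eq_zero ?_
        intro k hk
        obtain ⟨g, hg, rfl⟩ := List.mem_map.1 hk
        exact hc g hg
      omega
    obtain ⟨g, hg, hg0⟩ := this
    rw [word, map_list_prod]
    refine List.prod_eq_zero ?_
    rw [List.map_map]
    refine List.mem_map.2 ⟨g, hg, ?_⟩
    obtain ⟨g, hg⟩ := g
    cases g with
    | base a => simp [vdeg, deg] at hg0
    | cell n z => simp [aug, augGen]

theorem vdiff_vdiff (g : VGen K A) : twistedDerivation vdeg vdiff (vdiff g) = 0 := by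
  rw [← proj_incl (twistedDerivation vdeg vdiff (vdiff g)), incl_twistedDerivation, incl_vdiff]
  obtain ⟨g, hg⟩ := g
  cases hg with
  | base a => simp [diff]
  | cell n z hv hdeg hd hε => simp only [diff]; rw [hd, map_zero]

theorem aug_vdiff (g : VGen K A) : aug (vdiff g) = 0 := by
  rw [← lift_augGen_incl, incl_vdiff]
  obtain ⟨g, hg⟩ := g
  cases hg with
  | base a => simp [diff]
  | cell n z hv hdeg hd hε => exact hε

theorem aug_twistedDerivation (x : FreeAlgebra K (VGen K A)) :
    aug (twistedDerivation vdeg vdiff x) = 0 := by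
  induction mem_span_word x using Submodule.span_induction with
  | zero => simp
  | add x y _ _ h h' => simp [h, h']
  | smul a x _ h => simp [h]
  | mem x h =>
    obtain ⟨l, rfl⟩ := h
    induction l with
    | nil =>
      rw [show word (K := K) ([] : List (VGen K A)) = 1 by simp [word], twistedDerivation_one,
        map_zero]
    | cons g l ih =>
      rw [show word (K := K) (g :: l) = FreeAlgebra.ι K g * word l by simp [word],
        twistedDerivation_mul, map_add, map_mul, map_mul, ih, twistedDerivation_ι, aug_vdiff]
      simp

/-- The quasi-free chain algebra over `A` on the valid generators. -/
noncomputable def freeOver (K : Type v) [CommRing K] (A : Type u) [Ring A] [Algebra K A] :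
    ChainAlgebraOver.{v, max u v} K A where
  toChainAlgebra := freeChainAlgebra vdeg vdiff vdiff_mem vdiff_vdiff
  ε := aug
  ε_pos := aug_pos
  ε_d := aug_twistedDerivation

theorem freeOver_isQuasiFree : (freeOver K A).IsQuasiFree := by
  refine ⟨VGen K A, vdeg, FreeAlgebra.ι K, fun g => ι_mem vdeg g, ?_⟩
  have : FreeAlgebra.lift K (FreeAlgebra.ι K (X := VGen K A)) = AlgHom.id K _ := by
    ext g
    simp
  change Function.Bijective (FreeAlgebra.lift K (FreeAlgebra.ι K (X := VGen K A)))
  rw [this]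
  exact Function.bijective_id

theorem exists_list {n : ℕ} {x : FreeAlgebra K (VGen K A)} (hx : x ∈ freeGrading vdeg n) :
    ∃ z : List (K × List (Gen K A)), (∀ q ∈ z, ∀ g ∈ q.2, Valid g) ∧
      (∀ q ∈ z, wordDeg deg q.2 = n) ∧ eval z = incl x := by
  induction hx using Submodule.span_induction with
  | zero => exact ⟨[], by simp, by simp, by simp [eval]⟩
  | add x y _ _ h h' =>
    obtain ⟨z, h₁, h₂, h₃⟩ := h
    obtain ⟨z', h₁', h₂', h₃'⟩ := h'
    refine ⟨z ++ z', ?_, ?_, ?_⟩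
    · intro q hq
      rcases List.mem_append.1 hq with h | h
      exacts [h₁ q h, h₁' q h]
    · intro q hq
      rcases List.mem_append.1 hq with h | h
      exacts [h₂ q h, h₂' q h]
    · rw [map_add, ← h₃, ← h₃']
      simp [eval]
  | smul a x _ h =>
    obtain ⟨z, h₁, h₂, h₃⟩ := h
    refine ⟨z.map fun q => (a * q.1, q.2), ?_, ?_, ?_⟩
    · intro q hq
      obtain ⟨q', hq', rfl⟩ := List.mem_map.1 hq
      exact h₁ q' hq'
    · intro q hq
      obtain ⟨q', hq', rfl⟩ := List.mem_map.1 hq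
      exact h₂ q' hq'
    · rw [map_smul, ← h₃]
      simp [eval, List.smul_sum, List.map_map, Function.comp_def, mul_smul]
  | mem x h =>
    obtain ⟨l, hl, rfl⟩ := h
    refine ⟨[(1, l.map Subtype.val)], ?_, ?_, ?_⟩
    · intro q hq g hg
      rw [List.mem_singleton.1 hq] at hg
      obtain ⟨g', -, rfl⟩ := List.mem_map.1 hg
      exact g'.2
    · intro q hq
      rw [List.mem_singleton.1 hq, ← hl]
      simp only [wordDeg, List.map_map]
      rfl
    · rw [incl_word]
      simp [eval]

theorem vdiff_cell (n : ℕ) (z : List (K × List (Gen K A))) (hv : Valid (cell n z)) :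
    vdiff ⟨cell n z, hv⟩ = proj (eval z) := rfl

theorem ι_cell_mem (n : ℕ) (z : List (K × List (Gen K A))) (hv : Valid (cell n z)) :
    FreeAlgebra.ι K ⟨cell n z, hv⟩ ∈ freeGrading (K := K) (vdeg (K := K) (A := A)) (n + 1) :=
  ι_mem (K := K) (vdeg (K := K) (A := A)) ⟨cell n z, hv⟩

theorem exists_boundary {n : ℕ} {x : FreeAlgebra K (VGen K A)} (hx : x ∈ freeGrading vdeg n)
    (hd : twistedDerivation vdeg vdiff x = 0) (hε : aug x = 0) :
    ∃ y ∈ freeGrading vdeg (n + 1), twistedDerivation vdeg vdiff y = x := by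
  obtain ⟨z, h₁, h₂, h₃⟩ := exists_list hx
  have hz₁ : twistedDerivation deg diff (eval z) = 0 := by
    rw [h₃, ← incl_twistedDerivation, hd, map_zero]
  have hz₂ : FreeAlgebra.lift K (augGen (K := K) (A := A)) (eval z) = 0 := by
    rw [h₃, lift_augGen_incl, hε]
  have hv : Valid (cell n z) := Valid.cell n z h₁ h₂ hz₁ hz₂
  refine ⟨FreeAlgebra.ι K ⟨cell n z, hv⟩, ι_cell_mem n z hv, ?_⟩
  rw [twistedDerivation_ι, vdiff_cell, h₃, proj_incl]

theorem aug_ι_base (a : A) :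
    aug (FreeAlgebra.ι K (⟨base a, .base a⟩ : VGen K A)) = a := by
  simp [aug, augGen]

theorem freeOver_isWeakEquivalence : (freeOver K A).IsWeakEquivalence where
  surjective a := ⟨FreeAlgebra.ι K (⟨base a, .base a⟩ : VGen K A),
    ι_mem (K := K) (vdeg (K := K) (A := A)) ⟨base a, .base a⟩, aug_ι_base a⟩
  exact_zero _ hx hε :=
    exists_boundary hx (twistedDerivation_mem vdeg vdiff vdiff_mem hx) hε
  exact_succ n _ hx hd := exists_boundary hx hd (aug_pos n _ hx)

end Gen

end FreeResolution

namespace ChainAlgebraOver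

section Lifting

variable {K : Type v} [CommRing K] {A : Type u} [Ring A] [Algebra K A]
  {K' : Type v'} [CommRing K'] {A' : Type u'} [Ring A'] [Algebra K' A'] [Algebra K K']

theorem exists_strongRec {X : Type w} {Y : Type w'} [Zero Y] (deg : X → ℕ)
    (R : X → (X → Y) → Y) :
    ∃ f : X → Y, ∀ i, f i = R i (fun j => if deg j < deg i then f j else 0) := by
  refine ⟨(measure deg).wf.fix fun i ih => R i (fun j => if h : deg j < deg i then ih j h else 0),
    fun i => ?_⟩
  rw [WellFounded.fix_eq]
  congr 1

theorem letter_le {X : Type w} (deg : X → ℕ) {l : List X} {i : X} (hi : i ∈ l) :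
    deg i ≤ wordDeg deg l :=
  List.single_le_sum (by simp) _ (List.mem_map.2 ⟨i, hi, rfl⟩)

theorem lift_word {X : Type w} {B : Type w'} [Ring B] [Algebra K B] (f : X → B) (l : List X) :
    FreeAlgebra.lift K f (word l) = (l.map f).prod := by
  simp [word, map_list_prod, Function.comp_def]

theorem lift_congr {X : Type w} {B : Type w'} [Ring B] [Algebra K B] (deg : X → ℕ) (f h : X → B)
    {m : ℕ} (hfh : ∀ i, deg i ≤ m → f i = h i) {z : FreeAlgebra K X}
    (hz : z ∈ freeGrading deg m) : FreeAlgebra.lift K f z = FreeAlgebra.lift K h z := by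
  induction hz using Submodule.span_induction with
  | zero => simp
  | add x y _ _ h h' => rw [map_add, map_add, h, h']
  | smul a x _ h => rw [map_smul, map_smul, h]
  | mem x h =>
    obtain ⟨l, rfl, rfl⟩ := h
    rw [lift_word, lift_word]
    congr 1
    exact List.map_congr_left fun i hi => hfh i (letter_le deg hi)

/-- A quasi-free chain algebra over `A` lifts to any chain algebra that is weakly equivalent
to the target of a ring homomorphism `A → A'`. -/
theorem exists_hom {P : ChainAlgebraOver.{v, w} K A} (hP : P.IsQuasiFree)
    {Q : ChainAlgebraOver.{v', w'} K' A'} (hQ : Q.IsWeakEquivalence) (g : A →+* A')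
    (hg : ∀ k, g (algebraMap K A k) = algebraMap K' A' (algebraMap K K' k)) :
    Nonempty (P.Hom Q g) := by
  classical
  let _ : Algebra K Q.carrier := Algebra.compHom Q.carrier (algebraMap K K')
  have hsmul : ∀ (k : K) (y : Q.carrier), k • y = algebraMap K K' k • y := fun _ _ => rfl
  obtain ⟨X, deg, x, hx, hbij⟩ := hP
  let e : FreeAlgebra K X ≃ₐ[K] P.carrier := AlgEquiv.ofBijective _ hbij
  have he : ∀ i, e (FreeAlgebra.ι K i) = x i := fun i => by simp [e]
  have hed : ∀ i, e.symm (x i) = FreeAlgebra.ι K i := fun i => by rw [← he, e.symm_apply_apply]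
  -- the grading of the free algebra agrees with that of `P`
  have hmem : ∀ n, ∀ z ∈ freeGrading (K := K) deg n, e z ∈ P.grading n := by
    intro n z hz
    induction hz using Submodule.span_induction with
    | zero => simp
    | add x y _ _ h h' => rw [map_add]; exact add_mem h h'
    | smul a x _ h => rw [map_smul]; exact Submodule.smul_mem _ _ h
    | mem z h =>
      obtain ⟨l, rfl, rfl⟩ := h
      induction l with
      | nil =>
        rw [show word (K := K) ([] : List X) = 1 by simp [word], map_one]
        exact SetLike.one_mem_graded P.grading
      | cons i l ih =>
        rw [show word (K := K) (i :: l) = FreeAlgebra.ι K i * word l by simp [word], map_mul, he,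
          show wordDeg deg (i :: l) = deg i + wordDeg deg l by simp [wordDeg]]
        exact SetLike.mul_mem_graded (hx i) ih
  have hmem' : ∀ n, ∀ y ∈ P.grading n, e.symm y ∈ freeGrading (K := K) deg n := by
    have key : ∀ (n : ℕ) (z : FreeAlgebra K X),
        (DirectSum.decompose P.grading (e z) n : P.carrier)
          = e (DirectSum.decompose (freeGrading (K := K) deg) z n : FreeAlgebra K X) := by
      intro n z
      induction z using DirectSum.Decomposition.inductionOn (freeGrading (K := K) deg) with
      | zero => simp
      | add a b ha hb => simp [DirectSum.decompose_add, ha, hb]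
      | @homogeneous m z =>
        by_cases hmn : m = n
        · subst hmn
          rw [DirectSum.decompose_of_mem_same _ (hmem _ _ z.2),
            DirectSum.decompose_of_mem_same _ z.2]
        · rw [DirectSum.decompose_of_mem_ne _ (hmem _ _ z.2) hmn,
            DirectSum.decompose_of_mem_ne _ z.2 hmn, map_zero]
    intro n y hy
    have h := key n (e.symm y)
    rw [e.apply_symm_apply, DirectSum.decompose_of_mem_same _ hy] at h
    rw [h, e.symm_apply_apply]
    exact SetLike.coe_mem _
  -- the images of the generators, by recursion on the degree
  let Good : X → (X → Q.carrier) → Q.carrier → Prop := fun i h y =>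
    y ∈ Q.grading (deg i) ∧ Q.d y = FreeAlgebra.lift K h (e.symm (P.d (x i))) ∧
      Q.ε y = g (P.ε (x i))
  obtain ⟨f, hf⟩ := exists_strongRec deg
    (fun i h => if H : ∃ y, Good i h y then Classical.choose H else (0 : Q.carrier))
  let F : FreeAlgebra K X →ₐ[K] Q.carrier := FreeAlgebra.lift K f
  have hF : ∀ i, F (FreeAlgebra.ι K i) = f i := fun i => by simp [F]
  have hFc : ∀ i (l : List X), F (word (i :: l)) = f i * F (word l) := by
    intro i l
    rw [show word (K := K) (i :: l) = FreeAlgebra.ι K i * word l by simp [word], map_mul, hF]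
  -- properties of words of good letters
  have words : ∀ l : List X, (∀ i ∈ l, Good i f (f i)) →
      F (word l) ∈ Q.grading (wordDeg deg l) ∧
      Q.d (F (word l)) = F (e.symm (P.d (e (word l)))) ∧
      Q.ε (F (word l)) = g (P.ε (e (word l))) := by
    intro l
    induction l with
    | nil =>
      intro _
      have h1 : P.d 1 = 0 := P.d_zero 1 (SetLike.one_mem_graded P.grading)
      have h1' : Q.d 1 = 0 := Q.d_zero 1 (SetLike.one_mem_graded Q.grading)
      rw [show word (K := K) ([] : List X) = 1 by simp [word]]
      simp only [map_one, h1, h1', map_zero]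
      exact ⟨SetLike.one_mem_graded Q.grading, trivial, trivial⟩
    | cons i l ih =>
      intro hl
      obtain ⟨h₁, h₂, h₃⟩ := ih fun j hj => hl j (by simp [hj])
      obtain ⟨g₁, g₂, g₃⟩ := hl i (by simp)
      have hw : word (K := K) (i :: l) = FreeAlgebra.ι K i * word l := by simp [word]
      refine ⟨?_, ?_, ?_⟩
      · rw [hFc, show wordDeg deg (i :: l) = deg i + wordDeg deg l by simp [wordDeg]]
        exact SetLike.mul_mem_graded g₁ h₁
      · have hew : e (word (i :: l)) = x i * e (word l) := by rw [hw, map_mul, he]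
        rw [hFc, hew, Q.leibniz _ _ g₁, P.leibniz _ _ (hx i), h₂, g₂]
        simp [hF, hed, F]
      · rw [hFc, hw, map_mul, map_mul, map_mul, map_mul, h₃, g₃, he]
  have homog : ∀ m, (∀ i, deg i ≤ m → Good i f (f i)) → ∀ z ∈ freeGrading (K := K) deg m,
      F z ∈ Q.grading m ∧ Q.d (F z) = F (e.symm (P.d (e z))) ∧ Q.ε (F z) = g (P.ε (e z)) := by
    intro m hm z hz
    induction hz using Submodule.span_induction with
    | zero => simp
    | add x y _ _ h h' =>
      simp only [map_add, h.2.1, h.2.2, h'.2.1, h'.2.2]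
      exact ⟨add_mem h.1 h'.1, trivial, trivial⟩
    | smul a x _ h =>
      refine ⟨?_, ?_, ?_⟩
      · rw [map_smul, hsmul]; exact Submodule.smul_mem _ _ h.1
      · rw [map_smul, hsmul, map_smul, h.2.1, ← hsmul]
        simp only [map_smul]
      · rw [map_smul, hsmul, map_smul, h.2.2, map_smul, map_smul, Algebra.smul_def,
          Algebra.smul_def, map_mul, hg]
    | mem z h =>
      obtain ⟨l, rfl, rfl⟩ := h
      exact words l fun i hi => hm i (letter_le deg hi)
  have good : ∀ n i, deg i = n → Good i f (f i) := by
    intro n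
    induction n using Nat.strong_induction_on with
    | _ n ih =>
      intro i hi
      set h : X → Q.carrier := fun j => if deg j < deg i then f j else 0 with hh
      have hex : ∃ y, Good i h y := by
        cases n with
        | zero =>
          obtain ⟨y, hy, hy'⟩ := hQ.surjective (g (P.ε (x i)))
          refine ⟨y, by rw [hi]; exact hy, ?_, hy'⟩
          rw [Q.d_zero y hy, P.d_zero (x i) (by rw [← hi]; exact hx i), map_zero, map_zero]
        | succ n =>
          have hxi : x i ∈ P.grading (n + 1) := hi ▸ hx i
          have hz := hmem' _ _ (P.d_mem n _ hxi)
          have hcongr : FreeAlgebra.lift K h (e.symm (P.d (x i))) = F (e.symm (P.d (x i))) :=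
            lift_congr deg h f (fun j hj => by simp only [hh]; rw [if_pos (by omega)]) hz
          obtain ⟨h₁, h₂, h₃⟩ := homog n (fun j hj => ih (deg j) (by omega) j rfl) _ hz
          rw [e.apply_symm_apply, P.d_d, map_zero, map_zero] at h₂
          rw [e.apply_symm_apply, P.ε_d, map_zero] at h₃
          have : ∃ y ∈ Q.grading (n + 1), Q.d y = F (e.symm (P.d (x i))) := by
            cases n with
            | zero => exact hQ.exact_zero _ h₁ h₃
            | succ n => exact hQ.exact_succ n _ h₁ h₂
          obtain ⟨y, hy, hy'⟩ := this
          refine ⟨y, by rw [hi]; exact hy, hy'.trans hcongr.symm, ?_⟩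
          rw [Q.ε_pos n y hy, P.ε_pos n _ hxi, map_zero]
      have hfi := hf i
      rw [dif_pos hex] at hfi
      have hspec := Classical.choose_spec hex
      rw [← hfi] at hspec
      refine ⟨hspec.1, hspec.2.1.trans ?_, hspec.2.2⟩
      cases n with
      | zero => rw [P.d_zero (x i) (by rw [← hi]; exact hx i), map_zero, map_zero, map_zero]
      | succ n =>
        exact lift_congr deg h f (fun j hj => by simp only [hh]; rw [if_pos (by omega)])
          (hmem' _ _ (P.d_mem n _ (hi ▸ hx i)))
  have hom : ∀ m, ∀ y ∈ P.grading m, F (e.symm y) ∈ Q.grading m ∧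
      Q.d (F (e.symm y)) = F (e.symm (P.d y)) ∧ Q.ε (F (e.symm y)) = g (P.ε y) := by
    intro m y hy
    simpa using homog m (fun i _ => good _ i rfl) _ (hmem' m y hy)
  refine ⟨⟨(F : FreeAlgebra K X →+* Q.carrier).comp (e.symm : P.carrier →+* FreeAlgebra K X),
    fun k => ?_, fun n y hy => (hom n y hy).1, fun y => ?_, fun y => ?_⟩⟩
  · change F (e.symm (algebraMap K P.carrier k)) = _
    rw [AlgEquiv.commutes, AlgHom.commutes]
    rfl
  · change F (e.symm (P.d y)) = Q.d (F (e.symm y))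
    induction y using DirectSum.Decomposition.inductionOn P.grading with
    | zero => simp
    | homogeneous y => exact (hom _ _ y.2).2.1.symm
    | add a b ha hb => simp only [map_add, ha, hb]
  · change Q.ε (F (e.symm y)) = g (P.ε y)
    induction y using DirectSum.Decomposition.inductionOn P.grading with
    | zero => simp
    | homogeneous y => exact (hom _ _ y.2).2.2
    | add a b ha hb => simp only [map_add, ha, hb]

end Lifting

end ChainAlgebraOver

/-! ### Shukla cohomology -/

section Shukla

/-- The chosen weak equivalence from a quasi-free chain algebra over `K` to `A`. -/
noncomputable def resolution (K : Type v) [CommRing K] (A : Type u) [Ring A] [Algebra K A] :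
    ChainAlgebraOver.{v, max u v} K A :=
  Gen.freeOver K A

theorem resolution_isQuasiFree (K : Type v) [CommRing K] (A : Type u) [Ring A] [Algebra K A] :
    (resolution K A).IsQuasiFree :=
  Gen.freeOver_isQuasiFree

theorem resolution_isWeakEquivalence (K : Type v) [CommRing K] (A : Type u) [Ring A]
    [Algebra K A] : (resolution K A).IsWeakEquivalence :=
  Gen.freeOver_isWeakEquivalence

/-- The Shukla cohomology `Shuklaⁿ(A/K, M)`: the Hochschild cohomology, with coefficients in `M`,
of a quasi-free chain algebra over `K` that is weakly equivalent to `A`. -/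
abbrev Shukla (K : Type v) [CommRing K] (A : Type u) [Ring A] [Algebra K A] (M : Type t)
    [AddCommGroup M] [Module A M] [Module Aᵐᵒᵖ M] (n : ℕ) : Type (max u v t) :=
  (resolution K A).HochschildCohomology M n

variable (K : Type v) [CommRing K] {A : Type u} [Ring A] [Algebra K A]
  (K' : Type v') [CommRing K'] {A' : Type u'} [Ring A'] [Algebra K' A'] [Algebra K K']
  {M : Type t} [AddCommGroup M] [Module A M] [Module Aᵐᵒᵖ M]
  {M' : Type t'} [AddCommGroup M'] [Module A' M'] [Module A'ᵐᵒᵖ M']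

/-- The homomorphism induced on Shukla cohomology by a homomorphism of algebras, a homomorphism of
bimodules and a change of the ground ring: it is induced by a lift of `A → A'` to the quasi-free
chain algebras. -/
noncomputable def Shukla.map (φ : BimoduleHom A M A' M')
    (hφ : ∀ k, φ.g (algebraMap K A k) = algebraMap K' A' (algebraMap K K' k)) (n : ℕ) :
    Shukla K' A' M' n →+ Shukla K A M n :=
  (Classical.choice (ChainAlgebraOver.exists_hom (resolution_isQuasiFree K A)
    (resolution_isWeakEquivalence K' A') φ.g hφ)).cohomologyMap φ n

end Shukla

/-- The identity of a bimodule. -/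
def BimoduleHom.id (A : Type u) [Ring A] (M : Type t) [AddCommGroup M] [Module A M]
    [Module Aᵐᵒᵖ M] : BimoduleHom A M A M where
  g := RingHom.id A
  h := AddMonoidHom.id M
  map_smul _ _ := rfl
  map_op_smul _ _ := rfl

/-- `H⁰(A, M)`: the elements `m` of `M` with `a m = m a` for all `a` in `A`. -/
def H0 (A : Type u) [Ring A] (M : Type t) [AddCommGroup M] [Module A M] [Module Aᵐᵒᵖ M] :
    AddSubgroup M where
  carrier := {m | ∀ a : A, a • m = op a • m}
  zero_mem' := by simp
  add_mem' {x y} hx hy a := by rw [smul_add, smul_add, hx a, hy a]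
  neg_mem' {x} hx a := by rw [smul_neg, smul_neg, hx a]

/-- The homomorphism induced on `H⁰`. -/
def H0.map {A : Type u} [Ring A] {M : Type t} [AddCommGroup M] [Module A M] [Module Aᵐᵒᵖ M]
    {A' : Type u'} [Ring A'] {M' : Type t'} [AddCommGroup M'] [Module A' M'] [Module A'ᵐᵒᵖ M']
    (φ : BimoduleHom A M A' M') : H0 A' M' →+ H0 A M :=
  (φ.h.comp (H0 A' M').subtype).codRestrict (H0 A M) fun m a => by
    change a • φ.h m = op a • φ.h m
    rw [← φ.map_smul, ← φ.map_op_smul, m.2]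

/-- For `m` in `H⁰(A, M)`, the bimodule homomorphism `A → M` with `1 ↦ m`. -/
def BimoduleHom.ofH0 {A : Type u} [Ring A] {M : Type t} [AddCommGroup M] [Module A M]
    [Module Aᵐᵒᵖ M] (m : H0 A M) : BimoduleHom A M A A where
  g := RingHom.id A
  h := (LinearMap.toSpanSingleton A M (m : M)).toAddMonoidHom
  map_smul a x := by simp [mul_smul]
  map_op_smul a x := by
    change (x * a) • (m : M) = op a • x • (m : M)
    rw [m.2 x, m.2 (x * a), op_mul, mul_smul]

/-! ### Crossed extensions -/

/-- A crossed extension `0 → M → C₁ → C₀ → A → 0` of a `K`-algebra `A` by an `A`-bimodule `M`: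
`∂ : C₁ → C₀` is a crossed bimodule, that is `C₀` is a `K`-algebra, `C₁` is a `C₀`-bimodule and
`∂` is a homomorphism of bimodules with `∂ x * y = x * ∂ y`. -/
structure CrossedExtension (K : Type v) [CommRing K] (A : Type u) [Ring A] [Algebra K A]
    (M : Type t) [AddCommGroup M] [Module A M] [Module Aᵐᵒᵖ M] where
  C₀ : Type w
  [ring : Ring C₀]
  [algebra : Algebra K C₀]
  C₁ : Type w'
  [addCommGroup : AddCommGroup C₁]
  [moduleLeft : Module C₀ C₁]
  [moduleRight : Module C₀ᵐᵒᵖ C₁]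
  [smulCommClass : SMulCommClass C₀ C₀ᵐᵒᵖ C₁]
  central : ∀ (k : K) (x : C₁), algebraMap K C₀ k • x = op (algebraMap K C₀ k) • x
  bdry : C₁ →+ C₀
  bdry_smul : ∀ (c : C₀) (x : C₁), bdry (c • x) = c * bdry x
  bdry_op_smul : ∀ (c : C₀) (x : C₁), bdry (op c • x) = bdry x * c
  crossed : ∀ x y : C₁, bdry x • y = op (bdry y) • x
  π : C₀ →ₐ[K] A
  i : M →+ C₁
  i_smul : ∀ (c : C₀) (m : M), i (π c • m) = c • i m
  i_op_smul : ∀ (c : C₀) (m : M), i (op (π c) • m) = op c • i m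
  i_injective : Function.Injective i
  exact_C₁ : ∀ x : C₁, bdry x = 0 ↔ ∃ m, i m = x
  exact_C₀ : ∀ c : C₀, π c = 0 ↔ ∃ x, bdry x = c
  π_surjective : Function.Surjective π

attribute [instance] CrossedExtension.ring CrossedExtension.algebra CrossedExtension.addCommGroup
  CrossedExtension.moduleLeft CrossedExtension.moduleRight CrossedExtension.smulCommClass

namespace CrossedExtension

variable {K : Type v} [CommRing K] {A : Type u} [Ring A] [Algebra K A]
  {M : Type t} [AddCommGroup M] [Module A M] [Module Aᵐᵒᵖ M]

/-- The part `C₁ ⊕ M` of positive degree of the chain algebra `M → C₁ → C₀`. -/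
def Pos (E : CrossedExtension.{v, w, w'} K A M) : Type (max t w') := E.C₁ × M

variable (E : CrossedExtension.{v, w, w'} K A M)

instance : AddCommGroup E.Pos := inferInstanceAs (AddCommGroup (E.C₁ × M))

instance : Module E.C₀ E.Pos where
  smul c x := (c • x.1, E.π c • x.2)
  one_smul x := Prod.ext (one_smul _ x.1) ((congrArg (· • x.2) (map_one E.π)).trans (one_smul _ x.2))
  mul_smul a b x := Prod.ext (mul_smul a b x.1)
    ((congrArg (· • x.2) (map_mul E.π a b)).trans (mul_smul _ _ x.2))
  smul_zero a := Prod.ext (smul_zero a) (smul_zero _)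
  smul_add a x y := Prod.ext (smul_add a x.1 y.1) (smul_add _ x.2 y.2)
  add_smul a b x := Prod.ext (add_smul a b x.1)
    ((congrArg (· • x.2) (map_add E.π a b)).trans (add_smul _ _ x.2))
  zero_smul x := Prod.ext (zero_smul _ x.1)
    ((congrArg (· • x.2) (map_zero E.π)).trans (zero_smul _ x.2))

instance : Module E.C₀ᵐᵒᵖ E.Pos where
  smul c x := (c • x.1, op (E.π c.unop) • x.2)
  one_smul x := Prod.ext (one_smul _ x.1)
    ((congrArg (fun a => op a • x.2) (map_one E.π)).trans (one_smul _ x.2))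
  mul_smul a b x := Prod.ext (mul_smul a b x.1)
    ((congrArg (fun a => op a • x.2) (map_mul E.π b.unop a.unop)).trans (mul_smul _ _ x.2))
  smul_zero a := Prod.ext (smul_zero a) (smul_zero _)
  smul_add a x y := Prod.ext (smul_add a x.1 y.1) (smul_add _ x.2 y.2)
  add_smul a b x := Prod.ext (add_smul a b x.1)
    ((congrArg (fun a => op a • x.2) (map_add E.π a.unop b.unop)).trans (add_smul _ _ x.2))
  zero_smul x := Prod.ext (zero_smul _ x.1)
    ((congrArg (fun a => op a • x.2) (map_zero E.π)).trans (zero_smul _ x.2))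

instance [SMulCommClass A Aᵐᵒᵖ M] : SMulCommClass E.C₀ E.C₀ᵐᵒᵖ E.Pos :=
  ⟨fun a b x => Prod.ext (smul_comm a b x.1) (smul_comm (E.π a) (op (E.π b.unop)) x.2)⟩

instance : Module K E.Pos := Module.compHom E.Pos (algebraMap K E.C₀)

instance : IsScalarTower K E.C₀ E.Pos :=
  ⟨fun k c x => by
    change (k • c) • x = algebraMap K E.C₀ k • c • x
    rw [Algebra.smul_def, mul_smul]⟩

theorem central_pos (k : K) (x : E.Pos) :
    algebraMap K E.C₀ k • x = op (algebraMap K E.C₀ k) • x := by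
  refine Prod.ext (E.central k x.1) (E.i_injective ?_)
  change E.i (E.π _ • x.2) = E.i (op (E.π _) • x.2)
  rw [E.i_smul, E.i_op_smul, E.central]
  rfl

variable [SMulCommClass A Aᵐᵒᵖ M]

instance : SMulCommClass E.C₀ E.C₀ᵐᵒᵖ E.Pos :=
  ⟨fun a b x => Prod.ext (smul_comm a b x.1) (smul_comm (E.π a) (op (E.π b.unop)) x.2)⟩

instance : IsScalarTower K E.C₀ᵐᵒᵖ E.Pos :=
  ⟨fun k c x => by
    change (k • c) • x = algebraMap K E.C₀ k • c • x
    have : k • c = c * op (algebraMap K E.C₀ k) := by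
      rw [← op_unop c, ← op_smul, Algebra.smul_def, op_mul]
    rw [this, mul_smul, ← E.central_pos, ← smul_comm]⟩

/-- The underlying algebra of the chain algebra `M → C₁ → C₀`: all products of elements of
positive degree are zero. -/
abbrev Total : Type (max t w w') := TrivSqZeroExt E.C₀ E.Pos

/-- The element of the chain algebra with the given components. -/
def tri (c : E.C₀) (x : E.C₁) (m : M) : E.Total := (c, (x, m))

theorem total_ext {z z' : E.Total} (h₀ : z.fst = z'.fst) (h₁ : z.snd.1 = z'.snd.1)
    (h₂ : z.snd.2 = z'.snd.2) : z = z' :=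
  Prod.ext h₀ (Prod.ext h₁ h₂)

theorem mul_def (z z' : E.Total) : z * z' = E.tri (z.fst * z'.fst)
    (z.fst • z'.snd.1 + op z'.fst • z.snd.1)
    (E.π z.fst • z'.snd.2 + op (E.π z'.fst) • z.snd.2) := rfl

/-- The grading: `C₀` in degree `0`, `C₁` in degree `1`, `M` in degree `2`. -/
def grading (n : ℕ) : Submodule K E.Total where
  carrier := {z | (n ≠ 0 → z.fst = 0) ∧ (n ≠ 1 → z.snd.1 = 0) ∧ (n ≠ 2 → z.snd.2 = 0)}
  zero_mem' := ⟨fun _ => rfl, fun _ => rfl, fun _ => rfl⟩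
  add_mem' {x y} hx hy :=
    ⟨fun h => show x.fst + y.fst = 0 by rw [hx.1 h, hy.1 h, add_zero],
      fun h => show x.snd.1 + y.snd.1 = 0 by rw [hx.2.1 h, hy.2.1 h, add_zero],
      fun h => show x.snd.2 + y.snd.2 = 0 by rw [hx.2.2 h, hy.2.2 h, add_zero]⟩
  smul_mem' k x hx :=
    ⟨fun h => show k • x.fst = 0 by rw [hx.1 h, smul_zero],
      fun h => show algebraMap K E.C₀ k • x.snd.1 = 0 by rw [hx.2.1 h, smul_zero],
      fun h => show E.π (algebraMap K E.C₀ k) • x.snd.2 = 0 by rw [hx.2.2 h, smul_zero]⟩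

instance : SetLike.GradedMonoid E.grading where
  one_mem := ⟨fun h => absurd rfl h, fun _ => rfl, fun _ => rfl⟩
  mul_mem m n x y hx hy := by
    obtain ⟨x₀, x₁, x₂⟩ := hx
    obtain ⟨y₀, y₁, y₂⟩ := hy
    refine ⟨fun h => ?_, fun h => ?_, fun h => ?_⟩
    · change x.fst * y.fst = 0
      by_cases hm : m = 0
      · rw [y₀ (by omega), mul_zero]
      · rw [x₀ hm, zero_mul]
    · change x.fst • y.snd.1 + op y.fst • x.snd.1 = 0
      have h₁ : x.fst • y.snd.1 = 0 := by
        by_cases hm : m = 0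
        · rw [y₁ (by omega), smul_zero]
        · rw [x₀ hm, zero_smul]
      have h₂ : op y.fst • x.snd.1 = 0 := by
        by_cases hm : n = 0
        · rw [x₁ (by omega), smul_zero]
        · rw [y₀ hm, op_zero, zero_smul]
      rw [h₁, h₂, add_zero]
    · change E.π x.fst • y.snd.2 + op (E.π y.fst) • x.snd.2 = 0
      have h₁ : E.π x.fst • y.snd.2 = 0 := by
        by_cases hm : m = 0
        · rw [y₂ (by omega), smul_zero]
        · rw [x₀ hm, map_zero, zero_smul]
      have h₂ : op (E.π y.fst) • x.snd.2 = 0 := by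
        by_cases hm : n = 0
        · rw [x₂ (by omega), smul_zero]
        · rw [y₀ hm, map_zero, op_zero, zero_smul]
      rw [h₁, h₂, add_zero]

/-- The projection to the component of degree `n`. -/
def part (n : ℕ) : E.Total →+ E.grading n where
  toFun z := ⟨E.tri (if n = 0 then z.fst else 0) (if n = 1 then z.snd.1 else 0)
    (if n = 2 then z.snd.2 else 0), fun h => if_neg h, fun h => if_neg h, fun h => if_neg h⟩
  map_zero' := by
    refine Subtype.ext (E.total_ext ?_ ?_ ?_)
    exacts [ite_self _, ite_self _, ite_self _]
  map_add' x y := by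
    refine Subtype.ext (E.total_ext ?_ ?_ ?_)
    · change (if n = 0 then x.fst + y.fst else 0)
        = (if n = 0 then x.fst else 0) + (if n = 0 then y.fst else 0)
      split_ifs <;> simp
    · change (if n = 1 then x.snd.1 + y.snd.1 else 0)
        = (if n = 1 then x.snd.1 else 0) + (if n = 1 then y.snd.1 else 0)
      split_ifs <;> simp
    · change (if n = 2 then x.snd.2 + y.snd.2 else 0)
        = (if n = 2 then x.snd.2 else 0) + (if n = 2 then y.snd.2 else 0)
      split_ifs <;> simp

theorem part_same {n : ℕ} (x : E.grading n) : E.part n x = x := by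
  obtain ⟨x, h₀, h₁, h₂⟩ := x
  refine Subtype.ext (E.total_ext ?_ ?_ ?_)
  · change (if n = 0 then x.fst else 0) = x.fst
    split_ifs with h
    exacts [rfl, (h₀ h).symm]
  · change (if n = 1 then x.snd.1 else 0) = x.snd.1
    split_ifs with h
    exacts [rfl, (h₁ h).symm]
  · change (if n = 2 then x.snd.2 else 0) = x.snd.2
    split_ifs with h
    exacts [rfl, (h₂ h).symm]

theorem part_ne {n m : ℕ} (hnm : m ≠ n) (x : E.grading n) : E.part m x = 0 := by
  obtain ⟨x, h₀, h₁, h₂⟩ := x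
  refine Subtype.ext (E.total_ext ?_ ?_ ?_)
  · change (if m = 0 then x.fst else 0) = 0
    split_ifs with h
    exacts [h₀ (by omega), rfl]
  · change (if m = 1 then x.snd.1 else 0) = 0
    split_ifs with h
    exacts [h₁ (by omega), rfl]
  · change (if m = 2 then x.snd.2 else 0) = 0
    split_ifs with h
    exacts [h₂ (by omega), rfl]

instance : DirectSum.Decomposition E.grading :=
  DirectSum.Decomposition.ofAddHom E.grading
    (∑ n ∈ Finset.range 3, (DirectSum.of (fun n => E.grading n) n).comp (E.part n))
    (by
      refine AddMonoidHom.ext fun z => ?_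
      have : DirectSum.coeAddMonoidHom E.grading
          ((∑ n ∈ Finset.range 3, (DirectSum.of (fun n => E.grading n) n).comp (E.part n)) z)
          = (E.part 0 z : E.Total) + E.part 1 z + E.part 2 z := by
        rw [AddMonoidHom.finsetSum_apply, map_sum]
        simp [Finset.sum_range_succ]
      refine this.trans (E.total_ext ?_ ?_ ?_)
      · change z.fst + 0 + 0 = z.fst
        simp
      · change 0 + z.snd.1 + 0 = z.snd.1
        simp
      · change 0 + 0 + z.snd.2 = z.snd.2
        simp)
    (by
      refine DirectSum.addHom_ext fun n x => ?_
      change (∑ m ∈ Finset.range 3, (DirectSum.of (fun n => E.grading n) m).comp (E.part m))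
        (DirectSum.coeAddMonoidHom E.grading (DirectSum.of _ n x)) = DirectSum.of _ n x
      rw [DirectSum.coeAddMonoidHom_of, AddMonoidHom.finsetSum_apply]
      simp only [AddMonoidHom.comp_apply]
      by_cases hn : n < 3
      · rw [Finset.sum_eq_single n (fun m _ hm => by rw [E.part_ne hm, map_zero])
          (fun h => absurd (Finset.mem_range.2 hn) h), part_same]
      · have hx : x = 0 := by
          obtain ⟨x, h₀, h₁, h₂⟩ := x
          exact Subtype.ext (E.total_ext (h₀ (by omega)) (h₁ (by omega)) (h₂ (by omega)))
        subst hx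
        simp)

instance : GradedAlgebra E.grading where

/-- The chain algebra `M → C₁ → C₀` over `A`. -/
def chainAlgebra : ChainAlgebraOver.{v, max t w w'} K A where
  carrier := E.Total
  grading := E.grading
  d :=
    { toFun := fun z => E.tri (E.bdry z.snd.1) (E.i z.snd.2) 0
      map_add' := fun x y => E.total_ext (map_add E.bdry x.snd.1 y.snd.1)
        (map_add E.i x.snd.2 y.snd.2) (add_zero 0).symm
      map_smul' := fun k x => E.total_ext
        ((E.bdry_smul _ _).trans (Algebra.smul_def k _).symm) (E.i_smul _ _) (smul_zero _).symm }
  d_mem n x hx := ⟨fun h => (congrArg E.bdry (hx.2.1 (by omega))).trans (map_zero _),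
    fun h => (congrArg E.i (hx.2.2 (by omega))).trans (map_zero _), fun _ => rfl⟩
  d_zero x hx := E.total_ext ((congrArg E.bdry (hx.2.1 (by omega))).trans (map_zero _))
    ((congrArg E.i (hx.2.2 (by omega))).trans (map_zero _)) rfl
  d_d x := E.total_ext ((E.exact_C₁ _).2 ⟨_, rfl⟩) (map_zero _) rfl
  leibniz n x hx y := by
    change E.tri (E.bdry (x.fst • y.snd.1 + op y.fst • x.snd.1))
        (E.i (E.π x.fst • y.snd.2 + op (E.π y.fst) • x.snd.2)) 0
      = E.tri (E.bdry x.snd.1) (E.i x.snd.2) 0 * y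
        + (-1) ^ n * (x * E.tri (E.bdry y.snd.1) (E.i y.snd.2) 0)
    have hπ : ∀ z : E.C₁, E.π (E.bdry z) = 0 := fun z => (E.exact_C₀ _).2 ⟨z, rfl⟩
    have hi : ∀ m : M, E.bdry (E.i m) = 0 := fun m => (E.exact_C₁ _).2 ⟨m, rfl⟩
    obtain ⟨h₀, h₁, h₂⟩ := hx
    match n with
    | 0 =>
      rw [pow_zero, one_mul]
      refine E.total_ext ?_ ?_ ?_
      · change E.bdry _ = E.bdry x.snd.1 * y.fst + x.fst * E.bdry y.snd.1
        rw [map_add, E.bdry_smul, E.bdry_op_smul, add_comm]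
      · change E.i _ = (E.bdry x.snd.1 • y.snd.1 + op y.fst • E.i x.snd.2)
          + (x.fst • E.i y.snd.2 + op (E.bdry y.snd.1) • x.snd.1)
        rw [h₁ (by omega), h₂ (by omega), map_add, E.i_smul, smul_zero, map_zero, smul_zero,
          map_zero, zero_smul]
        simp
      · change 0 = (E.π (E.bdry x.snd.1) • y.snd.2 + op (E.π y.fst) • (0 : M))
          + (E.π x.fst • (0 : M) + op (E.π (E.bdry y.snd.1)) • x.snd.2)
        simp [hπ]
    | 1 =>
      rw [pow_one, neg_one_mul]
      refine E.total_ext ?_ ?_ ?_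
      · change E.bdry _ = E.bdry x.snd.1 * y.fst + -(x.fst * E.bdry y.snd.1)
        rw [h₀ (by omega), map_add, E.bdry_smul, E.bdry_op_smul]
        simp
      · change E.i _ = (E.bdry x.snd.1 • y.snd.1 + op y.fst • E.i x.snd.2)
          + -(x.fst • E.i y.snd.2 + op (E.bdry y.snd.1) • x.snd.1)
        rw [h₀ (by omega), h₂ (by omega), E.crossed]
        simp
      · change 0 = (E.π (E.bdry x.snd.1) • y.snd.2 + op (E.π y.fst) • (0 : M))
          + -(E.π x.fst • (0 : M) + op (E.π (E.bdry y.snd.1)) • x.snd.2)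
        simp [hπ]
    | n + 2 =>
      have hs : (-1) ^ (n + 2) * (x * E.tri (E.bdry y.snd.1) (E.i y.snd.2) 0) = 0 := by
        have : x * E.tri (E.bdry y.snd.1) (E.i y.snd.2) 0 = 0 := by
          refine E.total_ext ?_ ?_ ?_
          · change x.fst * E.bdry y.snd.1 = 0
            rw [h₀ (by omega), zero_mul]
          · change x.fst • E.i y.snd.2 + op (E.bdry y.snd.1) • x.snd.1 = 0
            rw [h₀ (by omega), h₁ (by omega), zero_smul, smul_zero, add_zero]
          · change E.π x.fst • (0 : M) + op (E.π (E.bdry y.snd.1)) • x.snd.2 = 0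
            simp [hπ]
        rw [this, mul_zero]
      rw [hs, add_zero]
      refine E.total_ext ?_ ?_ ?_
      · change E.bdry _ = E.bdry x.snd.1 * y.fst
        rw [h₀ (by omega), h₁ (by omega)]
        simp
      · change E.i _ = E.bdry x.snd.1 • y.snd.1 + op y.fst • E.i x.snd.2
        rw [h₀ (by omega), h₁ (by omega), map_add, E.i_op_smul]
        simp
      · change 0 = E.π (E.bdry x.snd.1) • y.snd.2 + op (E.π y.fst) • (0 : M)
        simp [hπ]
  ε := E.π.comp (TrivSqZeroExt.fstHom K E.C₀ E.Pos)
  ε_pos n x hx := (congrArg E.π (hx.1 (by omega))).trans (map_zero _)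
  ε_d x := (E.exact_C₀ _).2 ⟨_, rfl⟩

theorem chainAlgebra_isWeakEquivalence : E.chainAlgebra.IsWeakEquivalence where
  surjective a := by
    obtain ⟨c, hc⟩ := E.π_surjective a
    exact ⟨E.tri c 0 0, ⟨fun h => absurd rfl h, fun _ => rfl, fun _ => rfl⟩, hc⟩
  exact_zero x hx hε := by
    obtain ⟨y, hy⟩ := (E.exact_C₀ _).1 hε
    exact ⟨E.tri 0 y 0, ⟨fun _ => rfl, fun h => absurd rfl h, fun _ => rfl⟩,
      E.total_ext hy ((map_zero _).trans (hx.2.1 (by omega)).symm) (hx.2.2 (by omega)).symm⟩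
  exact_succ n x hx hd := by
    by_cases hn : n = 0
    · subst hn
      obtain ⟨m, hm⟩ := (E.exact_C₁ _).1 (congrArg TrivSqZeroExt.fst hd)
      exact ⟨E.tri 0 0 m, ⟨fun _ => rfl, fun _ => rfl, fun h => absurd rfl h⟩,
        E.total_ext ((map_zero _).trans (hx.1 (by omega)).symm) hm (hx.2.2 (by omega)).symm⟩
    · refine ⟨0, zero_mem _, (map_zero _).trans (E.total_ext (hx.1 (by omega)).symm
        (hx.2.1 (by omega)).symm (E.i_injective ?_))⟩
      exact (map_zero E.i).trans (congrArg (fun z => z.snd.1) hd).symm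

/-- The projection to the component `M` of the chain algebra `M → C₁ → C₀`, as a Hochschild
cochain of total degree `3`: one variable, chain degree `2`. -/
def cochain : E.chainAlgebra.RawCochain M
  | 1, r => (show E.Total from r 0).snd.2
  | _, _ => 0

theorem cochain_mem_cocycles : E.cochain ∈ E.chainAlgebra.cocycles M 3 := by
  refine ⟨⟨fun n r j x y => ?_, fun n r j k x => ?_, fun n deg r hr hn => ?_⟩, ?_⟩
  · match n, r, j with
    | 0, _, j => exact j.elim0
    | 1, r, j =>
      obtain rfl : j = 0 := Subsingleton.elim _ _
      simp only [cochain, Function.update_self]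
      rfl
    | n + 2, _, _ => exact (add_zero 0).symm
  · match n, r, j with
    | 0, _, j => exact j.elim0
    | 1, r, j =>
      obtain rfl : j = 0 := Subsingleton.elim _ _
      simp only [cochain, Function.update_self]
      rw [← E.π.commutes]
      rfl
    | n + 2, _, _ => exact (smul_zero _).symm
  · match n, deg, r, hr, hn with
    | 0, _, _, _, _ => rfl
    | 1, deg, r, hr, hn =>
      refine (hr 0).2.2 ?_
      simp only [Finset.univ_unique, Finset.sum_singleton] at hn
      have : (default : Fin 1) = 0 := rfl
      rw [this] at hn
      omega
    | n + 2, _, _, _, _ => rfl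
  · change E.chainAlgebra.differential M E.cochain = 0
    funext n r
    match n, r with
    | 0, _ => rfl
    | 1, r =>
      change E.chainAlgebra.hochschildCoboundary M 0 (fun _ => 0) r
        + (-1 : ℤ) ^ (0 + 1) • E.chainAlgebra.internalCoboundary M 1 (E.cochain 1) r = 0
      have h : E.chainAlgebra.internalCoboundary M 1 (E.cochain 1) r = 0 := by
        simp only [ChainAlgebraOver.internalCoboundary, Finset.univ_unique, Finset.sum_singleton]
        rfl
      rw [h]
      simp [ChainAlgebraOver.hochschildCoboundary]
    | 2, r =>
      change E.chainAlgebra.hochschildCoboundary M 1 (E.cochain 1) r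
        + (-1 : ℤ) ^ (1 + 1) • E.chainAlgebra.internalCoboundary M 2 (fun _ => 0) r = 0
      have h : E.chainAlgebra.hochschildCoboundary M 1 (E.cochain 1) r
          = E.π (show E.Total from r 0).fst • (show E.Total from r 1).snd.2
            + (-1 : ℤ) ^ 1 • ((show E.Total from r 0) * (show E.Total from r 1)).snd.2
            + (-1 : ℤ) ^ 2 • op (E.π (show E.Total from r 1).fst)
              • (show E.Total from r 0).snd.2 := by
        simp only [ChainAlgebraOver.hochschildCoboundary, Finset.univ_unique,
          Finset.sum_singleton]
        rfl
      rw [h, mul_def]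
      change E.π (show E.Total from r 0).fst • (show E.Total from r 1).snd.2
            + (-1 : ℤ) ^ 1 • (E.π (show E.Total from r 0).fst • (show E.Total from r 1).snd.2
              + op (E.π (show E.Total from r 1).fst) • (show E.Total from r 0).snd.2)
            + (-1 : ℤ) ^ 2 • op (E.π (show E.Total from r 1).fst)
              • (show E.Total from r 0).snd.2 + _ = 0
      simp [ChainAlgebraOver.internalCoboundary]
    | n + 3, r =>
      change E.chainAlgebra.hochschildCoboundary M (n + 2) (fun _ => 0) r
        + (-1 : ℤ) ^ (n + 2 + 1)
          • E.chainAlgebra.internalCoboundary M (n + 3) (fun _ => 0) r = 0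
      simp [ChainAlgebraOver.hochschildCoboundary, ChainAlgebraOver.internalCoboundary]

/-- The class in `Shukla³(A/K, M)` of a crossed extension: a lift of `A` to a chain algebra
morphism from the quasi-free chain algebra to `M → C₁ → C₀` has a component with values in `M`,
which is a cocycle. -/
noncomputable def shuklaClass : Shukla K A M 3 :=
  (Classical.choice (ChainAlgebraOver.exists_hom (K' := K) (resolution_isQuasiFree K A)
    E.chainAlgebra_isWeakEquivalence (RingHom.id A) fun _ => rfl)).cohomologyMap
      (BimoduleHom.id A M) 3
      (QuotientAddGroup.mk' _ ⟨E.cochain, E.cochain_mem_cocycles⟩)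

end CrossedExtension

/-! ### The canonical crossed extension -/

section Canonical

variable (A : Type u) [Ring A]

/-- The ideal of the monoid ring `ℤ[A]` of the multiplicative monoid of `A` generated by `[0]`. -/
noncomputable abbrev zeroIdeal : Ideal (MonoidAlgebra ℤ A) := Ideal.span {MonoidAlgebra.of ℤ A 0}

theorem mem_zeroIdeal (y : MonoidAlgebra ℤ A) :
    y ∈ zeroIdeal A ↔ ∀ b : A, b ≠ 0 → y.coeff b = 0 := by
  classical
  constructor
  · intro h b hb
    obtain ⟨a, rfl⟩ := Ideal.mem_span_singleton'.1 h
    clear h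
    induction a using MonoidAlgebra.induction_linear with
    | zero => simp
    | add x y hx hy => rw [add_mul, MonoidAlgebra.coeff_add, Finsupp.add_apply, hx, hy, add_zero]
    | single m r =>
      rw [MonoidAlgebra.of_apply, MonoidAlgebra.single_mul_single, mul_zero, mul_one,
        MonoidAlgebra.coeff_single, Finsupp.single_apply, if_neg (Ne.symm hb)]
  · intro h
    have h₁ : y = MonoidAlgebra.single 1 (y.coeff 0) * MonoidAlgebra.of ℤ A 0 := by
      rw [MonoidAlgebra.of_apply, MonoidAlgebra.single_mul_single, one_mul, mul_one]
      refine MonoidAlgebra.coeff_injective (Finsupp.ext fun b => ?_)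
      rw [MonoidAlgebra.coeff_single, Finsupp.single_apply]
      split_ifs with hb
      · rw [hb]
      · exact h b (Ne.symm hb)
    rw [h₁]
    exact Ideal.mul_mem_left _ _ (Ideal.subset_span rfl)

instance : (zeroIdeal A).IsTwoSided := by
  refine ⟨fun {a} b ha => ?_⟩
  obtain ⟨a, rfl⟩ := Ideal.mem_span_singleton'.1 ha
  rw [mul_assoc]
  refine Ideal.mul_mem_left _ _ ?_
  induction b using MonoidAlgebra.induction_linear with
  | zero => simp
  | add x y hx hy => rw [mul_add]; exact add_mem hx hy
  | single m r =>
    have : MonoidAlgebra.of ℤ A 0 * MonoidAlgebra.single m r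
        = MonoidAlgebra.single 1 r * MonoidAlgebra.of ℤ A 0 := by
      simp [MonoidAlgebra.of_apply, MonoidAlgebra.single_mul_single]
    rw [this]
    exact Ideal.mul_mem_left _ _ (Ideal.subset_span rfl)

/-- The ring `ℤ[A]`: the free abelian group on the set `A` modulo `[0] = 0`, with the
multiplication induced by that of `A`. -/
abbrev ZBracket : Type u := MonoidAlgebra ℤ A ⧸ zeroIdeal A

variable {A}

/-- The element `[a]` of `ℤ[A]`. -/
noncomputable def bracket (a : A) : ZBracket A := Ideal.Quotient.mk _ (MonoidAlgebra.of ℤ A a)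

theorem bracket_zero : bracket (0 : A) = 0 :=
  Ideal.Quotient.eq_zero_iff_mem.2 (Ideal.subset_span rfl)

theorem bracket_mul (a b : A) : bracket (a * b) = bracket a * bracket b := by
  simp only [bracket, map_mul]

theorem zbracket_torsionFree {n : ℕ} (hn : n ≠ 0) {x : ZBracket A} (hx : n • x = 0) : x = 0 := by
  obtain ⟨x, rfl⟩ := Ideal.Quotient.mk_surjective x
  rw [← map_nsmul, Ideal.Quotient.eq_zero_iff_mem, mem_zeroIdeal] at hx
  rw [Ideal.Quotient.eq_zero_iff_mem, mem_zeroIdeal]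
  intro b hb
  have h := hx b hb
  rw [MonoidAlgebra.coeff_smul, Finsupp.smul_apply] at h
  exact (smul_eq_zero_iff_right hn).1 h

variable (A) in
/-- The ring homomorphism `η : ℤ[A] → A`, `[a] ↦ a`. -/
noncomputable def eta : ZBracket A →+* A :=
  Ideal.Quotient.lift _ (MonoidAlgebra.lift ℤ A A (MonoidHom.id A)).toRingHom fun y hy => by
    obtain ⟨a, rfl⟩ := Ideal.mem_span_singleton'.1 hy
    simp

theorem eta_bracket (a : A) : eta A (bracket a) = a := by
  simp [eta, bracket]

variable (A) in
/-- The kernel `R(A)` of `η`. -/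
noncomputable abbrev RKer : Ideal (ZBracket A) := RingHom.ker (eta A)

/-- The element `⟨x, y⟩ = [x] + [y] - [x + y]` of `R(A)`. -/
noncomputable def angle (x y : A) : RKer A :=
  ⟨bracket x + bracket y - bracket (x + y), by simp [RingHom.mem_ker, eta_bracket]⟩

variable (q : ℕ)

variable (A) in
/-- The ideal `q ℤ[A]`. -/
noncomputable abbrev multIdeal : Ideal (ZBracket A) := Ideal.span {(q : ZBracket A)}

theorem mem_multIdeal {x : ZBracket A} : x ∈ multIdeal A q ↔ ∃ y, q • y = x := by
  rw [Ideal.mem_span_singleton']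
  simp only [nsmul_eq_mul, Nat.cast_comm]

instance : (multIdeal A q).IsTwoSided := by
  refine ⟨fun {a} b ha => ?_⟩
  obtain ⟨y, rfl⟩ := (mem_multIdeal q).1 ha
  exact (mem_multIdeal q).2 ⟨y * b, (smul_mul_assoc _ _ _).symm⟩

variable (A) in
/-- The ring `(ℤ/q)[A] = ℤ[A] ⊗ ℤ/q`. -/
abbrev ZModBracket : Type u := ZBracket A ⧸ multIdeal A q

variable (A) in
/-- The subgroup `q R(A)` of `R(A)`. -/
noncomputable abbrev multRKer : AddSubgroup (RKer A) := (nsmulAddMonoidHom (α := RKer A) q).range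

variable (A) in
/-- The bimodule `R(A) / q R(A)` over `(ℤ/q)[A]`. -/
def RMod : Type u := RKer A ⧸ multRKer A q

noncomputable instance : AddCommGroup (RMod A q) :=
  inferInstanceAs (AddCommGroup (RKer A ⧸ multRKer A q))

/-- The projection `R(A) → R(A) / q R(A)`. -/
noncomputable def rmk : RKer A →+ RMod A q := QuotientAddGroup.mk' (multRKer A q)

theorem rmk_surjective : Function.Surjective (rmk (A := A) q) := QuotientAddGroup.mk'_surjective _

theorem rmk_eq_zero {r : RKer A} : rmk q r = 0 ↔ ∃ s : RKer A, q • s = r :=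
  QuotientAddGroup.eq_zero_iff r

theorem rmod_ext {B : Type*} [AddCommGroup B] {f g : RMod A q →+ B}
    (h : ∀ r, f (rmk q r) = g (rmk q r)) : f = g := by
  refine AddMonoidHom.ext fun x => ?_
  obtain ⟨r, rfl⟩ := rmk_surjective q x
  exact h r

/-- The endomorphism of `R(A) / q R(A)` induced by an additive endomorphism of `R(A)`. -/
noncomputable def rmap (f : RKer A →+ RKer A) : RMod A q →+ RMod A q :=
  QuotientAddGroup.map _ _ f (by
    rintro _ ⟨s, rfl⟩
    exact ⟨f s, (map_nsmul f q s).symm⟩)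

theorem rmap_rmk (f : RKer A →+ RKer A) (r : RKer A) : rmap q f (rmk q r) = rmk q (f r) := rfl

/-- Left multiplication by an element of `ℤ[A]` on `R(A)`. -/
noncomputable def mulL (b : ZBracket A) : RKer A →+ RKer A where
  toFun r := ⟨b * r, Ideal.mul_mem_left _ _ r.2⟩
  map_zero' := Subtype.ext (mul_zero _)
  map_add' _ _ := Subtype.ext (mul_add _ _ _)

/-- Right multiplication by an element of `ℤ[A]` on `R(A)`. -/
noncomputable def mulR (b : ZBracket A) : RKer A →+ RKer A where
  toFun r := ⟨r * b, Ideal.mul_mem_right _ _ r.2⟩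
  map_zero' := Subtype.ext (zero_mul _)
  map_add' _ _ := Subtype.ext (add_mul _ _ _)

/-- The left action of `(ℤ/q)[A]` on `R(A) / q R(A)`. -/
noncomputable def actL : ZModBracket A q →+* AddMonoid.End (RMod A q) :=
  Ideal.Quotient.lift _
    { toFun := fun b => rmap q (mulL b)
      map_one' := rmod_ext q fun r => congrArg (rmk q) (Subtype.ext (one_mul _))
      map_mul' := fun a b => rmod_ext q fun r => congrArg (rmk q) (Subtype.ext (mul_assoc _ _ _))
      map_zero' := rmod_ext q fun r =>
        (congrArg (rmk q) (Subtype.ext (zero_mul _))).trans (map_zero _)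
      map_add' := fun a b => rmod_ext q fun r =>
        (congrArg (rmk q) (Subtype.ext (add_mul _ _ _))).trans (map_add (rmk q) _ _) }
    fun x hx => by
      obtain ⟨y, rfl⟩ := (mem_multIdeal q).1 hx
      refine rmod_ext q fun r => ?_
      refine (rmk_eq_zero q).2 ⟨mulL y r, Subtype.ext ?_⟩
      exact (smul_mul_assoc _ _ _).symm

/-- The right action of `(ℤ/q)[A]` on `R(A) / q R(A)`. -/
noncomputable def actR : ZModBracket A q →+* (AddMonoid.End (RMod A q))ᵐᵒᵖ :=
  Ideal.Quotient.lift _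
    { toFun := fun b => op (rmap q (mulR b))
      map_one' := congrArg op <| rmod_ext q fun r => congrArg (rmk q) (Subtype.ext (mul_one _))
      map_mul' := fun a b => congrArg op <| rmod_ext q fun r =>
        congrArg (rmk q) (Subtype.ext (mul_assoc _ _ _).symm)
      map_zero' := congrArg op <| rmod_ext q fun r =>
        (congrArg (rmk q) (Subtype.ext (mul_zero _))).trans (map_zero _)
      map_add' := fun a b => congrArg op <| rmod_ext q fun r =>
        (congrArg (rmk q) (Subtype.ext (mul_add _ _ _))).trans (map_add (rmk q) _ _) }
    fun x hx => by
      obtain ⟨y, rfl⟩ := (mem_multIdeal q).1 hx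
      refine congrArg op <| rmod_ext q fun r => ?_
      refine (rmk_eq_zero q).2 ⟨mulR y r, Subtype.ext ?_⟩
      exact (mul_smul_comm _ _ _).symm

noncomputable instance : Module (ZModBracket A q) (RMod A q) where
  smul c x := actL q c x
  one_smul x := DFunLike.congr_fun (map_one (actL q)) x
  mul_smul a b x := DFunLike.congr_fun (map_mul (actL q) a b) x
  smul_zero a := map_zero (actL q a)
  smul_add a x y := map_add (actL q a) x y
  add_smul a b x := DFunLike.congr_fun (map_add (actL q) a b) x
  zero_smul x := DFunLike.congr_fun (map_zero (actL q)) x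

noncomputable instance : Module (ZModBracket A q)ᵐᵒᵖ (RMod A q) where
  smul c x := (actR q c.unop).unop x
  one_smul x := DFunLike.congr_fun (congrArg unop (map_one (actR q))) x
  mul_smul a b x := DFunLike.congr_fun (congrArg unop (map_mul (actR q) b.unop a.unop)) x
  smul_zero a := map_zero (actR q a.unop).unop
  smul_add a x y := map_add (actR q a.unop).unop x y
  add_smul a b x := DFunLike.congr_fun (congrArg unop (map_add (actR q) a.unop b.unop)) x
  zero_smul x := DFunLike.congr_fun (congrArg unop (map_zero (actR q))) x

theorem smul_rmk (b : ZBracket A) (r : RKer A) :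
    (Ideal.Quotient.mk (multIdeal A q) b) • rmk q r = rmk q (mulL b r) := rfl

theorem op_smul_rmk (b : ZBracket A) (r : RKer A) :
    op (Ideal.Quotient.mk (multIdeal A q) b) • rmk q r = rmk q (mulR b r) := rfl

instance : SMulCommClass (ZModBracket A q) (ZModBracket A q)ᵐᵒᵖ (RMod A q) := by
  refine ⟨fun a b x => ?_⟩
  obtain ⟨a, rfl⟩ := Ideal.Quotient.mk_surjective a
  obtain ⟨b, hb⟩ := Ideal.Quotient.mk_surjective b.unop
  obtain rfl : op (Ideal.Quotient.mk (multIdeal A q) b) = _ := (congrArg op hb).trans (op_unop _)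
  obtain ⟨r, rfl⟩ := rmk_surjective q x
  rw [op_smul_rmk, smul_rmk, smul_rmk, op_smul_rmk]
  exact congrArg (rmk q) (Subtype.ext (mul_assoc _ _ _).symm)

/-- A ring in which `q = 0` is an algebra over `ℤ/q`. -/
@[reducible] noncomputable def algebraZMod (B : Type*) [Ring B] (h : (q : B) = 0) :
    Algebra (ZMod q) B :=
  haveI := ringChar.charP B
  ZMod.algebra' B (ringChar B) (ringChar.dvd h)

noncomputable instance : Algebra (ZMod q) (ZModBracket A q) :=
  algebraZMod q (ZModBracket A q) (by
    rw [← map_natCast (Ideal.Quotient.mk (multIdeal A q))]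
    exact Ideal.Quotient.eq_zero_iff_mem.2 (Ideal.subset_span rfl))

/-- The homomorphism `R(A) / q R(A) → (ℤ/q)[A]` induced by the inclusion. -/
noncomputable def rbdry : RMod A q →+ ZModBracket A q :=
  QuotientAddGroup.lift _
    ((Ideal.Quotient.mk (multIdeal A q)).toAddMonoidHom.comp (RKer A).toAddSubgroup.subtype) (by
      rintro _ ⟨s, rfl⟩
      exact Ideal.Quotient.eq_zero_iff_mem.2 ((mem_multIdeal q).2 ⟨s, rfl⟩))

theorem rbdry_rmk (r : RKer A) : rbdry q (rmk q r) = Ideal.Quotient.mk (multIdeal A q) r := rfl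

end Canonical

section CanonicalExtension

variable (p : ℕ) (A : Type u) [Ring A]

/-- The map `A → R(A) / p² R(A)`, `x ↦ ∑ p ⟨j x, x⟩`, with the sum over `0 ≤ j < p`. -/
noncomputable def canonicalInclFun (x : A) : RMod A (p ^ 2) :=
  ∑ j ∈ Finset.range p, p • rmk (p ^ 2) (angle (j • x) x)

variable {A} [Algebra (ZMod p) A]

theorem char_smul (x : A) : p • x = 0 := by
  rw [nsmul_eq_mul, ← map_natCast (algebraMap (ZMod p) A), ZMod.natCast_self, map_zero, zero_mul]

/-- The element `p [x]` of `R(A)`. -/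
noncomputable def pBracket (x : A) : RKer A :=
  ⟨p • bracket x, by rw [RingHom.mem_ker, map_nsmul, eta_bracket, char_smul]⟩

theorem canonicalInclFun_eq (x : A) :
    canonicalInclFun p A x = rmk (p ^ 2) (p • pBracket p x) := by
  rw [canonicalInclFun, ← Finset.smul_sum, ← map_sum, ← map_nsmul]
  congr 2
  refine Subtype.ext ?_
  have h : ∀ n : ℕ, ((∑ j ∈ Finset.range n, angle (j • x) x : RKer A) : ZBracket A)
      = n • bracket x - bracket (n • x) := by
    intro n
    induction n with
    | zero => simp [bracket_zero]
    | succ n ih =>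
      rw [Finset.sum_range_succ, Submodule.coe_add, ih, succ_nsmul, succ_nsmul]
      simp only [angle]
      abel
  rw [h, char_smul p x, bracket_zero, sub_zero]
  rfl

/-- The homomorphism `i : A → R(A) / p² R(A)` of the canonical crossed extension. -/
noncomputable def canonicalIncl : A →+ RMod A (p ^ 2) where
  toFun := canonicalInclFun p A
  map_zero' := by
    have : pBracket p (0 : A) = 0 := Subtype.ext (by simp [pBracket, bracket_zero])
    rw [canonicalInclFun_eq, this, smul_zero, map_zero]
  map_add' x y := by
    rw [canonicalInclFun_eq, canonicalInclFun_eq, canonicalInclFun_eq, ← map_add, eq_comm,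
      ← sub_eq_zero, ← map_sub, rmk_eq_zero]
    refine ⟨angle x y, Subtype.ext ?_⟩
    change p ^ 2 • (bracket x + bracket y - bracket (x + y))
      = p • p • bracket x + p • p • bracket y - p • p • bracket (x + y)
    simp only [smul_smul, ← pow_two, smul_add, smul_sub]

theorem canonicalIncl_apply (x : A) : canonicalIncl p x = rmk (p ^ 2) (p • pBracket p x) :=
  canonicalInclFun_eq p x

variable [Algebra (ZMod (p ^ 2)) A] [Fact p.Prime]

theorem sq_sub_mem (b : ZBracket A) : b - bracket (eta A b) ∈ RKer A := by
  rw [RingHom.mem_ker, map_sub, eta_bracket, sub_self]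

variable (A) in
/-- The homomorphism `(ℤ/p²)[A] → A` induced by `η`. -/
noncomputable def etaMod : ZModBracket A (p ^ 2) →ₐ[ZMod (p ^ 2)] A :=
  let f : ZModBracket A (p ^ 2) →+* A := Ideal.Quotient.lift _ (eta A) fun x hx => by
    obtain ⟨y, rfl⟩ := (mem_multIdeal _).1 hx
    rw [map_nsmul, pow_two, mul_smul, char_smul p]
  { f with
    commutes' := fun k =>
      DFunLike.congr_fun (RingHom.ext_zmod (f.comp (algebraMap _ _)) (algebraMap _ _)) k }

theorem etaMod_mk (b : ZBracket A) :
    etaMod p A (Ideal.Quotient.mk (multIdeal A (p ^ 2)) b) = eta A b := rfl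

/-- The canonical crossed extension
`0 → A → R(A) / p² R(A) → (ℤ/p²)[A] → A → 0` of an algebra `A` over the field with `p` elements. -/
noncomputable def canonicalExtension : CrossedExtension (ZMod (p ^ 2)) A A where
  C₀ := ZModBracket A (p ^ 2)
  C₁ := RMod A (p ^ 2)
  central k x := by
    obtain ⟨n, rfl⟩ := ZMod.natCast_zmod_surjective k
    obtain ⟨r, rfl⟩ := rmk_surjective _ x
    rw [map_natCast, ← map_natCast (Ideal.Quotient.mk (multIdeal A (p ^ 2))), smul_rmk,
      op_smul_rmk]
    exact congrArg (rmk _) (Subtype.ext (Nat.cast_comm _ _))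
  bdry := rbdry (p ^ 2)
  bdry_smul c x := by
    obtain ⟨b, rfl⟩ := Ideal.Quotient.mk_surjective c
    obtain ⟨r, rfl⟩ := rmk_surjective _ x
    rw [smul_rmk, rbdry_rmk, rbdry_rmk, ← map_mul]
    rfl
  bdry_op_smul c x := by
    obtain ⟨b, rfl⟩ := Ideal.Quotient.mk_surjective c
    obtain ⟨r, rfl⟩ := rmk_surjective _ x
    rw [op_smul_rmk, rbdry_rmk, rbdry_rmk, ← map_mul]
    rfl
  crossed x y := by
    obtain ⟨r, rfl⟩ := rmk_surjective _ x
    obtain ⟨s, rfl⟩ := rmk_surjective _ y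
    rw [rbdry_rmk, rbdry_rmk, smul_rmk, op_smul_rmk]
    rfl
  π := etaMod p A
  i := canonicalIncl p
  i_smul c m := by
    obtain ⟨b, rfl⟩ := Ideal.Quotient.mk_surjective c
    rw [etaMod_mk, canonicalIncl_apply, canonicalIncl_apply, smul_rmk, eq_comm, ← sub_eq_zero,
      ← map_sub, rmk_eq_zero]
    refine ⟨⟨b * bracket m - bracket (eta A b * m), ?_⟩, Subtype.ext ?_⟩
    · rw [RingHom.mem_ker, map_sub, map_mul, eta_bracket, eta_bracket, sub_self]
    · change p ^ 2 • (b * bracket m - bracket (eta A b * m))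
        = b * (p • p • bracket m) - p • p • bracket (eta A b * m)
      simp only [smul_smul, ← pow_two, smul_sub, mul_smul_comm]
  i_op_smul c m := by
    obtain ⟨b, rfl⟩ := Ideal.Quotient.mk_surjective c
    rw [etaMod_mk, canonicalIncl_apply, canonicalIncl_apply, op_smul_rmk, eq_comm,
      ← sub_eq_zero, ← map_sub, rmk_eq_zero]
    refine ⟨⟨bracket m * b - bracket (m * eta A b), ?_⟩, Subtype.ext ?_⟩
    · rw [RingHom.mem_ker, map_sub, map_mul, eta_bracket, eta_bracket, sub_self]
    · change p ^ 2 • (bracket m * b - bracket (m * eta A b))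
        = (p • p • bracket m) * b - p • p • bracket (m * eta A b)
      simp only [smul_smul, ← pow_two, smul_sub, smul_mul_assoc]
  i_injective := by
    rw [injective_iff_map_eq_zero]
    intro a ha
    rw [canonicalIncl_apply, rmk_eq_zero] at ha
    obtain ⟨s, hs⟩ := ha
    have h : p ^ 2 • ((s : ZBracket A) - bracket a) = 0 := by
      have h' : p ^ 2 • (s : ZBracket A) = p • p • bracket a := congrArg Subtype.val hs
      rw [smul_sub, h', smul_smul, ← pow_two, sub_self]
    have h₀ := zbracket_torsionFree (pow_ne_zero 2 (Fact.out : p.Prime).ne_zero) h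
    have h₁ := congrArg (eta A) h₀
    rw [map_sub, (RingHom.mem_ker (f := eta A)).1 s.2, eta_bracket, map_zero, zero_sub,
      neg_eq_zero] at h₁
    exact h₁
  exact_C₁ x := by
    obtain ⟨r, rfl⟩ := rmk_surjective _ x
    rw [rbdry_rmk, Ideal.Quotient.eq_zero_iff_mem, mem_multIdeal]
    constructor
    · rintro ⟨b, hb⟩
      refine ⟨eta A b, ?_⟩
      rw [canonicalIncl_apply, eq_comm, ← sub_eq_zero, ← map_sub, rmk_eq_zero]
      refine ⟨⟨b - bracket (eta A b), sq_sub_mem b⟩, Subtype.ext ?_⟩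
      change p ^ 2 • (b - bracket (eta A b)) = (r : ZBracket A) - p • p • bracket (eta A b)
      rw [smul_sub, hb, smul_smul, ← pow_two]
    · rintro ⟨m, hm⟩
      rw [canonicalIncl_apply, eq_comm, ← sub_eq_zero, ← map_sub, rmk_eq_zero] at hm
      obtain ⟨s, hs⟩ := hm
      refine ⟨(s : ZBracket A) + bracket m, ?_⟩
      have h' : p ^ 2 • (s : ZBracket A) = r - p • p • bracket m := congrArg Subtype.val hs
      rw [smul_add, h', smul_smul, ← pow_two, sub_add_cancel]
  exact_C₀ c := by
    obtain ⟨b, rfl⟩ := Ideal.Quotient.mk_surjective c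
    rw [etaMod_mk]
    constructor
    · intro h
      exact ⟨rmk _ ⟨b, h⟩, rfl⟩
    · rintro ⟨x, hx⟩
      obtain ⟨r, rfl⟩ := rmk_surjective _ x
      rw [← etaMod_mk p, ← hx, rbdry_rmk, etaMod_mk]
      exact r.2
  π_surjective a := ⟨Ideal.Quotient.mk _ (bracket a), eta_bracket a⟩

end CanonicalExtension

/-! ### Bimodules over algebras over the field with `p` elements -/

/-- An algebra `A` over the field with `p` elements together with an `A`-bimodule `M`. -/
structure FpBimodule (p : ℕ) where
  A : Type u
  M : Type t
  [ring : Ring A]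
  [algebra : Algebra (ZMod p) A]
  [addCommGroup : AddCommGroup M]
  [moduleLeft : Module A M]
  [moduleRight : Module Aᵐᵒᵖ M]
  [smulCommClass : SMulCommClass A Aᵐᵒᵖ M]

namespace FpBimodule

attribute [instance] ring algebra addCommGroup moduleLeft moduleRight smulCommClass

variable {p : ℕ} (X Y : FpBimodule.{u, t} p)

/-- The `ℤ/p²`-algebra structure of an algebra over the field with `p` elements. -/
noncomputable instance : Algebra (ZMod (p ^ 2)) X.A :=
  Algebra.compHom X.A (ZMod.castHom (dvd_pow_self p two_ne_zero) (ZMod p))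

/-- Morphisms: a ring homomorphism `X.A → Y.A` with a compatible homomorphism `Y.M → X.M`. -/
abbrev Hom : Type (max u t) := BimoduleHom X.A X.M Y.A Y.M

variable {X Y}

/-- Functoriality of `Shuklaⁿ(A/(ℤ/p²), M)`. -/
noncomputable def mapZModSq (φ : X.Hom Y) (n : ℕ) :
    Shukla (ZMod (p ^ 2)) Y.A Y.M n →+ Shukla (ZMod (p ^ 2)) X.A X.M n :=
  Shukla.map (ZMod (p ^ 2)) (ZMod (p ^ 2)) φ
    (DFunLike.congr_fun (RingHom.ext_zmod (φ.g.comp (algebraMap _ _)) (algebraMap _ _))) n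

/-- Functoriality of `Shuklaⁿ(A/ℤ, M)`. -/
noncomputable def mapInt (φ : X.Hom Y) (n : ℕ) :
    Shukla ℤ Y.A Y.M n →+ Shukla ℤ X.A X.M n :=
  Shukla.map ℤ ℤ φ (fun k => by simp) n

variable (X)

/-- The base change homomorphism `bⁿ : Shuklaⁿ(A/(ℤ/p²), M) → Shuklaⁿ(A/ℤ, M)`. -/
noncomputable def baseChange (n : ℕ) :
    Shukla (ZMod (p ^ 2)) X.A X.M n →+ Shukla ℤ X.A X.M n :=
  Shukla.map ℤ (ZMod (p ^ 2)) (BimoduleHom.id X.A X.M) (fun k => by simp [BimoduleHom.id]) n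

/-- The class `(σ)_A` in `Shukla³(A/(ℤ/p²), A)` of the canonical crossed extension. -/
noncomputable def canonicalClass [Fact p.Prime] : Shukla (ZMod (p ^ 2)) X.A X.A 3 :=
  (canonicalExtension p (A := X.A)).shuklaClass

/-- The map `H⁰(A, M) → Shukla³(A/(ℤ/p²), M)` sending `m` to the image of `(σ)_A` under the
homomorphism induced by the bimodule homomorphism `A → M`, `1 ↦ m`. -/
noncomputable def canonicalMap [Fact p.Prime] (m : H0 X.A X.M) :
    Shukla (ZMod (p ^ 2)) X.A X.M 3 :=
  Shukla.map (ZMod (p ^ 2)) (ZMod (p ^ 2)) (BimoduleHom.ofH0 m) (fun _ => rfl) 3 X.canonicalClass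

end FpBimodule

end ShuklaCohomology

/-!
# Shukla cohomology of degree three over `ℤ/p²` and over `ℤ`

Over a ground ring `K` that is a quotient of `ℤ`, the third Shukla cohomology only depends on the
part of degrees `0` and `1` of a quasi-free resolution `P → A`. A bimodule homomorphism `θ` from the
cycles of degree `1` to `M` that vanishes on the elements `d x * y - x * d y` is called a crossed
map; the derivation `w ↦ θ (d w)` on elements `w` of degree `2` is a cocycle. Since `P` is free as
an algebra, Hochschild cocycles of two and more variables have primitives, and therefore every class
of degree `3` is the class of a crossed map, and the class vanishes if and only if `θ` extends to a
bimodule homomorphism on all elements of degree `1` (`crossedClass_surjective`,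
`crossedClass_eq_zero_iff`). Lifts of ring homomorphisms to truncations exist and are unique up to
homotopy, so that all induced maps may be computed with arbitrary lifts of the truncations
(`IsQuasiFree.exists_truncHom`, `Shukla.map_crossedClass`). The class of a crossed extension is the
class of the identification of the kernel of `∂` with `M` (`CrossedExtension.shuklaClass_eq`).

Let `A` be an algebra over `𝔽_p`. Then `p = d x` for some `x` of degree `1`, as `p` vanishes in `A`.
Over `ℤ/p²` the element `p x` is a cycle, and `θ ↦ θ (p x)` is a homomorphism to `H⁰(A, M)` that
depends only on the class of `θ` since `p M = 0`; this is `secondaryClass`. The isomorphism of the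
theorem has base change and this secondary invariant as its components.

* For the canonical crossed extension one may take `x = p [1]`, and `p x = i 1`; so its secondary
  invariant is `1` (`secondary_kernelMap_canonicalExtension`). Its base change vanishes, because a
  morphism from a quasi-free chain algebra over the integers to `(ℤ/p²)[A]` lifts to `ℤ[A]`
  (`pull_kernelMap_canonicalExtension_mem`).
* Let `Q` be the resolution over the integers. Although `Q / p² Q` is not a resolution of `A`, the
  truncation of the resolution over `ℤ/p²` maps to it. As `Q` is torsion-free, a cycle of degree `1`
  of `Q / p² Q` is represented by `e` with `d e = p² c` for a unique `c`, and `e - c (p x)` is a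
  cycle of `Q`. Hence a crossed map `θ` on `Q` extends to the reduction by `e ↦ θ (e - c (p x))`,
  and the extension has vanishing secondary invariant (`exists_mod_crossedMap`). This makes base
  change surjective on the kernel of the secondary invariant (`exists_baseChange_eq`).
* By the same decomposition `e = (e - c (p x)) + c (p x)`, a crossed map over `ℤ/p²` with vanishing
  secondary invariant is extendable if its base change to `ℤ` is (`pull_ofMod_mem_extendable`,
  `eq_zero_of_baseChange`). So the two components are jointly injective.
-/

namespace ShuklaCohomology

/-! ### Truncated chain algebras and crossed maps -/

/-- The part of degrees `0` and `1` of a chain algebra over `A` whose homology in degree `0` is `A`.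
The two homogeneous parts are subgroups of an ambient ring, on which the differential `d` and the
augmentation `ε` are defined; the Leibniz rule is only required for products of total degree `1`. -/
structure TruncatedAlgebra (A : Type u) [Ring A] where
  carrier : Type w
  [ring : Ring carrier]
  deg0 : Subring carrier
  deg1 : AddSubgroup carrier
  d : carrier →+ carrier
  ε : carrier →+* A
  mul_mem : ∀ a ∈ deg0, ∀ x ∈ deg1, a * x ∈ deg1
  mul_mem' : ∀ a ∈ deg0, ∀ x ∈ deg1, x * a ∈ deg1
  d_mem : ∀ x ∈ deg1, d x ∈ deg0
  ε_d : ∀ x ∈ deg1, ε (d x) = 0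
  d_mul : ∀ a ∈ deg0, ∀ x ∈ deg1, d (a * x) = a * d x
  d_mul' : ∀ a ∈ deg0, ∀ x ∈ deg1, d (x * a) = d x * a
  exact : ∀ a ∈ deg0, ε a = 0 → ∃ x ∈ deg1, d x = a
  surjective : ∀ a, ∃ x ∈ deg0, ε x = a

attribute [instance] TruncatedAlgebra.ring

namespace TruncatedAlgebra

variable {A : Type u} [Ring A] (B : TruncatedAlgebra.{w} A)

/-- The cycles of degree `1`. -/
def cycles : AddSubgroup B.carrier := B.deg1 ⊓ B.d.ker

theorem peiffer_mem {x y : B.carrier} (hx : x ∈ B.deg1) (hy : y ∈ B.deg1) :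
    B.d x * y - x * B.d y ∈ B.cycles := by
  refine ⟨B.deg1.sub_mem (B.mul_mem _ (B.d_mem x hx) _ hy) (B.mul_mem' _ (B.d_mem y hy) _ hx), ?_⟩
  change B.d _ = 0
  rw [map_sub, B.d_mul _ (B.d_mem x hx) _ hy, B.d_mul' _ (B.d_mem y hy) _ hx, sub_self]

theorem mul_mem_cycles {a x : B.carrier} (ha : a ∈ B.deg0) (hx : x ∈ B.cycles) :
    a * x ∈ B.cycles :=
  ⟨B.mul_mem _ ha _ hx.1, show B.d _ = 0 by
    rw [B.d_mul _ ha _ hx.1, show B.d x = 0 from hx.2, mul_zero]⟩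

theorem mul_mem_cycles' {a x : B.carrier} (ha : a ∈ B.deg0) (hx : x ∈ B.cycles) :
    x * a ∈ B.cycles :=
  ⟨B.mul_mem' _ ha _ hx.1, show B.d _ = 0 by
    rw [B.d_mul' _ ha _ hx.1, show B.d x = 0 from hx.2, zero_mul]⟩

variable (M : Type t) [AddCommGroup M] [Module A M] [Module Aᵐᵒᵖ M]

/-- The bimodule homomorphisms from the `1`-cycles to `M` that vanish on the elements
`d x * y - x * d y`. In terms of crossed extensions they are the homomorphisms to `M` from the
kernel of the crossed bimodule associated with `B`. -/
def crossedMaps : AddSubgroup (B.cycles →+ M) where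
  carrier := {θ |
    (∀ a ∈ B.deg0, ∀ x y : B.cycles, (y : B.carrier) = a * x → θ y = B.ε a • θ x) ∧
    (∀ a ∈ B.deg0, ∀ x y : B.cycles, (y : B.carrier) = x * a → θ y = op (B.ε a) • θ x) ∧
    (∀ x ∈ B.deg1, ∀ y ∈ B.deg1, ∀ z : B.cycles,
      (z : B.carrier) = B.d x * y - x * B.d y → θ z = 0)}
  zero_mem' := by simp
  add_mem' := by
    rintro θ θ' ⟨h₁, h₂, h₃⟩ ⟨h₁', h₂', h₃'⟩
    refine ⟨fun a ha x y h => ?_, fun a ha x y h => ?_, fun x hx y hy z h => ?_⟩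
    · simp [h₁ a ha x y h, h₁' a ha x y h]
    · simp [h₂ a ha x y h, h₂' a ha x y h]
    · simp [h₃ x hx y hy z h, h₃' x hx y hy z h]
  neg_mem' := by
    rintro θ ⟨h₁, h₂, h₃⟩
    refine ⟨fun a ha x y h => ?_, fun a ha x y h => ?_, fun x hx y hy z h => ?_⟩
    · simp [h₁ a ha x y h]
    · simp [h₂ a ha x y h]
    · simp [h₃ x hx y hy z h]

/-- The bimodule homomorphisms from the part of degree `1` to `M`. -/
def derivations : AddSubgroup (B.deg1 →+ M) where
  carrier := {D |
    (∀ a ∈ B.deg0, ∀ x y : B.deg1, (y : B.carrier) = a * x → D y = B.ε a • D x) ∧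
    (∀ a ∈ B.deg0, ∀ x y : B.deg1, (y : B.carrier) = x * a → D y = op (B.ε a) • D x)}
  zero_mem' := by simp
  add_mem' := by
    rintro θ θ' ⟨h₁, h₂⟩ ⟨h₁', h₂'⟩
    refine ⟨fun a ha x y h => ?_, fun a ha x y h => ?_⟩
    · simp [h₁ a ha x y h, h₁' a ha x y h]
    · simp [h₂ a ha x y h, h₂' a ha x y h]
  neg_mem' := by
    rintro θ ⟨h₁, h₂⟩
    refine ⟨fun a ha x y h => ?_, fun a ha x y h => ?_⟩
    · simp [h₁ a ha x y h]
    · simp [h₂ a ha x y h]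

/-- The restriction of a map to the cycles. -/
def restrict : (B.deg1 →+ M) →+ (B.cycles →+ M) where
  toFun D := D.comp (AddSubgroup.inclusion inf_le_left)
  map_zero' := rfl
  map_add' _ _ := rfl

/-- The maps from the cycles to `M` that extend to a bimodule homomorphism on the whole part of
degree `1`. -/
def extendable : AddSubgroup (B.cycles →+ M) := (B.derivations M).map (B.restrict M)

variable {B M}

/-- A bimodule homomorphism on the part of degree `1` is determined by its values on elements of
the ambient ring; this is a way to show that a map is extendable without subtypes. -/
theorem mem_extendable_of {θ : B.cycles →+ M} (D : B.deg1 →+ M)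
    (h₁ : ∀ a (ha : a ∈ B.deg0) x (hx : x ∈ B.deg1),
      D ⟨a * x, B.mul_mem a ha x hx⟩ = B.ε a • D ⟨x, hx⟩)
    (h₂ : ∀ a (ha : a ∈ B.deg0) x (hx : x ∈ B.deg1),
      D ⟨x * a, B.mul_mem' a ha x hx⟩ = op (B.ε a) • D ⟨x, hx⟩)
    (h₃ : ∀ x (hx : x ∈ B.cycles), θ ⟨x, hx⟩ = D ⟨x, hx.1⟩) : θ ∈ B.extendable M := by
  refine ⟨D, ⟨?_, ?_⟩, AddMonoidHom.ext fun x => (h₃ x x.2).symm⟩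
  · rintro a ha ⟨x, hx⟩ ⟨y, hy⟩ (rfl : y = a * x)
    exact h₁ a ha x hx
  · rintro a ha ⟨x, hx⟩ ⟨y, hy⟩ (rfl : y = x * a)
    exact h₂ a ha x hx

variable {A' : Type u'} [Ring A'] {A'' : Type*} [Ring A'']

/-- Morphisms of truncated chain algebras that lie over a ring homomorphism `g`. -/
structure Hom (B : TruncatedAlgebra.{w} A) (C : TruncatedAlgebra.{w'} A') (g : A →+* A') where
  toRingHom : B.carrier →+* C.carrier
  map_deg0 : ∀ a ∈ B.deg0, toRingHom a ∈ C.deg0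
  map_deg1 : ∀ x ∈ B.deg1, toRingHom x ∈ C.deg1
  map_d : ∀ x ∈ B.deg1, toRingHom (B.d x) = C.d (toRingHom x)
  map_ε : ∀ a ∈ B.deg0, C.ε (toRingHom a) = g (B.ε a)

namespace Hom

variable {C : TruncatedAlgebra.{w'} A'} {g : A →+* A'}

/-- The composite of two morphisms. -/
def comp {C' : TruncatedAlgebra A''} {g' : A' →+* A''} (G : C.Hom C' g')
    (F : B.Hom C g) : B.Hom C' (g'.comp g) where
  toRingHom := G.toRingHom.comp F.toRingHom
  map_deg0 a ha := G.map_deg0 _ (F.map_deg0 a ha)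
  map_deg1 x hx := G.map_deg1 _ (F.map_deg1 x hx)
  map_d x hx := (congrArg _ (F.map_d x hx)).trans (G.map_d _ (F.map_deg1 x hx))
  map_ε a ha := (G.map_ε _ (F.map_deg0 a ha)).trans (congrArg _ (F.map_ε a ha))

theorem map_mem_cycles (F : B.Hom C g) {x : B.carrier} (hx : x ∈ B.cycles) :
    F.toRingHom x ∈ C.cycles :=
  ⟨F.map_deg1 x hx.1, show C.d _ = 0 by
    rw [← F.map_d x hx.1, show B.d x = 0 from hx.2, map_zero]⟩

/-- The map induced on `1`-cycles. -/
def cyclesMap (F : B.Hom C g) : B.cycles →+ C.cycles where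
  toFun x := ⟨F.toRingHom x, F.map_mem_cycles x.2⟩
  map_zero' := Subtype.ext (map_zero _)
  map_add' _ _ := Subtype.ext (map_add _ _ _)

variable {M' : Type t'} [AddCommGroup M'] [Module A' M'] [Module A'ᵐᵒᵖ M']

/-- The map `θ ↦ h ∘ θ ∘ F` induced by a morphism `F` and a homomorphism `h` of bimodules. -/
def pull (φ : BimoduleHom A M A' M') (F : B.Hom C φ.g) : (C.cycles →+ M') →+ (B.cycles →+ M) where
  toFun θ := (φ.h.comp θ).comp F.cyclesMap
  map_zero' := AddMonoidHom.ext fun _ => map_zero φ.h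
  map_add' _ _ := AddMonoidHom.ext fun _ => map_add φ.h _ _

theorem pull_apply (φ : BimoduleHom A M A' M') (F : B.Hom C φ.g) (θ : C.cycles →+ M') {x}
    (hx : x ∈ B.cycles) :
    F.pull φ θ ⟨x, hx⟩ = φ.h (θ ⟨F.toRingHom x, F.map_mem_cycles hx⟩) := rfl

theorem pull_mem (φ : BimoduleHom A M A' M') (F : B.Hom C φ.g) {θ : C.cycles →+ M'}
    (hθ : θ ∈ C.crossedMaps M') : F.pull φ θ ∈ B.crossedMaps M := by
  obtain ⟨h₁, h₂, h₃⟩ := hθ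
  refine ⟨fun a ha x y h => ?_, fun a ha x y h => ?_, fun x hx y hy z h => ?_⟩
  · change φ.h (θ _) = B.ε a • φ.h (θ _)
    rw [h₁ _ (F.map_deg0 a ha) (F.cyclesMap x) (F.cyclesMap y)
      ((congrArg F.toRingHom h).trans (map_mul _ _ _)), F.map_ε a ha, φ.map_smul]
  · change φ.h (θ _) = op (B.ε a) • φ.h (θ _)
    rw [h₂ _ (F.map_deg0 a ha) (F.cyclesMap x) (F.cyclesMap y)
      ((congrArg F.toRingHom h).trans (map_mul _ _ _)), F.map_ε a ha, φ.map_op_smul]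
  · change φ.h (θ _) = 0
    rw [h₃ _ (F.map_deg1 x hx) _ (F.map_deg1 y hy) (F.cyclesMap z), map_zero]
    refine (congrArg F.toRingHom h).trans ?_
    rw [map_sub, map_mul, map_mul, F.map_d x hx, F.map_d y hy]

end Hom

/-- Two morphisms over the same homomorphism that are homotopic in degree `0` induce the same map
up to extendable maps. The extension is `x ↦ θ (F x - G x - h (d x))`. -/
theorem Hom.pull_sub_pull_mem {C : TruncatedAlgebra.{w'} A'} {M' : Type t'} [AddCommGroup M']
    [Module A' M'] [Module A'ᵐᵒᵖ M'] (φ : BimoduleHom A M A' M') (F G : B.Hom C φ.g)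
    (h : B.carrier →+ C.carrier) (h_mem : ∀ a ∈ B.deg0, h a ∈ C.deg1)
    (h_d : ∀ a ∈ B.deg0, C.d (h a) = F.toRingHom a - G.toRingHom a)
    (h_mul : ∀ a ∈ B.deg0, ∀ b ∈ B.deg0,
      h (a * b) = h a * G.toRingHom b + F.toRingHom a * h b)
    {θ : C.cycles →+ M'} (hθ : θ ∈ C.crossedMaps M') :
    F.pull φ θ - G.pull φ θ ∈ B.extendable M := by
  obtain ⟨h₁, h₂, h₃⟩ := hθ
  have hmem : ∀ x ∈ B.deg1, F.toRingHom x - G.toRingHom x - h (B.d x) ∈ C.cycles := by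
    intro x hx
    refine ⟨C.deg1.sub_mem (C.deg1.sub_mem (F.map_deg1 x hx) (G.map_deg1 x hx))
      (h_mem _ (B.d_mem x hx)), ?_⟩
    change C.d _ = 0
    rw [map_sub, map_sub, h_d _ (B.d_mem x hx), F.map_d x hx, G.map_d x hx, sub_self]
  let q : B.deg1 →+ C.cycles :=
    { toFun := fun x => ⟨_, hmem x x.2⟩
      map_zero' := Subtype.ext (by simp)
      map_add' := fun x y => Subtype.ext (by
        simp only [AddSubgroup.coe_add, map_add]; abel) }
  refine mem_extendable_of ((φ.h.comp θ).comp q) (fun a ha x hx => ?_) (fun a ha x hx => ?_)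
    (fun x hx => ?_)
  · change φ.h (θ _) = _ • φ.h (θ _)
    rw [← φ.map_smul, ← F.map_ε a ha, ← h₁ _ (F.map_deg0 a ha) (q ⟨x, hx⟩)
      ⟨_, C.mul_mem_cycles (F.map_deg0 a ha) (q ⟨x, hx⟩).2⟩ rfl, ← sub_eq_zero, ← map_sub,
      ← map_sub, h₃ _ (h_mem a ha) _ (G.map_deg1 x hx), map_zero]
    change (F.toRingHom (a * x) - G.toRingHom (a * x) - h (B.d (a * x)))
      - F.toRingHom a * (F.toRingHom x - G.toRingHom x - h (B.d x))
        = C.d (h a) * G.toRingHom x - h a * C.d (G.toRingHom x)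
    rw [B.d_mul a ha x hx, h_mul a ha _ (B.d_mem x hx), h_d a ha, G.map_d x hx, map_mul, map_mul]
    noncomm_ring
  · change φ.h (θ _) = _ • φ.h (θ _)
    rw [← φ.map_op_smul, ← F.map_ε a ha]
    have hε : C.ε (F.toRingHom a) = C.ε (G.toRingHom a) := by rw [F.map_ε a ha, G.map_ε a ha]
    rw [hε, ← h₂ _ (G.map_deg0 a ha) (q ⟨x, hx⟩)
      ⟨_, C.mul_mem_cycles' (G.map_deg0 a ha) (q ⟨x, hx⟩).2⟩ rfl, ← sub_eq_zero, ← map_sub,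
      ← map_sub, ← neg_eq_zero, ← map_neg, ← map_neg, h₃ _ (F.map_deg1 x hx) _ (h_mem a ha),
      map_zero]
    change -((F.toRingHom (x * a) - G.toRingHom (x * a) - h (B.d (x * a)))
      - (F.toRingHom x - G.toRingHom x - h (B.d x)) * G.toRingHom a)
        = C.d (F.toRingHom x) * h a - F.toRingHom x * C.d (h a)
    rw [B.d_mul' a ha x hx, h_mul _ (B.d_mem x hx) a ha, h_d a ha, F.map_d x hx, map_mul, map_mul]
    noncomm_ring
  · change φ.h (θ _) - φ.h (θ _) = φ.h (θ _)
    rw [← map_sub, ← map_sub]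
    congr 2
    refine Subtype.ext ?_
    change F.toRingHom x - G.toRingHom x = F.toRingHom x - G.toRingHom x - h (B.d x)
    rw [show B.d x = 0 from hx.2, map_zero, sub_zero]

end TruncatedAlgebra

/-! ### Quasi-free chain algebras -/

namespace ChainAlgebraOver

/-- A family of homogeneous elements that freely generates the underlying algebra of `P`. -/
structure FreeGenerators {K : Type v} [CommRing K] {A : Type u} [Ring A] [Algebra K A]
    (P : ChainAlgebraOver.{v, w} K A) where
  X : Type w
  deg : X → ℕ
  x : X → P.carrier
  mem : ∀ i, x i ∈ P.grading (deg i)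
  bijective : Function.Bijective (FreeAlgebra.lift K x)

theorem IsQuasiFree.nonempty_freeGenerators {K : Type v} [CommRing K] {A : Type u} [Ring A]
    [Algebra K A] {P : ChainAlgebraOver.{v, w} K A} (h : P.IsQuasiFree) :
    Nonempty P.FreeGenerators := by
  obtain ⟨X, deg, x, hx, hb⟩ := h
  exact ⟨⟨X, deg, x, hx, hb⟩⟩

variable {K : Type v} [CommRing K] {A : Type u} [Ring A] [Algebra K A]
  {P : ChainAlgebraOver.{v, w} K A}

theorem one_mem_grading : (1 : P.carrier) ∈ P.grading 0 := SetLike.one_mem_graded P.grading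

theorem mul_mem_grading {m n : ℕ} {a b : P.carrier} (ha : a ∈ P.grading m)
    (hb : b ∈ P.grading n) : a * b ∈ P.grading (m + n) := SetLike.mul_mem_graded ha hb

/-- A subgroup that contains all homogeneous elements is everything. This is applied to equalizers
of additive maps. -/
theorem mem_of_homogeneous (V : AddSubgroup P.carrier) (h : ∀ n, ∀ a ∈ P.grading n, a ∈ V)
    (a : P.carrier) : a ∈ V := by
  induction a using DirectSum.Decomposition.inductionOn P.grading with
  | zero => exact zero_mem _
  | homogeneous a => exact h _ _ a.2
  | add a b ha hb => exact add_mem ha hb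

namespace FreeGenerators

variable (G : P.FreeGenerators)

/-- The isomorphism from the free algebra. -/
noncomputable def equiv : FreeAlgebra K G.X ≃ₐ[K] P.carrier :=
  AlgEquiv.ofBijective _ G.bijective

theorem equiv_ι (i : G.X) : G.equiv (FreeAlgebra.ι K i) = G.x i := by simp [equiv]

theorem equiv_symm_x (i : G.X) : G.equiv.symm (G.x i) = FreeAlgebra.ι K i := by
  rw [← equiv_ι, AlgEquiv.symm_apply_apply]

theorem equiv_word_cons (i : G.X) (l : List G.X) :
    G.equiv (word (i :: l)) = G.x i * G.equiv (word l) := by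
  rw [show word (K := K) (i :: l) = FreeAlgebra.ι K i * word l by simp [word], map_mul, equiv_ι]

theorem equiv_word_nil : G.equiv (word []) = 1 := by
  rw [show word (K := K) ([] : List G.X) = 1 by simp [word], map_one]

theorem equiv_word_mem (l : List G.X) : G.equiv (word l) ∈ P.grading (wordDeg G.deg l) := by
  induction l with
  | nil => rw [equiv_word_nil]; exact one_mem_grading
  | cons i l ih =>
    rw [equiv_word_cons, show wordDeg G.deg (i :: l) = G.deg i + wordDeg G.deg l by simp [wordDeg]]
    exact mul_mem_grading (G.mem i) ih

theorem equiv_mem {n : ℕ} {z : FreeAlgebra K G.X} (hz : z ∈ freeGrading (K := K) G.deg n) :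
    G.equiv z ∈ P.grading n := by
  induction hz using Submodule.span_induction with
  | zero => simp
  | add x y _ _ h h' => rw [map_add]; exact add_mem h h'
  | smul a x _ h => rw [map_smul]; exact Submodule.smul_mem _ _ h
  | mem z h =>
    obtain ⟨l, rfl, rfl⟩ := h
    exact G.equiv_word_mem l

theorem equiv_symm_mem {n : ℕ} {y : P.carrier} (hy : y ∈ P.grading n) :
    G.equiv.symm y ∈ freeGrading (K := K) G.deg n := by
  have key : ∀ z : FreeAlgebra K G.X, (DirectSum.decompose P.grading (G.equiv z) n : P.carrier)
      = G.equiv (DirectSum.decompose (freeGrading (K := K) G.deg) z n : FreeAlgebra K G.X) := by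
    classical
    intro z
    induction z using DirectSum.Decomposition.inductionOn (freeGrading (K := K) G.deg) with
    | zero => simp
    | add a b ha hb => simp [DirectSum.decompose_add, ha, hb]
    | @homogeneous m z =>
      by_cases hmn : m = n
      · subst hmn
        rw [DirectSum.decompose_of_mem_same _ (G.equiv_mem z.2),
          DirectSum.decompose_of_mem_same _ z.2]
      · rw [DirectSum.decompose_of_mem_ne _ (G.equiv_mem z.2) hmn,
          DirectSum.decompose_of_mem_ne _ z.2 hmn, map_zero]
  have h := key (G.equiv.symm y)
  rw [AlgEquiv.apply_symm_apply, DirectSum.decompose_of_mem_same _ hy] at h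
  rw [h, AlgEquiv.symm_apply_apply]
  exact SetLike.coe_mem _

-- `K` is a quotient of `ℤ`, so that additive maps between `K`-modules are `K`-linear
variable (hK : ∀ k : K, ∃ n : ℤ, (n : K) = k)

include hK

/-- Induction on homogeneous elements: they are integral combinations of words in the
generators. -/
theorem grading_le (V : ℕ → AddSubgroup P.carrier) (h_one : 1 ∈ V 0)
    (h_mul : ∀ i n a, a ∈ P.grading n → a ∈ V n → G.x i * a ∈ V (G.deg i + n)) {n : ℕ}
    {a : P.carrier} (ha : a ∈ P.grading n) : a ∈ V n := by
  rw [← G.equiv.apply_symm_apply a]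
  have hz := G.equiv_symm_mem ha
  generalize G.equiv.symm a = z at hz
  clear ha
  induction hz using Submodule.span_induction with
  | zero => rw [map_zero]; exact zero_mem _
  | add x y _ _ h h' => rw [map_add]; exact add_mem h h'
  | smul k x _ h =>
    obtain ⟨m, rfl⟩ := hK k
    rw [map_smul, Int.cast_smul_eq_zsmul]
    exact zsmul_mem h m
  | mem z h =>
    obtain ⟨l, rfl, rfl⟩ := h
    induction l with
    | nil => rw [equiv_word_nil]; exact h_one
    | cons i l ih =>
      rw [equiv_word_cons,
        show wordDeg G.deg (i :: l) = G.deg i + wordDeg G.deg l by simp [wordDeg]]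
      exact h_mul _ _ _ (G.equiv_word_mem l) ih

/-- The universal property with respect to rings that receive a homomorphism from `K`. -/
theorem exists_ringHom {R : Type*} [Ring R] (κ : K →+* R) (f : G.X → R) :
    ∃ F : P.carrier →+* R, ∀ i, F (G.x i) = f i := by
  let _ : Algebra K R := κ.toAlgebra' fun k r => by
    obtain ⟨n, rfl⟩ := hK k
    rw [map_intCast]
    exact Int.cast_comm n r
  refine ⟨(FreeAlgebra.lift K f : FreeAlgebra K G.X →+* R).comp
    (G.equiv.symm : P.carrier →+* FreeAlgebra K G.X), fun i => ?_⟩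
  change FreeAlgebra.lift K f (G.equiv.symm (G.x i)) = f i
  rw [equiv_symm_x, FreeAlgebra.lift_ι_apply]

end FreeGenerators

/-- The truncation of a chain algebra that is weakly equivalent to `A`. The ambient ring is the
whole underlying ring of the chain algebra. -/
def trunc (P : ChainAlgebraOver.{v, w} K A) (hP : P.IsWeakEquivalence) :
    TruncatedAlgebra.{w} A where
  carrier := P.carrier
  deg0 :=
    { (P.grading 0).toAddSubgroup with
      one_mem' := one_mem_grading
      mul_mem' := fun ha hb => mul_mem_grading ha hb }
  deg1 := (P.grading 1).toAddSubgroup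
  d := P.d.toAddMonoidHom
  ε := P.ε.toRingHom
  mul_mem a ha x hx := by
    have := mul_mem_grading (P := P) (m := 0) (n := 1) ha hx
    rwa [zero_add] at this
  mul_mem' a ha x hx := mul_mem_grading (P := P) (m := 1) (n := 0) hx ha
  d_mem x hx := P.d_mem 0 x hx
  ε_d x _ := P.ε_d x
  d_mul a ha x hx := by
    change P.d (a * x) = a * P.d x
    rw [P.leibniz 0 a ha, P.d_zero a ha]
    simp
  d_mul' a ha x hx := by
    change P.d (x * a) = P.d x * a
    rw [P.leibniz 1 x hx, P.d_zero a ha]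
    simp
  exact := hP.exact_zero
  surjective := hP.surjective

section Hom

variable {K' : Type v'} [CommRing K'] {A' : Type u'} [Ring A'] [Algebra K' A'] [Algebra K K']
  {Q : ChainAlgebraOver.{v', w'} K' A'} {g : A →+* A'}

/-- The truncation of a morphism. -/
def Hom.trunc (F : P.Hom Q g) (hP : P.IsWeakEquivalence) (hQ : Q.IsWeakEquivalence) :
    (P.trunc hP).Hom (Q.trunc hQ) g where
  toRingHom := F.toRingHom
  map_deg0 := F.map_mem 0
  map_deg1 := F.map_mem 1
  map_d x _ := F.map_d x
  map_ε a _ := F.map_ε a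

end Hom

variable (hK : ∀ k : K, ∃ n : ℤ, (n : K) = k) (hP : P.IsWeakEquivalence)
  {A' : Type u'} [Ring A'] {C : TruncatedAlgebra.{w'} A'}

include hK

/-- Two morphisms from a quasi-free chain algebra over the same ring homomorphism are homotopic in
degree `0`. The homotopy is the upper right entry of a homomorphism to upper triangular
matrices. -/
theorem FreeGenerators.exists_homotopy (S : P.FreeGenerators) (F G : P.carrier →+* C.carrier)
    (hF : ∀ a ∈ P.grading 0, F a ∈ C.deg0) (hG : ∀ a ∈ P.grading 0, G a ∈ C.deg0)
    (hε : ∀ a ∈ P.grading 0, C.ε (F a) = C.ε (G a)) :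
    ∃ h : P.carrier →+ C.carrier, (∀ a ∈ P.grading 0, h a ∈ C.deg1) ∧
      (∀ a ∈ P.grading 0, C.d (h a) = F a - G a) ∧
      ∀ a b, h (a * b) = h a * G b + F a * h b := by
  classical
  have hex : ∀ i, ∃ y ∈ C.deg1, S.deg i = 0 →
      C.d y = F (S.x i) - G (S.x i) := by
    intro i
    by_cases hi : S.deg i = 0
    · have hx : S.x i ∈ P.grading 0 := by
        have := S.mem i
        rw [hi] at this
        exact this
      obtain ⟨y, hy, hy'⟩ := C.exact (F (S.x i) - G (S.x i))
        (C.deg0.sub_mem (hF _ hx) (hG _ hx))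
        (by rw [map_sub, hε _ hx, sub_self])
      exact ⟨y, hy, fun _ => hy'⟩
    · exact ⟨0, C.deg1.zero_mem, fun h => absurd h hi⟩
  choose y hy hy' using hex
  let κ : K →+* Matrix (Fin 2) (Fin 2) C.carrier :=
    (Matrix.scalar (Fin 2)).comp (F.comp (algebraMap K P.carrier))
  obtain ⟨H, hH⟩ := S.exists_ringHom hK κ
    fun i => !![F (S.x i), y i; 0, G (S.x i)]
  -- `P` is generated as a ring by the generators, so that homogeneous induction determines `H`
  have hent : ∀ a : P.carrier, H a 0 0 = F a ∧ H a 1 0 = 0 ∧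
      H a 1 1 = G a := by
    let V : AddSubgroup P.carrier :=
      { carrier := {a | H a 0 0 = F a ∧ H a 1 0 = 0 ∧ H a 1 1 = G a}
        zero_mem' := by simp
        add_mem' := by
          rintro a b ⟨h₁, h₂, h₃⟩ ⟨h₁', h₂', h₃'⟩
          simp [h₁, h₂, h₃, h₁', h₂', h₃']
        neg_mem' := by
          rintro a ⟨h₁, h₂, h₃⟩
          simp [h₁, h₂, h₃] }
    refine mem_of_homogeneous V fun n a ha => S.grading_le hK (fun _ => V) ?_ ?_ ha
    · simp [V]
    · rintro i n a - ⟨h₁, h₂, h₃⟩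
      refine ⟨?_, ?_, ?_⟩ <;> simp [hH, Matrix.mul_apply, Fin.sum_univ_two, h₁, h₂, h₃]
  have hmul : ∀ a b, H (a * b) 0 1 = H a 0 1 * G b + F a * H b 0 1 := by
    intro a b
    rw [map_mul, Matrix.mul_apply, Fin.sum_univ_two, (hent a).1, (hent b).2.2, add_comm]
  -- the condition is void in positive degrees, where `H` need not be homogeneous
  let V : ℕ → AddSubgroup P.carrier := fun n =>
    { carrier := {a | n = 0 → H a 0 1 ∈ C.deg1 ∧
        C.d (H a 0 1) = F a - G a}
      zero_mem' := by simp [C.deg1.zero_mem]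
      add_mem' := by
        intro a b ha hb hn
        refine ⟨?_, ?_⟩
        · rw [map_add]; exact C.deg1.add_mem (ha hn).1 (hb hn).1
        · rw [map_add, Matrix.add_apply, map_add, (ha hn).2, (hb hn).2, map_add, map_add]; abel
      neg_mem' := by
        intro a ha hn
        refine ⟨?_, ?_⟩
        · rw [map_neg]; exact C.deg1.neg_mem (ha hn).1
        · rw [map_neg, Matrix.neg_apply, map_neg, (ha hn).2, map_neg, map_neg]; abel }
  have hV : ∀ a ∈ P.grading 0, a ∈ V 0 := by
    intro a ha
    refine S.grading_le hK V ?_ ?_ ha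
    · intro _
      simp [C.deg1.zero_mem]
    · intro i n a ha hV hn
      obtain ⟨hi, rfl⟩ : S.deg i = 0 ∧ n = 0 := by omega
      obtain ⟨h₁, h₂⟩ := hV rfl
      have hx : S.x i ∈ P.grading 0 := by
        have := S.mem i
        rw [hi] at this
        exact this
      have hxi : H (S.x i) 0 1 = y i := by rw [hH]; rfl
      rw [hmul, hxi]
      refine ⟨C.deg1.add_mem (C.mul_mem' _ (hG _ ha) _ (hy i))
        (C.mul_mem _ (hF _ hx) _ h₁), ?_⟩
      rw [map_add, C.d_mul' _ (hG _ ha) _ (hy i), C.d_mul _ (hF _ hx) _ h₁, h₂,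
        hy' i hi, map_mul, map_mul]
      noncomm_ring
  refine ⟨{ toFun := fun a => H a 0 1, map_zero' := by simp, map_add' := fun a b => by simp },
    fun a ha => (hV a ha rfl).1, fun a ha => (hV a ha rfl).2, hmul⟩

/-- Morphisms from a quasi-free chain algebra over the same ring homomorphism induce the same map
up to extendable maps. -/
theorem IsQuasiFree.pull_sub_pull_mem (hPf : P.IsQuasiFree) {M : Type t} [AddCommGroup M]
    [Module A M] [Module Aᵐᵒᵖ M] {M' : Type t'} [AddCommGroup M'] [Module A' M']
    [Module A'ᵐᵒᵖ M'] (φ : BimoduleHom A M A' M') (F G : (P.trunc hP).Hom C φ.g)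
    {θ : C.cycles →+ M'} (hθ : θ ∈ C.crossedMaps M') :
    F.pull φ θ - G.pull φ θ ∈ (P.trunc hP).extendable M := by
  obtain ⟨S⟩ := hPf.nonempty_freeGenerators
  obtain ⟨h, h₁, h₂, h₃⟩ := S.exists_homotopy hK F.toRingHom G.toRingHom F.map_deg0
    G.map_deg0 fun a ha => (F.map_ε a ha).trans (G.map_ε a ha).symm
  exact TruncatedAlgebra.Hom.pull_sub_pull_mem φ F G h h₁ h₂ (fun a _ b _ => h₃ a b) hθ

/-- Morphisms to truncated chain algebras exist: only exactness in degree `0` is needed to choose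
the images of the generators of degrees `0` and `1`. -/
theorem IsQuasiFree.exists_truncHom (hPf : P.IsQuasiFree) (κ : K →+* C.carrier) (g : A →+* A') :
    Nonempty ((P.trunc hP).Hom C g) := by
  classical
  obtain ⟨S⟩ := hPf.nonempty_freeGenerators
  choose a ha ha' using fun i => C.surjective (g (P.ε (S.x i)))
  -- `F` is right in degree `0`; it is used to find the images of the generators of degree `1`
  obtain ⟨F, hF⟩ := S.exists_ringHom hK κ fun i => if S.deg i = 0 then a i else 0
  have hκ : ∀ n : ℕ, ∀ b ∈ P.grading n, n = 0 → F b ∈ C.deg0 ∧ C.ε (F b) = g (P.ε b) := by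
    let V : ℕ → AddSubgroup P.carrier := fun n =>
      { carrier := {b | n = 0 → F b ∈ C.deg0 ∧ C.ε (F b) = g (P.ε b)}
        zero_mem' := by simp [C.deg0.zero_mem]
        add_mem' := by
          intro b c hb hc hn
          refine ⟨by rw [map_add]; exact C.deg0.add_mem (hb hn).1 (hc hn).1, ?_⟩
          simp only [map_add, (hb hn).2, (hc hn).2]
        neg_mem' := by
          intro b hb hn
          refine ⟨by rw [map_neg]; exact C.deg0.neg_mem (hb hn).1, ?_⟩
          simp only [map_neg, (hb hn).2] }
    intro n b hb
    refine S.grading_le hK V ?_ ?_ hb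
    · intro _
      simp [C.deg0.one_mem]
    · intro i n b hb hV hn
      obtain ⟨hi, rfl⟩ : S.deg i = 0 ∧ n = 0 := by omega
      obtain ⟨h₁, h₂⟩ := hV rfl
      rw [map_mul, hF, if_pos hi]
      exact ⟨C.deg0.mul_mem (ha i) h₁, by rw [map_mul, map_mul, map_mul, h₂, ha']⟩
  have hex : ∀ i, ∃ y ∈ C.deg1, S.deg i = 1 → C.d y = F (P.d (S.x i)) := by
    intro i
    by_cases hi : S.deg i = 1
    · have hx : P.d (S.x i) ∈ P.grading 0 := P.d_mem 0 _ (by simpa [hi] using S.mem i)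
      obtain ⟨h₁, h₂⟩ := hκ 0 _ hx rfl
      obtain ⟨y, hy, hy'⟩ := C.exact _ h₁ (by rw [h₂, P.ε_d, map_zero])
      exact ⟨y, hy, fun _ => hy'⟩
    · exact ⟨0, C.deg1.zero_mem, fun h => absurd h hi⟩
  choose y hy hy' using hex
  obtain ⟨F', hF'⟩ := S.exists_ringHom hK κ fun i =>
    if S.deg i = 0 then a i else if S.deg i = 1 then y i else 0
  have hFF : ∀ n : ℕ, ∀ b ∈ P.grading n, n = 0 → F' b = F b := by
    let V : ℕ → AddSubgroup P.carrier := fun n =>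
      { carrier := {b | n = 0 → F' b = F b}
        zero_mem' := by simp
        add_mem' := by
          intro b c hb hc hn
          rw [map_add, map_add, hb hn, hc hn]
        neg_mem' := by
          intro b hb hn
          rw [map_neg, map_neg, hb hn] }
    intro n b hb
    refine S.grading_le hK V (by simp [V]) ?_ hb
    intro i n b hb hV hn
    obtain ⟨hi, rfl⟩ : S.deg i = 0 ∧ n = 0 := by omega
    rw [map_mul, map_mul, hV rfl, hF, hF', if_pos hi, if_pos hi]
  have h1 : ∀ n : ℕ, ∀ b ∈ P.grading n, n = 1 → F' b ∈ C.deg1 ∧ F' (P.d b) = C.d (F' b) := by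
    let V : ℕ → AddSubgroup P.carrier := fun n =>
      { carrier := {b | n = 1 → F' b ∈ C.deg1 ∧ F' (P.d b) = C.d (F' b)}
        zero_mem' := by simp [C.deg1.zero_mem]
        add_mem' := by
          intro b c hb hc hn
          refine ⟨by rw [map_add]; exact C.deg1.add_mem (hb hn).1 (hc hn).1, ?_⟩
          simp only [map_add, (hb hn).2, (hc hn).2]
        neg_mem' := by
          intro b hb hn
          refine ⟨by rw [map_neg]; exact C.deg1.neg_mem (hb hn).1, ?_⟩
          simp only [map_neg, (hb hn).2] }
    intro n b hb
    refine S.grading_le hK V (by simp [V]) ?_ hb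
    intro i n b hb hV hn
    have hi : (S.deg i = 0 ∧ n = 1) ∨ (S.deg i = 1 ∧ n = 0) := by omega
    rcases hi with ⟨hi, rfl⟩ | ⟨hi, rfl⟩
    · obtain ⟨h₁, h₂⟩ := hV rfl
      have hx : S.x i ∈ P.grading 0 := hi ▸ S.mem i
      rw [P.leibniz 0 _ hx, P.d_zero _ hx, zero_mul, zero_add, pow_zero, one_mul, map_mul, map_mul,
        hF', if_pos hi, h₂]
      exact ⟨C.mul_mem _ (ha i) _ h₁, (C.d_mul _ (ha i) _ h₁).symm⟩
    · have hx : S.x i ∈ P.grading 1 := hi ▸ S.mem i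
      have hb0 : F' b ∈ C.deg0 := by rw [hFF 0 b hb rfl]; exact (hκ 0 b hb rfl).1
      rw [P.leibniz 1 _ hx, P.d_zero _ hb, mul_zero, mul_zero, add_zero, map_mul, map_mul,
        hF', if_neg (by omega), if_pos hi, hFF 0 _ (P.d_mem 0 _ hx) rfl]
      exact ⟨C.mul_mem' _ hb0 _ (hy i), by rw [C.d_mul' _ hb0 _ (hy i), hy' i hi]⟩
  have h0 : ∀ b ∈ P.grading 0, F' b ∈ C.deg0 ∧ C.ε (F' b) = g (P.ε b) := by
    intro b hb
    rw [hFF 0 b hb rfl]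
    exact hκ 0 b hb rfl
  exact ⟨⟨F', fun b hb => (h0 b hb).1, fun b hb => (h1 1 b hb rfl).1,
    fun b hb => (h1 1 b hb rfl).2, fun b hb => (h0 b hb).2⟩⟩

end ChainAlgebraOver

/-! ### Primitives of two-cocycles on free algebras -/

namespace ChainAlgebraOver

variable {K : Type v} [CommRing K] {A : Type u} [Ring A] [Algebra K A]
  {P : ChainAlgebraOver.{v, w} K A}

/-- An additive map on a free algebra with prescribed values on words. -/
theorem exists_addMonoidHom_word {X : Type*} {N : Type*} [AddCommGroup N] [Module K N]
    (f : List X → N) : ∃ e : FreeAlgebra K X →+ N, ∀ l, e (word l) = f l := by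
  let e : MonoidAlgebra K (FreeMonoid X) →ₗ[K] N :=
    (MonoidAlgebra.basis (FreeMonoid X) K).constr K fun l => f l.toList
  let E := FreeAlgebra.equivMonoidAlgebraFreeMonoid (R := K) (X := X)
  have hE : ∀ l : List X, E (word l) = MonoidAlgebra.of K _ (FreeMonoid.ofList l) := by
    intro l
    induction l with
    | nil => simp [word, MonoidAlgebra.one_def]
    | cons i l ih =>
      rw [show word (K := K) (i :: l) = FreeAlgebra.ι K i * word l by simp [word], map_mul, ih,
        FreeMonoid.ofList_cons, map_mul]
      congr 1
      simp [E, FreeAlgebra.equivMonoidAlgebraFreeMonoid]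
  refine ⟨e.toAddMonoidHom.comp (E : FreeAlgebra K X →+ _), fun l => ?_⟩
  change e (E (word l)) = f l
  rw [hE, MonoidAlgebra.of_apply, ← MonoidAlgebra.basis_apply, Module.Basis.constr_basis]
  rfl

/-- Hochschild `2`-cocycles of a quasi-free `P` are coboundaries, and the primitive respects a
grading `V` of the coefficients that the cocycle respects. The right action `R` on the
coefficients `N` need not be unital. The primitive vanishes on the generators; its value
on a word `x * l` is determined recursively by the cocycle equation for `x` and `l`. -/
theorem FreeGenerators.exists_primitive (S : P.FreeGenerators)
    (hK : ∀ k : K, ∃ n : ℤ, (n : K) = k) {N : Type*} [AddCommGroup N] [Module K N]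
    (L : P.carrier →+* AddMonoid.End N) (R : P.carrier → N →+ N)
    (hLR : ∀ a b n, L a (R b n) = R b (L a n)) (f : P.carrier →+ P.carrier →+ N)
    (hf : ∀ a b c, L a (f b c) - f (a * b) c + f a (b * c) - R c (f a b) = 0) :
    ∃ e : P.carrier →+ N, (∀ a b, L a (e b) - e (a * b) + R b (e a) = f a b) ∧
      ∀ V : ℕ → AddSubgroup N,
        (∀ m n a b, a ∈ P.grading m → b ∈ P.grading n → f a b ∈ V (m + n)) →
        (∀ i n z, z ∈ V n → L (S.x i) z ∈ V (S.deg i + n)) →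
        ∀ n a, a ∈ P.grading n → e a ∈ V n := by
  let F : List S.X → N := fun l =>
    List.rec (f 1 1) (fun i l y => L (S.x i) y - f (S.x i) (S.equiv (word l))) l
  obtain ⟨e₀, he₀⟩ := exists_addMonoidHom_word (K := K) F
  let e : P.carrier →+ N := e₀.comp (S.equiv.symm : P.carrier →+ FreeAlgebra K S.X)
  have hew : ∀ l, e (S.equiv (word l)) = F l := fun l => by
    change e₀ (S.equiv.symm (S.equiv (word l))) = F l
    rw [AlgEquiv.symm_apply_apply, he₀]
  have he1 : e 1 = f 1 1 := by
    have h := hew []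
    rwa [S.equiv_word_nil] at h
  have hex : ∀ i a, e (S.x i * a) = L (S.x i) (e a) - f (S.x i) a := by
    intro i a
    let V : AddSubgroup P.carrier :=
      (e.comp (AddMonoidHom.mulLeft (S.x i))).eqLocus ((L (S.x i)).comp e - f (S.x i))
    change a ∈ V
    rw [← S.equiv.apply_symm_apply a]
    generalize S.equiv.symm a = z
    induction mem_span_word z using Submodule.span_induction with
    | zero => rw [map_zero]; exact zero_mem _
    | add x y _ _ h h' => rw [map_add]; exact add_mem h h'
    | smul k x _ h =>
      obtain ⟨m, rfl⟩ := hK k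
      rw [map_smul, Int.cast_smul_eq_zsmul]
      exact zsmul_mem h m
    | mem z h =>
      obtain ⟨l, rfl⟩ := h
      change e (S.x i * S.equiv (word l)) = L (S.x i) (e (S.equiv (word l))) - f _ _
      rw [← S.equiv_word_cons, hew, hew]
  refine ⟨e, fun a b => ?_, fun V hV hL n a ha => ?_⟩
  · let V : AddSubgroup P.carrier :=
      { carrier := {a | L a (e b) - e (a * b) + R b (e a) = f a b}
        zero_mem' := by simp
        add_mem' := by
          intro x y (hx : _ = _) (hy : _ = _)
          change _ = _
          simp only [map_add, add_mul, AddMonoidHom.add_apply, ← hx, ← hy]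
          rw [show (L x + L y) (e b) = L x (e b) + L y (e b) from rfl]
          abel
        neg_mem' := by
          intro x (hx : _ = _)
          change _ = _
          simp only [map_neg, neg_mul, AddMonoidHom.neg_apply, ← hx]
          rw [show (-L x) (e b) = -L x (e b) from rfl]
          abel }
    refine mem_of_homogeneous V (fun n a ha => S.grading_le hK (fun _ => V) ?_ ?_ ha) a
    · have h := hf 1 1 b
      rw [map_one, one_mul, one_mul] at h
      change (L 1) (e b) - e (1 * b) + R b (e 1) = f 1 b
      rw [map_one, he1, one_mul]
      have h' : f 1 b - R b (f 1 1) = 0 := by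
        rw [← h]
        change _ = f 1 b - f 1 b + f 1 b - R b (f 1 1)
        abel
      change e b - e b + _ = _
      rw [sub_self, zero_add, sub_eq_zero.1 h']
    · intro i n a _ (ha : L a (e b) - e (a * b) + R b (e a) = f a b)
      change L (S.x i * a) (e b) - e (S.x i * a * b) + R b (e (S.x i * a)) = f (S.x i * a) b
      rw [mul_assoc, hex, hex, map_mul, map_sub, ← hLR]
      change L (S.x i) (L a (e b)) - _ + _ = _
      have h := hf (S.x i) a b
      rw [← ha, map_add, map_sub] at h
      rw [← sub_eq_zero, ← h]
      abel
  · refine S.grading_le hK (fun n => (V n).comap e) ?_ ?_ ha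
    · change e 1 ∈ V 0
      rw [he1]
      exact hV 0 0 1 1 one_mem_grading one_mem_grading
    · intro i n a ha hn
      change e (S.x i * a) ∈ V (S.deg i + n)
      rw [hex]
      exact sub_mem (hL i n _ hn) (hV _ _ _ _ (S.mem i) ha)

end ChainAlgebraOver

/-! ### Cochains of one and two variables -/

namespace ChainAlgebraOver

variable {K : Type v} [CommRing K] {A : Type u} [Ring A] [Algebra K A]
  {P : ChainAlgebraOver.{v, w} K A} {M : Type t} [AddCommGroup M] [Module A M]

/-- The cochain with the single component `e` of one variable. -/
def cochain₁ (P : ChainAlgebraOver.{v, w} K A) {M : Type t} [AddCommGroup M]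
    (e : P.carrier →+ M) : P.RawCochain M
  | 1, r => e (r 0)
  | _, _ => 0

/-- The cochain with the single component `e` of two variables. -/
def cochain₂ (P : ChainAlgebraOver.{v, w} K A) {M : Type t} [AddCommGroup M]
    (e : P.carrier →+ P.carrier →+ M) : P.RawCochain M
  | 2, r => e (r 0) (r 1)
  | _, _ => 0

theorem map_smul_of_int (hK : ∀ k : K, ∃ n : ℤ, (n : K) = k) (e : P.carrier →+ M) (k : K)
    (x : P.carrier) : e (k • x) = algebraMap K A k • e x := by
  obtain ⟨n, rfl⟩ := hK k
  rw [Int.cast_smul_eq_zsmul, map_zsmul, map_intCast, Int.cast_smul_eq_zsmul]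

theorem cochain₁_mem (hK : ∀ k : K, ∃ n : ℤ, (n : K) = k) {N : ℕ} {e : P.carrier →+ M}
    (he : ∀ n, ∀ a ∈ P.grading n, n + 1 ≠ N → e a = 0) : P.cochain₁ e ∈ P.cochains M N := by
  refine ⟨fun n r j x y => ?_, fun n r j k x => ?_, fun n deg r hr hn => ?_⟩
  · match n, r, j with
    | 0, _, j => exact j.elim0
    | 1, r, j =>
      obtain rfl : j = 0 := Subsingleton.elim _ _
      simp only [cochain₁, Function.update_self, map_add]
    | n + 2, _, _ => exact (add_zero 0).symm
  · match n, r, j with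
    | 0, _, j => exact j.elim0
    | 1, r, j =>
      obtain rfl : j = 0 := Subsingleton.elim _ _
      simp only [cochain₁, Function.update_self, map_smul_of_int hK]
    | n + 2, _, _ => exact (smul_zero _).symm
  · match n, deg, r, hr, hn with
    | 0, _, _, _, _ => rfl
    | 1, deg, r, hr, hn =>
      refine he _ _ (hr 0) ?_
      rw [Fin.sum_univ_one] at hn
      omega
    | n + 2, _, _, _, _ => rfl

theorem cochain₂_mem (hK : ∀ k : K, ∃ n : ℤ, (n : K) = k) {N : ℕ}
    {e : P.carrier →+ P.carrier →+ M}
    (he : ∀ m n, ∀ a ∈ P.grading m, ∀ b ∈ P.grading n, m + n + 2 ≠ N → e a b = 0) :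
    P.cochain₂ e ∈ P.cochains M N := by
  refine ⟨fun n r j x y => ?_, fun n r j k x => ?_, fun n deg r hr hn => ?_⟩
  · match n, r, j with
    | 0, _, j => exact j.elim0
    | 1, _, _ => exact (add_zero 0).symm
    | 2, r, j =>
      fin_cases j
      · simp [cochain₂]
      · simp [cochain₂]
    | n + 3, _, _ => exact (add_zero 0).symm
  · match n, r, j with
    | 0, _, j => exact j.elim0
    | 1, _, _ => exact (smul_zero _).symm
    | 2, r, j =>
      fin_cases j
      · simpa [cochain₂] using map_smul_of_int hK (e.flip (r 1)) k x
      · simpa [cochain₂] using map_smul_of_int hK (e (r 0)) k x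
    | n + 3, _, _ => exact (smul_zero _).symm
  · match n, deg, r, hr, hn with
    | 0, _, _, _, _ => rfl
    | 1, _, _, _, _ => rfl
    | 2, deg, r, hr, hn =>
      refine he _ _ _ (hr 0) _ (hr 1) ?_
      rw [Fin.sum_univ_two] at hn
      omega
    | n + 3, _, _, _, _ => rfl

omit [Module A M] in
/-- Multiadditive maps that vanish on homogeneous elements vanish. -/
theorem eq_zero_of_homogeneous {n : ℕ} (f : (Fin n → P.carrier) → M)
    (hadd : ∀ (r : Fin n → P.carrier) (i : Fin n) (x y : P.carrier),
      f (Function.update r i (x + y)) = f (Function.update r i x) + f (Function.update r i y))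
    (hf : ∀ (deg : Fin n → ℕ) (r : Fin n → P.carrier), (∀ i, r i ∈ P.grading (deg i)) → f r = 0)
    (r : Fin n → P.carrier) : f r = 0 := by
  have key : ∀ (s : Finset (Fin n)) (r : Fin n → P.carrier),
      (∀ i ∉ s, ∃ m, r i ∈ P.grading m) → f r = 0 := by
    intro s
    induction s using Finset.induction_on with
    | empty =>
      intro r hr
      choose deg hdeg using fun i => hr i (by simp)
      exact hf deg r hdeg
    | insert i s hi ih =>
      intro r hr
      let V : AddSubgroup P.carrier :=
        (AddMonoidHom.mk' (fun x => f (Function.update r i x)) (hadd r i)).ker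
      have hV : r i ∈ V := by
        refine mem_of_homogeneous V (fun m a ha => ?_) _
        refine ih _ fun j hj => ?_
        by_cases hji : j = i
        · subst hji
          exact ⟨m, by simpa using ha⟩
        · rw [Function.update_of_ne hji]
          exact hr j (by simp [hji, hj])
      have h : f (Function.update r i (r i)) = 0 := hV
      rwa [Function.update_eq_self] at h
  exact key Finset.univ r (by simp)

theorem cochains_eq_zero_of_lt {N n : ℕ} {f : P.RawCochain M} (hf : f ∈ P.cochains M N)
    (h : N < n) (r : Fin n → P.carrier) : f n r = 0 :=
  eq_zero_of_homogeneous (f n) (hf.1 n) (fun deg r hr => hf.2.2 n deg r hr (by omega)) r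

theorem cochains_zero_eq_zero {N : ℕ} {f : P.RawCochain M} (hf : f ∈ P.cochains M N)
    (h : N ≠ 0) (r : Fin 0 → P.carrier) : f 0 r = 0 :=
  hf.2.2 0 (fun i => i.elim0) r (fun i => i.elim0) (by simpa using h.symm)

theorem cochains_eq_zero {N n : ℕ} {f : P.RawCochain M} (hf : f ∈ P.cochains M N)
    {deg : Fin n → ℕ} {r : Fin n → P.carrier} (hr : ∀ i, r i ∈ P.grading (deg i))
    (h : n + ∑ i, deg i ≠ N) : f n r = 0 := hf.2.2 n deg r hr h

section Vec

variable {X : Type*} (a b c x : X)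

theorem update_vec₁ : Function.update ![a] 0 x = ![x] := by
  ext i; fin_cases i; rfl

theorem update_vec₂ : Function.update ![a, b] 0 x = ![x, b] := by
  ext i; fin_cases i <;> rfl

theorem update_vec₂' : Function.update ![a, b] 1 x = ![a, x] := by
  ext i; fin_cases i <;> rfl

theorem update_vec₃ : Function.update ![a, b, c] 0 x = ![x, b, c] := by
  ext i; fin_cases i <;> rfl

theorem update_vec₃' : Function.update ![a, b, c] 1 x = ![a, x, c] := by
  ext i; fin_cases i <;> rfl

theorem update_vec₃'' : Function.update ![a, b, c] 2 x = ![a, b, x] := by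
  ext i; fin_cases i <;> rfl

end Vec

/-- The component of one variable of a cochain. -/
def component₁ {N : ℕ} {f : P.RawCochain M} (hf : f ∈ P.cochains M N) : P.carrier →+ M :=
  AddMonoidHom.mk' (fun a => f 1 ![a]) fun a b => by
    have h := hf.1 1 ![0] 0 a b
    simp only [update_vec₁] at h
    exact h

/-- The component of two variables of a cochain. -/
def component₂ {N : ℕ} {f : P.RawCochain M} (hf : f ∈ P.cochains M N) :
    P.carrier →+ P.carrier →+ M :=
  AddMonoidHom.mk' (fun a => AddMonoidHom.mk' (fun b => f 2 ![a, b]) fun b b' => by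
    have h := hf.1 2 ![a, 0] 1 b b'
    simp only [update_vec₂'] at h
    exact h) fun a a' => by
    ext b
    have h := hf.1 2 ![0, b] 0 a a'
    simp only [update_vec₂] at h
    exact h

/-- The component of three variables of a cochain. -/
def component₃ {N : ℕ} {f : P.RawCochain M} (hf : f ∈ P.cochains M N) :
    P.carrier →+ P.carrier →+ P.carrier →+ M :=
  AddMonoidHom.mk' (fun a => AddMonoidHom.mk' (fun b =>
    AddMonoidHom.mk' (fun c => f 3 ![a, b, c]) fun c c' => by
      have h := hf.1 3 ![a, b, 0] 2 c c'
      simp only [update_vec₃''] at h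
      exact h) fun b b' => by
      ext c
      have h := hf.1 3 ![a, 0, c] 1 b b'
      simp only [update_vec₃'] at h
      exact h) fun a a' => by
    ext b c
    have h := hf.1 3 ![0, b, c] 0 a a'
    simp only [update_vec₃] at h
    exact h

theorem component₃_apply {N : ℕ} {f : P.RawCochain M} (hf : f ∈ P.cochains M N)
    (a b c : P.carrier) : component₃ hf a b c = f 3 ![a, b, c] := rfl

omit [AddCommGroup M] [Module A M] in
theorem exists_eq_one (f : P.RawCochain M) : ∃ e : P.carrier → M, ∀ r, f 1 r = e (r 0) :=
  ⟨fun a => f 1 ![a], fun r => congrArg (f 1) (by ext i; fin_cases i; rfl)⟩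

omit [AddCommGroup M] [Module A M] in
theorem exists_eq_two (f : P.RawCochain M) :
    ∃ e : P.carrier → P.carrier → M, ∀ r, f 2 r = e (r 0) (r 1) :=
  ⟨fun a b => f 2 ![a, b], fun r => congrArg (f 2) (by ext i; fin_cases i <;> rfl)⟩

omit [AddCommGroup M] [Module A M] in
theorem exists_eq_three (f : P.RawCochain M) :
    ∃ e : P.carrier → P.carrier → P.carrier → M, ∀ r, f 3 r = e (r 0) (r 1) (r 2) :=
  ⟨fun a b c => f 3 ![a, b, c], fun r => congrArg (f 3) (by ext i; fin_cases i <;> rfl)⟩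

variable [Module Aᵐᵒᵖ M]

theorem differential_one (f : P.RawCochain M) (h0 : ∀ r, f 0 r = 0) (a : P.carrier) :
    P.differential M f 1 ![a] = -f 1 ![P.d a] := by
  obtain ⟨e, he⟩ := exists_eq_one f
  change P.hochschildCoboundary M 0 (f 0) ![a]
    + (-1 : ℤ) ^ (0 + 1) • P.internalCoboundary M 1 (f 1) ![a] = _
  simp [hochschildCoboundary, internalCoboundary, h0, he]

theorem differential_two (f : P.RawCochain M) (a b : P.carrier) :
    P.differential M f 2 ![a, b] = P.ε a • f 1 ![b] - f 1 ![a * b] + op (P.ε b) • f 1 ![a]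
      + (f 2 ![P.d a, b] + f 2 ![P.sign a, P.d b]) := by
  obtain ⟨e₁, he₁⟩ := exists_eq_one f
  obtain ⟨e₂, he₂⟩ := exists_eq_two f
  change P.hochschildCoboundary M 1 (f 1) ![a, b]
    + (-1 : ℤ) ^ (1 + 1) • P.internalCoboundary M 2 (f 2) ![a, b] = _
  simp [hochschildCoboundary, internalCoboundary, he₁, he₂, Fin.sum_univ_two, Fin.contractNth,
    sub_eq_add_neg]

theorem differential_three (f : P.RawCochain M) (a b c : P.carrier) :
    P.differential M f 3 ![a, b, c] = P.ε a • f 2 ![b, c] - f 2 ![a * b, c] + f 2 ![a, b * c]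
      - op (P.ε c) • f 2 ![a, b] - (f 3 ![P.d a, b, c] + f 3 ![P.sign a, P.d b, c]
        + f 3 ![P.sign a, P.sign b, P.d c]) := by
  obtain ⟨e, he⟩ := exists_eq_two f
  obtain ⟨g, hg⟩ := exists_eq_three f
  change P.hochschildCoboundary M 2 (f 2) ![a, b, c]
    + (-1 : ℤ) ^ (2 + 1) • P.internalCoboundary M 3 (f 3) ![a, b, c] = _
  simp [hochschildCoboundary, internalCoboundary, he, hg, Fin.sum_univ_two, Fin.sum_univ_three,
    Fin.contractNth, sub_eq_add_neg, pow_succ]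
  abel

theorem differential_four (f : P.RawCochain M) (h4 : ∀ r, f 4 r = 0) (a b c e : P.carrier) :
    P.differential M f 4 ![a, b, c, e] = P.ε a • f 3 ![b, c, e] - f 3 ![a * b, c, e]
      + f 3 ![a, b * c, e] - f 3 ![a, b, c * e] + op (P.ε e) • f 3 ![a, b, c] := by
  obtain ⟨g, hg⟩ := exists_eq_three f
  change P.hochschildCoboundary M 3 (f 3) ![a, b, c, e]
    + (-1 : ℤ) ^ (3 + 1) • P.internalCoboundary M 4 (f 4) ![a, b, c, e] = _
  simp [hochschildCoboundary, internalCoboundary, hg, h4, Fin.sum_univ_three, Fin.contractNth,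
    sub_eq_add_neg, pow_succ]
  abel

end ChainAlgebraOver

/-! ### Third cohomology in terms of crossed maps -/

namespace ChainAlgebraOver

variable {K : Type v} [CommRing K] {A : Type u} [Ring A] [Algebra K A]
  {P : ChainAlgebraOver.{v, w} K A}

/-- The component of degree `n`. -/
noncomputable abbrev proj (P : ChainAlgebraOver.{v, w} K A) (n : ℕ) : P.carrier →+ P.carrier :=
  GradedRing.proj P.grading n

theorem proj_mem (n : ℕ) (a : P.carrier) : P.proj n a ∈ P.grading n := SetLike.coe_mem _

theorem proj_same {n : ℕ} {a : P.carrier} (ha : a ∈ P.grading n) : P.proj n a = a :=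
  DirectSum.decompose_of_mem_same _ ha

theorem proj_ne {m n : ℕ} {a : P.carrier} (ha : a ∈ P.grading m) (h : m ≠ n) : P.proj n a = 0 :=
  DirectSum.decompose_of_mem_ne _ ha h

theorem proj_d (n : ℕ) (a : P.carrier) : P.proj n (P.d a) = P.d (P.proj (n + 1) a) := by
  refine mem_of_homogeneous (((P.proj n).comp P.d.toAddMonoidHom).eqLocus
    (P.d.toAddMonoidHom.comp (P.proj (n + 1)))) (fun m a ha => ?_) a
  change P.proj n (P.d a) = P.d (P.proj (n + 1) a)
  cases m with
  | zero => rw [P.d_zero a ha, proj_ne ha (by omega), map_zero, map_zero]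
  | succ m =>
    by_cases h : m = n
    · subst h
      rw [proj_same ha, proj_same (P.d_mem m a ha)]
    · rw [proj_ne ha (by omega), proj_ne (P.d_mem m a ha) h, map_zero]

theorem ε_eq_zero {n : ℕ} {a : P.carrier} (ha : a ∈ P.grading n) (hn : n ≠ 0) : P.ε a = 0 := by
  obtain ⟨n, rfl⟩ := Nat.exists_eq_succ_of_ne_zero hn
  exact P.ε_pos n a ha

section

variable (hP : P.IsWeakEquivalence)

/-- The differential of the component of degree `2`, with values in the cycles of degree `1`. -/
noncomputable def bdry₂ : P.carrier →+ (P.trunc hP).cycles :=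
  AddMonoidHom.codRestrict (P.d.toAddMonoidHom.comp (P.proj 2)) (P.trunc hP).cycles fun a =>
    ⟨P.d_mem 1 _ (proj_mem 2 a), P.d_d _⟩

theorem bdry₂_of_mem {a : P.carrier} (ha : a ∈ P.grading 2) :
    (bdry₂ hP a).1 = P.d a := congrArg P.d (proj_same ha)

theorem bdry₂_of_mem_ne {n : ℕ} {a : P.carrier} (ha : a ∈ P.grading n) (hn : n ≠ 2) :
    bdry₂ hP a = 0 := Subtype.ext ((congrArg P.d (proj_ne ha hn)).trans (map_zero _))

theorem bdry₂_d (a : P.carrier) : bdry₂ hP (P.d a) = 0 := by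
  refine Subtype.ext ?_
  change P.d (P.proj 2 (P.d a)) = 0
  rw [proj_d, P.d_d]

theorem bdry₂_surjective : Function.Surjective (bdry₂ hP) := by
  rintro ⟨x, hx, hx'⟩
  obtain ⟨y, hy, hy'⟩ := hP.exact_succ 0 x hx hx'
  exact ⟨y, Subtype.ext ((bdry₂_of_mem hP hy).trans hy')⟩

variable {hP} {M : Type t} [AddCommGroup M] [Module A M] [Module Aᵐᵒᵖ M]

/-- The composite of a crossed map with the differential is a derivation. For homogeneous elements
of degree `1` this is the vanishing on `d x * y - x * d y`. -/
theorem crossedMap_bdry₂_mul {θ : (P.trunc hP).cycles →+ M}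
    (hθ : θ ∈ (P.trunc hP).crossedMaps M) (a b : P.carrier) :
    θ (bdry₂ hP (a * b)) = P.ε a • θ (bdry₂ hP b) + op (P.ε b) • θ (bdry₂ hP a) := by
  obtain ⟨h₁, h₂, h₃⟩ := hθ
  let V : P.carrier → AddSubgroup P.carrier := fun b =>
    { carrier := {a | θ (bdry₂ hP (a * b))
        = P.ε a • θ (bdry₂ hP b) + op (P.ε b) • θ (bdry₂ hP a)}
      zero_mem' := by simp
      add_mem' := by
        intro x y (hx : _ = _) (hy : _ = _)
        change _ = _
        simp only [add_mul, map_add, hx, hy, add_smul, smul_add]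
        abel
      neg_mem' := by
        intro x (hx : _ = _)
        change _ = _
        simp only [neg_mul, map_neg, hx, neg_smul, smul_neg]
        abel }
  let W : P.carrier → AddSubgroup P.carrier := fun a =>
    { carrier := {b | θ (bdry₂ hP (a * b))
        = P.ε a • θ (bdry₂ hP b) + op (P.ε b) • θ (bdry₂ hP a)}
      zero_mem' := by simp
      add_mem' := by
        intro x y (hx : _ = _) (hy : _ = _)
        change _ = _
        simp only [mul_add, map_add, hx, hy, add_smul, smul_add, op_add]
        abel
      neg_mem' := by
        intro x (hx : _ = _)
        change _ = _
        simp only [mul_neg, map_neg, hx, neg_smul, smul_neg, op_neg]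
        abel }
  refine mem_of_homogeneous (V b) (fun m a ha => ?_) a
  refine mem_of_homogeneous (W a) (fun n b hb => ?_) b
  change _ = _
  have hab := mul_mem_grading ha hb
  by_cases hmn : m + n = 2
  · have hc : (m = 0 ∧ n = 2) ∨ (m = 1 ∧ n = 1) ∨ (m = 2 ∧ n = 0) := by omega
    rw [hmn] at hab
    rcases hc with ⟨rfl, rfl⟩ | ⟨rfl, rfl⟩ | ⟨rfl, rfl⟩
    · rw [bdry₂_of_mem_ne hP ha (by omega), map_zero, smul_zero, add_zero]
      refine h₁ a ha _ _ ?_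
      rw [bdry₂_of_mem hP hab, bdry₂_of_mem hP hb, P.leibniz 0 a ha, P.d_zero a ha]
      simp
      rfl
    · rw [bdry₂_of_mem_ne hP ha (by omega), bdry₂_of_mem_ne hP hb (by omega), map_zero, smul_zero,
        smul_zero, add_zero]
      refine h₃ a ha b hb _ ?_
      rw [bdry₂_of_mem hP hab, P.leibniz 1 a ha, pow_one, neg_one_mul, ← sub_eq_add_neg]
      rfl
    · rw [bdry₂_of_mem_ne hP hb (by omega), map_zero, smul_zero, zero_add]
      refine h₂ b hb _ _ ?_
      rw [bdry₂_of_mem hP hab, bdry₂_of_mem hP ha, P.leibniz 2 a ha, P.d_zero b hb]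
      simp
      rfl
  · rw [bdry₂_of_mem_ne hP hab hmn, map_zero]
    have hl : P.ε a • θ (bdry₂ hP b) = 0 := by
      by_cases hm : m = 0
      · rw [bdry₂_of_mem_ne hP hb (by omega), map_zero, smul_zero]
      · rw [ε_eq_zero ha hm, zero_smul]
    have hr : op (P.ε b) • θ (bdry₂ hP a) = 0 := by
      by_cases hn : n = 0
      · rw [bdry₂_of_mem_ne hP ha (by omega), map_zero, smul_zero]
      · rw [ε_eq_zero hb hn, op_zero, zero_smul]
    rw [hl, hr, add_zero]

omit [AddCommGroup M] [Module A M] [Module Aᵐᵒᵖ M] in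
/-- Equality of cochains of total degree `3` may be checked on one, two and three variables. -/
theorem rawCochain_ext {f g : P.RawCochain M} (h0 : ∀ r, f 0 r = g 0 r)
    (h1 : ∀ a, f 1 ![a] = g 1 ![a]) (h2 : ∀ a b, f 2 ![a, b] = g 2 ![a, b])
    (h3 : ∀ a b c, f 3 ![a, b, c] = g 3 ![a, b, c])
    (h4 : ∀ n r, f (n + 4) r = g (n + 4) r) : f = g := by
  funext n r
  match n, r with
  | 0, r => exact h0 r
  | 1, r =>
    rw [show r = ![r 0] by ext i; fin_cases i; rfl]
    exact h1 _
  | 2, r =>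
    rw [show r = ![r 0, r 1] by ext i; fin_cases i <;> rfl]
    exact h2 _ _
  | 3, r =>
    rw [show r = ![r 0, r 1, r 2] by ext i; fin_cases i <;> rfl]
    exact h3 _ _ _
  | n + 4, r => exact h4 n r

theorem differential_cochain₁ {e : P.carrier →+ M} :
    (∀ a, P.differential M (P.cochain₁ e) 1 ![a] = -e (P.d a)) ∧
    (∀ a b, P.differential M (P.cochain₁ e) 2 ![a, b]
      = P.ε a • e b - e (a * b) + op (P.ε b) • e a) ∧
    ∀ n r, P.differential M (P.cochain₁ e) (n + 3) r = 0 := by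
  refine ⟨fun a => differential_one _ (fun _ => rfl) a, fun a b => ?_, fun n r => ?_⟩
  · rw [differential_two]
    exact (congrArg _ (add_zero (0 : M))).trans (add_zero _)
  · change P.hochschildCoboundary M (n + 2) (fun _ => 0) r
      + (-1 : ℤ) ^ (n + 2 + 1) • P.internalCoboundary M (n + 3) (fun _ => 0) r = 0
    simp [hochschildCoboundary, internalCoboundary]

theorem crossedCochain_mem_cocycles (hK : ∀ k : K, ∃ n : ℤ, (n : K) = k)
    {θ : (P.trunc hP).cycles →+ M} (hθ : θ ∈ (P.trunc hP).crossedMaps M) :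
    P.cochain₁ (θ.comp (bdry₂ hP)) ∈ P.cocycles M 3 := by
  refine ⟨cochain₁_mem hK fun n a ha hn => ?_, ?_⟩
  · change θ (bdry₂ hP a) = 0
    rw [bdry₂_of_mem_ne hP ha (by omega), map_zero]
  · change P.differential M _ = 0
    obtain ⟨h₁, h₂, h₃⟩ := differential_cochain₁ (P := P) (e := θ.comp (bdry₂ hP))
    refine rawCochain_ext (fun _ => rfl) (fun a => ?_) (fun a b => ?_) (fun a b c => h₃ 0 _)
      (fun n r => h₃ (n + 1) r)
    · rw [h₁]
      change -θ (bdry₂ hP (P.d a)) = 0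
      rw [bdry₂_d, map_zero, neg_zero]
    · rw [h₂]
      change P.ε a • θ (bdry₂ hP b) - θ (bdry₂ hP (a * b)) + op (P.ε b) • θ (bdry₂ hP a) = 0
      rw [crossedMap_bdry₂_mul hθ]
      abel

variable (hP M) in
/-- The class of degree `3` of a crossed map `θ`: it is represented by `w ↦ θ (d w)` for `w` of
degree `2`. -/
noncomputable def crossedClass (hK : ∀ k : K, ∃ n : ℤ, (n : K) = k) :
    (P.trunc hP).crossedMaps M →+ P.HochschildCohomology M 3 :=
  (QuotientAddGroup.mk' _).comp
    { toFun := fun θ => ⟨P.cochain₁ (θ.1.comp (bdry₂ hP)), crossedCochain_mem_cocycles hK θ.2⟩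
      map_zero' := Subtype.ext (by
        funext n r
        match n, r with
        | 0, _ => rfl
        | 1, _ => rfl
        | n + 2, _ => rfl)
      map_add' := fun θ θ' => Subtype.ext (by
        funext n r
        match n, r with
        | 0, _ => exact (add_zero 0).symm
        | 1, _ => rfl
        | n + 2, _ => exact (add_zero 0).symm) }

end

section Naturality

variable {K' : Type v'} [CommRing K'] {A' : Type u'} [Ring A'] [Algebra K' A'] [Algebra K K']
  {Q : ChainAlgebraOver.{v', w'} K' A'}
  {M : Type t} [AddCommGroup M] [Module A M] [Module Aᵐᵒᵖ M]
  {M' : Type t'} [AddCommGroup M'] [Module A' M'] [Module A'ᵐᵒᵖ M']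

theorem Hom.map_proj {g : A →+* A'} (F : P.Hom Q g) (n : ℕ) (a : P.carrier) :
    F.toRingHom (P.proj n a) = Q.proj n (F.toRingHom a) := by
  refine mem_of_homogeneous ((F.toRingHom.toAddMonoidHom.comp (P.proj n)).eqLocus
    ((Q.proj n).comp F.toRingHom.toAddMonoidHom)) (fun m a ha => ?_) a
  change F.toRingHom (P.proj n a) = Q.proj n (F.toRingHom a)
  by_cases h : m = n
  · subst h
    rw [proj_same ha, proj_same (F.map_mem _ _ ha)]
  · rw [proj_ne ha h, proj_ne (F.map_mem _ _ ha) h, map_zero]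

theorem Hom.cohomologyMap_crossedClass (hK : ∀ k : K, ∃ n : ℤ, (n : K) = k)
    (hK' : ∀ k : K', ∃ n : ℤ, (n : K') = k) (hP : P.IsWeakEquivalence)
    (hQ : Q.IsWeakEquivalence) (φ : BimoduleHom A M A' M') (F : P.Hom Q φ.g)
    (θ : (Q.trunc hQ).crossedMaps M') :
    F.cohomologyMap φ 3 (crossedClass hQ M' hK' θ)
      = crossedClass hP M hK ⟨(F.trunc hP hQ).pull φ θ.1, (F.trunc hP hQ).pull_mem φ θ.2⟩ := by
  refine congrArg (QuotientAddGroup.mk' _) (Subtype.ext ?_)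
  funext n r
  match n, r with
  | 0, _ => exact map_zero φ.h
  | n + 2, _ => exact map_zero φ.h
  | 1, r =>
    change φ.h (θ.1 (bdry₂ hQ (F.toRingHom (r 0))))
      = φ.h (θ.1 ((F.trunc hP hQ).cyclesMap (bdry₂ hP (r 0))))
    congr 2
    refine Subtype.ext ?_
    change Q.d (Q.proj 2 (F.toRingHom (r 0))) = F.toRingHom (P.d (P.proj 2 (r 0)))
    rw [F.map_d, F.map_proj]

end Naturality

end ChainAlgebraOver

/-! ### Hochschild cocycles of two and three variables -/

namespace ChainAlgebraOver

variable {K : Type v} [CommRing K] {A : Type u} [Ring A] [Algebra K A]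
  {P : ChainAlgebraOver.{v, w} K A}
  {M : Type t} [AddCommGroup M] [Module A M] [Module Aᵐᵒᵖ M]

theorem differential_cochain₂ {e : P.carrier →+ P.carrier →+ M} :
    (∀ a, P.differential M (P.cochain₂ e) 1 ![a] = 0) ∧
    (∀ a b, P.differential M (P.cochain₂ e) 2 ![a, b] = e (P.d a) b + e (P.sign a) (P.d b)) ∧
    (∀ a b c, P.differential M (P.cochain₂ e) 3 ![a, b, c]
      = P.ε a • e b c - e (a * b) c + e a (b * c) - op (P.ε c) • e a b) ∧
    ∀ n r, P.differential M (P.cochain₂ e) (n + 4) r = 0 := by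
  refine ⟨fun a => ?_, fun a b => ?_, fun a b c => ?_,
    fun n r => ?_⟩
  · rw [differential_one _ (fun _ => rfl)]
    exact neg_zero
  · rw [differential_two]
    change P.ε a • (0 : M) - 0 + op (P.ε b) • (0 : M) + (e (P.d a) b + e (P.sign a) (P.d b)) = _
    simp
  · rw [differential_three]
    exact (congrArg _ ((add_zero _).trans (add_zero (0 : M)))).trans (sub_zero _)
  · change P.hochschildCoboundary M (n + 3) (fun _ => 0) r
      + (-1 : ℤ) ^ (n + 3 + 1) • P.internalCoboundary M (n + 4) (fun _ => 0) r = 0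
    simp [hochschildCoboundary, internalCoboundary]

variable (P M) in
/-- The left action of `P` on an `A`-bimodule. -/
def leftAct : P.carrier →+* AddMonoid.End M := (Module.toAddMonoidEnd A M).comp P.ε.toRingHom

variable (P M) in
/-- The right action of `P` on an `A`-bimodule. -/
def rightAct (a : P.carrier) : M →+ M := DistribSMul.toAddMonoidHom M (op (P.ε a))

variable (P M) in
/-- The left action of `P` on `Hom(P, M)` through `M`. -/
def leftActHom : P.carrier →+* AddMonoid.End (P.carrier →+ M) where
  toFun a := AddMonoidHom.compHom (leftAct P M a)
  map_one' := by rw [map_one]; rfl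
  map_mul' a b := by rw [map_mul]; rfl
  map_zero' := by rw [map_zero]; rfl
  map_add' a b := by rw [map_add]; rfl

omit [Module Aᵐᵒᵖ M] in
theorem leftActHom_apply (a b : P.carrier) (z : P.carrier →+ M) :
    leftActHom P M a z b = P.ε a • z b := rfl

variable (P M) in
/-- The right action `(z * a) b = z (a * b) - z a * b` of `P` on `Hom(P, M)`, for which the
Hochschild coboundary of a map of two variables with values in `M` is that of a map of one
variable with values in `Hom(P, M)`. -/
def rightActHom (a : P.carrier) : (P.carrier →+ M) →+ (P.carrier →+ M) where
  toFun z :=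
    { toFun := fun b => z (a * b) - op (P.ε b) • z a
      map_zero' := by simp
      map_add' := fun b c => by simp only [mul_add, map_add, op_add, add_smul]; abel }
  map_zero' := by ext; simp
  map_add' y z := by ext b; simp only [AddMonoidHom.coe_mk, ZeroHom.coe_mk,
    AddMonoidHom.add_apply, smul_add]; abel

omit [Module A M] in
theorem rightActHom_apply (a b : P.carrier) (z : P.carrier →+ M) :
    rightActHom P M a z b = z (a * b) - op (P.ε b) • z a := rfl

variable [SMulCommClass A Aᵐᵒᵖ M]

/-- A Hochschild `2`-cocycle with values in `M` that is concentrated in degree `N` has a primitive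
that is concentrated in degree `N`. -/
theorem IsQuasiFree.exists_primitive₁ (hPf : P.IsQuasiFree)
    (hK : ∀ k : K, ∃ n : ℤ, (n : K) = k) (N : ℕ) (f : P.carrier →+ P.carrier →+ M)
    (hN : ∀ m n, ∀ a ∈ P.grading m, ∀ b ∈ P.grading n, m + n ≠ N → f a b = 0)
    (hf : ∀ a b c, P.ε a • f b c - f (a * b) c + f a (b * c) - op (P.ε c) • f a b = 0) :
    ∃ e : P.carrier →+ M, (∀ n, ∀ a ∈ P.grading n, n ≠ N → e a = 0) ∧
      ∀ a b, P.ε a • e b - e (a * b) + op (P.ε b) • e a = f a b := by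
  obtain ⟨S⟩ := hPf.nonempty_freeGenerators
  let _ : Module K M := Module.compHom M (algebraMap K A)
  obtain ⟨e, he, heV⟩ := S.exists_primitive hK (leftAct P M) (rightAct P M)
    (fun a b m => smul_comm _ _ m) f hf
  refine ⟨e, fun n a ha hn => ?_, he⟩
  let V : ℕ → AddSubgroup M := fun n =>
    { carrier := {m | n ≠ N → m = 0}
      zero_mem' := fun _ => rfl
      add_mem' := fun ha hb hn => by rw [ha hn, hb hn, add_zero]
      neg_mem' := fun ha hn => by rw [ha hn, neg_zero] }
  refine heV V (fun m n a b ha hb => hN m n a ha b hb) (fun i n z hz hn => ?_) n a ha hn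
  change P.ε (S.x i) • z = 0
  by_cases hi : S.deg i = 0
  · rw [hz (by omega), smul_zero]
  · rw [ε_eq_zero (S.mem i) hi, zero_smul]

/-- A Hochschild `3`-cocycle with values in `M` that is concentrated in degree `N` has a primitive
that is concentrated in degree `N`. -/
theorem IsQuasiFree.exists_primitive₂ (hPf : P.IsQuasiFree)
    (hK : ∀ k : K, ∃ n : ℤ, (n : K) = k) (N : ℕ) (f : P.carrier →+ P.carrier →+ P.carrier →+ M)
    (hN : ∀ l m n, ∀ a ∈ P.grading l, ∀ b ∈ P.grading m, ∀ c ∈ P.grading n, l + m + n ≠ N →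
      f a b c = 0)
    (hf : ∀ a b c x, P.ε a • f b c x - f (a * b) c x + f a (b * c) x - f a b (c * x)
      + op (P.ε x) • f a b c = 0) :
    ∃ e : P.carrier →+ P.carrier →+ M,
      (∀ m n, ∀ a ∈ P.grading m, ∀ b ∈ P.grading n, m + n ≠ N → e a b = 0) ∧
      ∀ a b c, P.ε a • e b c - e (a * b) c + e a (b * c) - op (P.ε c) • e a b = f a b c := by
  obtain ⟨S⟩ := hPf.nonempty_freeGenerators
  let _ : Module K M := Module.compHom M (algebraMap K A)
  obtain ⟨e, he, heV⟩ := S.exists_primitive hK (leftActHom P M) (rightActHom P M)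
    (fun a b z => by
      ext c
      simp only [leftActHom_apply, rightActHom_apply, smul_sub]
      rw [smul_comm]) f (fun a b c => by
      ext x
      have h := hf a b c x
      simp only [AddMonoidHom.sub_apply, AddMonoidHom.add_apply, leftActHom_apply,
        rightActHom_apply, AddMonoidHom.zero_apply]
      rw [← h]
      abel)
  refine ⟨e, fun m n a ha b hb hmn => ?_, fun a b c => ?_⟩
  · let V : ℕ → AddSubgroup (P.carrier →+ M) := fun m =>
      { carrier := {z | ∀ n, ∀ b ∈ P.grading n, m + n ≠ N → z b = 0}
        zero_mem' := fun _ _ _ _ => rfl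
        add_mem' := fun hy hz n b hb hn => by
          rw [AddMonoidHom.add_apply, hy n b hb hn, hz n b hb hn, add_zero]
        neg_mem' := fun hz n b hb hn => by
          rw [AddMonoidHom.neg_apply, hz n b hb hn, neg_zero] }
    refine heV V (fun l m a b ha hb n c hc hn => hN l m n a ha b hb c hc hn)
      (fun i m z hz n b hb hn => ?_) m a ha n b hb hmn
    change P.ε (S.x i) • z b = 0
    by_cases hi : S.deg i = 0
    · rw [hz n b hb (by omega), smul_zero]
    · rw [ε_eq_zero (S.mem i) hi, zero_smul]
  · rw [← he a b]
    simp only [AddMonoidHom.sub_apply, AddMonoidHom.add_apply, leftActHom_apply,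
      rightActHom_apply]
    abel

end ChainAlgebraOver

/-! ### Classes of degree three come from crossed maps -/

namespace ChainAlgebraOver

variable {K : Type v} [CommRing K] {A : Type u} [Ring A] [Algebra K A]
  {P : ChainAlgebraOver.{v, w} K A}

theorem sign_mem {n : ℕ} {a : P.carrier} (ha : a ∈ P.grading n) : P.sign a ∈ P.grading n := by
  rw [P.sign_of_mem ha]
  exact zsmul_mem ha _

theorem ε_sign (a : P.carrier) : P.ε (P.sign a) = P.ε a := by
  refine mem_of_homogeneous ((P.ε.toRingHom.toAddMonoidHom.comp P.sign).eqLocus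
    P.ε.toRingHom.toAddMonoidHom) (fun n a ha => ?_) a
  change P.ε (P.sign a) = P.ε a
  by_cases hn : n = 0
  · subst hn
    rw [P.sign_of_mem ha, pow_zero, one_smul]
  · rw [ε_eq_zero ha hn, ε_eq_zero (sign_mem ha) hn]

theorem d_sign (a : P.carrier) : P.d (P.sign a) = -P.sign (P.d a) := by
  refine mem_of_homogeneous ((P.d.toAddMonoidHom.comp P.sign).eqLocus
    (-P.sign.comp P.d.toAddMonoidHom)) (fun n a ha => ?_) a
  change P.d (P.sign a) = -P.sign (P.d a)
  cases n with
  | zero => rw [P.d_zero a ha, P.d_zero _ (sign_mem ha), map_zero, neg_zero]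
  | succ n =>
    rw [P.sign_of_mem ha, P.sign_of_mem (P.d_mem n a ha), map_zsmul, pow_succ, mul_neg_one,
      neg_smul]

theorem d_mul (a b : P.carrier) : P.d (a * b) = P.d a * b + P.sign a * P.d b := by
  refine mem_of_homogeneous ((P.d.toAddMonoidHom.comp (AddMonoidHom.mulRight b)).eqLocus
    ((AddMonoidHom.mulRight b).comp P.d.toAddMonoidHom
      + (AddMonoidHom.mulRight (P.d b)).comp P.sign)) (fun n a ha => ?_) a
  change P.d (a * b) = P.d a * b + P.sign a * P.d b
  rw [P.leibniz n a ha, P.sign_of_mem ha, zsmul_eq_mul, mul_assoc]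
  simp

theorem sign_mul (a b : P.carrier) : P.sign (a * b) = P.sign a * P.sign b := by
  refine mem_of_homogeneous ((P.sign.comp (AddMonoidHom.mulRight b)).eqLocus
    ((AddMonoidHom.mulRight (P.sign b)).comp P.sign)) (fun m a ha => ?_) a
  refine mem_of_homogeneous ((P.sign.comp (AddMonoidHom.mulLeft a)).eqLocus
    ((AddMonoidHom.mulLeft (P.sign a)).comp P.sign)) (fun n b hb => ?_) b
  change P.sign (a * b) = P.sign a * P.sign b
  rw [P.sign_of_mem ha, P.sign_of_mem hb, P.sign_of_mem (mul_mem_grading ha hb), smul_mul_smul_comm,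
    pow_add]

variable {M : Type t} [AddCommGroup M] [Module A M] [Module Aᵐᵒᵖ M]

/-- Derivations that are concentrated in degree `2` and vanish on boundaries come from crossed
maps. -/
theorem exists_crossedMap {hP : P.IsWeakEquivalence} (g : P.carrier →+ M)
    (hg : ∀ n, ∀ a ∈ P.grading n, n ≠ 2 → g a = 0)
    (hmul : ∀ a b, g (a * b) = P.ε a • g b + op (P.ε b) • g a) (hd : ∀ a, g (P.d a) = 0) :
    ∃ θ ∈ (P.trunc hP).crossedMaps M, θ.comp (bdry₂ hP) = g := by
  have hproj : ∀ a, g (P.proj 2 a) = g a := by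
    refine mem_of_homogeneous ((g.comp (P.proj 2)).eqLocus g) fun n a ha => ?_
    change g (P.proj 2 a) = g a
    by_cases hn : n = 2
    · subst hn
      rw [proj_same ha]
    · rw [proj_ne ha hn, map_zero, hg n a ha hn]
  have hker : (bdry₂ hP).ker ≤ g.ker := by
    intro a ha
    have h : P.d (P.proj 2 a) = 0 := congrArg Subtype.val ha
    obtain ⟨y, -, hy⟩ := hP.exact_succ 1 _ (proj_mem 2 a) h
    change g a = 0
    rw [← hproj, ← hy, hd]
  let θ : (P.trunc hP).cycles →+ M :=
    AddMonoidHom.liftOfSurjective (bdry₂ hP) (bdry₂_surjective hP) ⟨g, hker⟩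
  have hθ : ∀ a, θ (bdry₂ hP a) = g a :=
    fun a => AddMonoidHom.liftOfRightInverse_comp_apply _ _ _ ⟨g, hker⟩ a
  have hθ' : ∀ (x : (P.trunc hP).cycles) (y : P.carrier), y ∈ P.grading 2 → P.d y = x.1 →
      θ x = g y := by
    intro x y hy hyx
    rw [← hθ]
    exact congrArg θ (Subtype.ext (hyx.symm.trans (bdry₂_of_mem hP hy).symm))
  refine ⟨θ, ⟨?_, ?_, ?_⟩, AddMonoidHom.ext hθ⟩
  · intro (a : P.carrier) ha x z hz
    obtain ⟨y, hy, hyx⟩ := hP.exact_succ 0 x.1 x.2.1 x.2.2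
    have hay := mul_mem_grading (P := P) (m := 0) ha hy
    rw [zero_add] at hay
    rw [hθ' x y hy hyx, hθ' z (a * y) hay, hmul, hg 0 a ha (by omega), smul_zero, add_zero]
    · rfl
    · rw [hz, P.leibniz 0 a ha, P.d_zero a ha, zero_mul, zero_add, pow_zero, one_mul, hyx]
      rfl
  · intro (a : P.carrier) ha x z hz
    obtain ⟨y, hy, hyx⟩ := hP.exact_succ 0 x.1 x.2.1 x.2.2
    have hay := mul_mem_grading (P := P) (n := 0) hy ha
    rw [hθ' x y hy hyx, hθ' z (y * a) hay, hmul, hg 0 a ha (by omega), smul_zero, zero_add]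
    · rfl
    · rw [hz, P.leibniz 2 y hy, P.d_zero a ha, mul_zero, mul_zero, add_zero, hyx]
      rfl
  · intro (x : P.carrier) hx (y : P.carrier) hy z hz
    have hxy := mul_mem_grading (P := P) (m := 1) (n := 1) hx hy
    rw [hθ' z (x * y) hxy, hmul, hg 1 x hx (by omega), hg 1 y hy (by omega), smul_zero, smul_zero,
      add_zero]
    rw [hz, P.leibniz 1 x hx, pow_one, neg_one_mul, ← sub_eq_add_neg]
    rfl

variable [SMulCommClass A Aᵐᵒᵖ M]

/-- Every cohomology class of degree `3` comes from a crossed map: the components of three and of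
two variables of a cocycle are removed successively by primitives. -/
theorem crossedClass_surjective (hK : ∀ k : K, ∃ n : ℤ, (n : K) = k) (hPf : P.IsQuasiFree)
    (hP : P.IsWeakEquivalence) : Function.Surjective (crossedClass hP M hK) := by
  intro y
  obtain ⟨⟨f, hf, hdf⟩, rfl⟩ := QuotientAddGroup.mk_surjective y
  have hdf : ∀ n r, P.differential M f n r = 0 := fun n r =>
    congrFun (congrFun (show P.differential M f = 0 from hdf) n) r
  have hf₄ : ∀ n r, f (n + 4) r = 0 := fun n => cochains_eq_zero_of_lt hf (by omega)
  have hf₀ := cochains_zero_eq_zero hf (by omega)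
  have sum₁ : ∀ (l : ℕ), ∑ i, ![l] i = l := fun l => by simp
  have sum₂ : ∀ (l m : ℕ), ∑ i, ![l, m] i = l + m := fun l m => by simp [Fin.sum_univ_two]
  have sum₃ : ∀ (l m n : ℕ), ∑ i, ![l, m, n] i = l + m + n := fun l m n => by
    simp [Fin.sum_univ_three]
  -- the component of three variables
  obtain ⟨e₂, he₂, hde₂⟩ := hPf.exists_primitive₂ hK 0 (component₃ hf)
    (fun l m n a ha b hb c hc hn => by
      refine cochains_eq_zero hf (deg := ![l, m, n]) (fun i => ?_) (by rw [sum₃]; omega)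
      fin_cases i
      exacts [ha, hb, hc])
    (fun a b c x => by
      have h := differential_four f (hf₄ 0) a b c x
      rw [hdf] at h
      exact h.symm)
  obtain ⟨hd₁, hd₂, hd₃, hd₄⟩ := differential_cochain₂ (P := P) (e := e₂)
  have hc₂ : P.cochain₂ e₂ ∈ P.cochains M 2 :=
    cochain₂_mem hK fun m n a ha b hb h => he₂ m n a ha b hb (by omega)
  have hsgn : ∀ a b, e₂ (P.sign (P.d a)) b = -e₂ (P.d (P.sign a)) b := fun a b => by
    rw [d_sign, map_neg, AddMonoidHom.neg_apply, neg_neg]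
  -- the remaining component of two variables
  let f' : P.carrier →+ P.carrier →+ M := component₂ hf
    - (e₂.comp P.d.toAddMonoidHom + AddMonoidHom.mk' (fun a => (e₂ (P.sign a)).comp
      P.d.toAddMonoidHom) fun a b => by ext c; simp)
  have hf' : ∀ a b, f' a b = f 2 ![a, b] - (e₂ (P.d a) b + e₂ (P.sign a) (P.d b)) :=
    fun a b => rfl
  obtain ⟨e₁, he₁, hde₁⟩ := hPf.exists_primitive₁ hK 1 f' (fun m n a ha b hb hn => by
      have h₁ : f 2 ![a, b] = 0 := by
        refine cochains_eq_zero hf (deg := ![m, n]) (fun i => ?_) (by rw [sum₂]; omega)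
        fin_cases i
        exacts [ha, hb]
      have h₂ : e₂ (P.d a) b = 0 := by
        cases m with
        | zero => rw [P.d_zero a ha, map_zero, AddMonoidHom.zero_apply]
        | succ m => exact he₂ m n _ (P.d_mem m a ha) b hb (by omega)
      have h₃ : e₂ (P.sign a) (P.d b) = 0 := by
        cases n with
        | zero => rw [P.d_zero b hb, map_zero]
        | succ n => exact he₂ m n _ (sign_mem ha) _ (P.d_mem n b hb) (by omega)
      rw [hf', h₁, h₂, h₃, add_zero, sub_zero])
    (fun a b c => by
      have h := differential_three f a b c
      rw [hdf] at h
      have hc : ∀ a b c, f 3 ![a, b, c] = _ := fun a b c => (hde₂ a b c).symm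
      simp only [hc, P.ε_d, ε_sign, zero_smul, op_zero] at h
      simp only [hf', smul_sub, smul_add, d_mul, sign_mul, map_add, AddMonoidHom.add_apply]
      refine Eq.trans ?_ h.symm
      abel)
  have hdd : ∀ a b, e₁ (P.d (a * b))
      = P.ε a • e₁ (P.d b) + op (P.ε b) • e₁ (P.d a) - f' (P.d a) b - f' (P.sign a) (P.d b) := by
    intro a b
    rw [← hde₁, ← hde₁, d_mul, map_add, P.ε_d, P.ε_d, ε_sign, zero_smul, op_zero, zero_smul]
    abel
  let g : P.carrier →+ M := component₁ hf + e₁.comp P.d.toAddMonoidHom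
  have hgd : ∀ a, g a = f 1 ![a] + e₁ (P.d a) := fun a => rfl
  obtain ⟨θ, hθ, hθg⟩ := exists_crossedMap (hP := hP) g (fun n a ha hn => by
      have h₁ : f 1 ![a] = 0 := by
        refine cochains_eq_zero hf (deg := ![n]) (fun i => ?_) (by rw [sum₁]; omega)
        fin_cases i
        exact ha
      rw [hgd, h₁, zero_add]
      cases n with
      | zero => rw [P.d_zero a ha, map_zero]
      | succ n => exact he₁ n _ (P.d_mem n a ha) (by omega))
    (fun a b => by
      have h := differential_two f a b
      rw [hdf] at h
      rw [hgd, hgd, hgd, hdd, hf', hf', P.d_d, P.d_d, map_zero, map_zero, AddMonoidHom.zero_apply,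
        hsgn, smul_add, smul_add, ← sub_eq_zero, h]
      abel)
    (fun a => by
      have h := differential_one f hf₀ a
      rw [hdf] at h
      rw [hgd, P.d_d, map_zero, add_zero, ← neg_eq_zero, ← h])
  have hc₁ : P.cochain₁ e₁ ∈ P.cochains M 2 :=
    cochain₁_mem hK fun n a ha h => he₁ n a ha (by omega)
  obtain ⟨hd₁', hd₂', hd₃'⟩ := differential_cochain₁ (P := P) (e := e₁)
  refine ⟨⟨θ, hθ⟩, ?_⟩
  refine QuotientAddGroup.eq.2 ⟨P.cochain₁ e₁ + P.cochain₂ e₂, add_mem hc₁ hc₂, ?_⟩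
  rw [map_add]
  change _ = -P.cochain₁ (θ.comp (bdry₂ hP)) + f
  rw [hθg]
  refine rawCochain_ext (fun r => ?_) (fun a => ?_) (fun a b => ?_) (fun a b c => ?_)
    (fun n r => ?_)
  · change (0 : M) + 0 = -0 + f 0 r
    rw [hf₀]; simp
  · change P.differential M (P.cochain₁ e₁) 1 ![a] + P.differential M (P.cochain₂ e₂) 1 ![a]
      = -g a + f 1 ![a]
    rw [hd₁, hd₁', hgd]
    abel
  · change P.differential M (P.cochain₁ e₁) 2 ![a, b] + P.differential M (P.cochain₂ e₂) 2 ![a, b]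
      = -0 + f 2 ![a, b]
    rw [hd₂, hd₂', hde₁, hf']
    abel
  · change P.differential M (P.cochain₁ e₁) 3 _ + P.differential M (P.cochain₂ e₂) 3 ![a, b, c]
      = -0 + f 3 ![a, b, c]
    rw [hd₃, hd₃' 0, hde₂, component₃_apply]
    abel
  · change P.differential M (P.cochain₁ e₁) (n + 4) r + P.differential M (P.cochain₂ e₂) (n + 4) r
      = -0 + f (n + 4) r
    rw [hd₄, hd₃' (n + 1), hf₄]
    abel

/-- The class of a crossed map vanishes if and only if the map extends to a bimodule homomorphism
on the part of degree `1`. If the class is the differential of a cochain, then the component of two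
variables of the cochain has a primitive, and subtracting the coboundary of the primitive leaves a
derivation of degree `1` that restricts to the crossed map up to sign. -/
theorem crossedClass_eq_zero_iff (hK : ∀ k : K, ∃ n : ℤ, (n : K) = k) (hPf : P.IsQuasiFree)
    (hP : P.IsWeakEquivalence) (θ : (P.trunc hP).crossedMaps M) :
    crossedClass hP M hK θ = 0 ↔ θ.1 ∈ (P.trunc hP).extendable M := by
  constructor
  · intro h
    obtain ⟨f, hf, hdf⟩ := (QuotientAddGroup.eq_zero_iff _).1 h
    have hdf : P.differential M f = P.cochain₁ (θ.1.comp (bdry₂ hP)) := hdf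
    have hf : f ∈ P.cochains M 2 := hf
    have hf₀ := cochains_zero_eq_zero hf (by omega)
    have hf₃ : ∀ r, f 3 r = 0 := cochains_eq_zero_of_lt hf (by omega)
    obtain ⟨e, he, hde⟩ := hPf.exists_primitive₁ hK 0 (component₂ hf)
      (fun m n a ha b hb hn => by
        refine cochains_eq_zero hf (deg := ![m, n]) (fun i => ?_)
          (by simp only [Fin.sum_univ_two, Matrix.cons_val_zero, Matrix.cons_val_one]; omega)
        fin_cases i
        exacts [ha, hb])
      (fun a b c => by
        have h := differential_three f a b c
        rw [hdf] at h
        simp only [hf₃, add_zero, sub_zero] at h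
        exact h.symm)
    let D : P.carrier →+ M := component₁ hf + e.comp P.d.toAddMonoidHom
    have hD : ∀ a, D a = f 1 ![a] + e (P.d a) := fun a => rfl
    have hDmul : ∀ a b, D (a * b) = P.ε a • D b + op (P.ε b) • D a := by
      intro a b
      have h := differential_two f a b
      rw [hdf] at h
      have h : (0 : M) = _ := h
      have hc : ∀ a b, f 2 ![a, b] = _ := fun a b => (hde a b).symm
      rw [hc, hc, P.ε_d, P.ε_d, ε_sign, zero_smul, op_zero, zero_smul] at h
      rw [hD, hD, hD, d_mul, map_add, smul_add, smul_add, ← sub_eq_zero, ← neg_eq_zero]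
      rw [eq_comm] at h
      rw [← h]
      abel
    refine TruncatedAlgebra.mem_extendable_of
      (-D.comp (P.trunc hP).deg1.subtype) (fun (a : P.carrier) ha (x : P.carrier) hx => ?_)
      (fun (a : P.carrier) ha (x : P.carrier) hx => ?_) (fun (x : P.carrier) hx => ?_)
    · have hx0 : P.ε x = 0 := P.ε_pos 0 x hx
      change -D (a * x) = P.ε a • -D x
      rw [hDmul, hx0, op_zero, zero_smul, add_zero, smul_neg]
    · have hx0 : P.ε x = 0 := P.ε_pos 0 x hx
      change -D (x * a) = op (P.ε a) • -D x
      rw [hDmul, hx0, zero_smul, zero_add, smul_neg]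
    · obtain ⟨y, hy⟩ := bdry₂_surjective hP ⟨x, hx⟩
      have hyx : P.d (P.proj 2 y) = x := congrArg Subtype.val hy
      have h := differential_one f hf₀ (P.proj 2 y)
      rw [hdf, hyx] at h
      change _ = -D x
      have hy' : bdry₂ hP (P.proj 2 y) = ⟨x, hx⟩ :=
        (Subtype.ext (bdry₂_of_mem hP (proj_mem 2 y))).trans hy
      rw [hD, ← hy', ← hyx, P.d_d, map_zero, add_zero, hyx, ← h]
      rfl
  · rintro ⟨D, ⟨h₁, h₂⟩, hD⟩
    let e : P.carrier →+ M := -D.comp (AddMonoidHom.codRestrict (P.proj 1)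
      (P.trunc hP).deg1 (proj_mem 1))
    have he₁ : ∀ a (ha : a ∈ P.grading 1), e a = -D ⟨a, ha⟩ := fun a ha =>
      congrArg (fun x => -D x) (Subtype.ext (proj_same ha))
    have he : ∀ n, ∀ a ∈ P.grading n, n ≠ 1 → e a = 0 := fun n a ha hn =>
      (congrArg (fun x => -D x) (Subtype.ext (proj_ne ha hn))).trans
        ((congrArg Neg.neg (map_zero D)).trans neg_zero)
    have hmul : ∀ a b, P.ε a • e b - e (a * b) + op (P.ε b) • e a = 0 := by
      intro a b
      let V : P.carrier → AddSubgroup P.carrier := fun b =>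
        { carrier := {a | P.ε a • e b - e (a * b) + op (P.ε b) • e a = 0}
          zero_mem' := by simp
          add_mem' := by
            intro x y (hx : _ = _) (hy : _ = _)
            change _ = _
            rw [← add_zero (0 : M)]
            nth_rw 1 [← hx]
            rw [← hy]
            simp only [add_mul, map_add, add_smul, smul_add]
            abel
          neg_mem' := by
            intro x (hx : _ = _)
            change _ = _
            rw [← neg_zero, ← hx]
            simp only [neg_mul, map_neg, neg_smul, smul_neg]
            abel }
      let W : P.carrier → AddSubgroup P.carrier := fun a =>
        { carrier := {b | P.ε a • e b - e (a * b) + op (P.ε b) • e a = 0}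
          zero_mem' := by simp
          add_mem' := by
            intro x y (hx : _ = _) (hy : _ = _)
            change _ = _
            rw [← add_zero (0 : M)]
            nth_rw 1 [← hx]
            rw [← hy]
            simp only [mul_add, map_add, op_add, add_smul, smul_add]
            abel
          neg_mem' := by
            intro x (hx : _ = _)
            change _ = _
            rw [← neg_zero, ← hx]
            simp only [mul_neg, map_neg, op_neg, neg_smul, smul_neg]
            abel }
      refine mem_of_homogeneous (V b) (fun m a ha => ?_) a
      refine mem_of_homogeneous (W a) (fun n b hb => ?_) b
      change _ = _
      have hab := mul_mem_grading ha hb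
      by_cases hmn : m + n = 1
      · have hc : (m = 0 ∧ n = 1) ∨ (m = 1 ∧ n = 0) := by omega
        rw [hmn] at hab
        rcases hc with ⟨rfl, rfl⟩ | ⟨rfl, rfl⟩
        · rw [he 0 a ha (by omega), smul_zero, add_zero, he₁ b hb, he₁ _ hab,
            h₁ a ha ⟨b, hb⟩ ⟨a * b, hab⟩ rfl, smul_neg]
          exact sub_self _
        · rw [he 0 b hb (by omega), smul_zero, zero_sub, he₁ a ha, he₁ _ hab,
            h₂ b hb ⟨a, ha⟩ ⟨a * b, hab⟩ rfl, smul_neg, neg_neg]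
          exact add_neg_cancel _
      · rw [he _ _ hab hmn]
        have hl : P.ε a • e b = 0 := by
          by_cases hm : m = 0
          · rw [he n b hb (by omega), smul_zero]
          · rw [ε_eq_zero ha hm, zero_smul]
        have hr : op (P.ε b) • e a = 0 := by
          by_cases hn : n = 0
          · rw [he m a ha (by omega), smul_zero]
          · rw [ε_eq_zero hb hn, op_zero, zero_smul]
        rw [hl, hr, sub_zero, add_zero]
    obtain ⟨hd₁, hd₂, hd₃⟩ := differential_cochain₁ (P := P) (e := e)
    refine (QuotientAddGroup.eq_zero_iff _).2 ⟨P.cochain₁ e,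
      cochain₁_mem (N := 2) hK fun n a ha h => he n a ha (by omega), ?_⟩
    change _ = P.cochain₁ (θ.1.comp (bdry₂ hP))
    refine rawCochain_ext (fun _ => rfl) (fun a => ?_) (fun a b => ?_) (fun a b c => hd₃ 0 _)
      (fun n r => hd₃ (n + 1) r)
    · rw [hd₁]
      change - -D _ = θ.1 (bdry₂ hP a)
      rw [neg_neg, ← hD]
      exact congrArg D (Subtype.ext (proj_d 1 a))
    · rw [hd₂, hmul]
      rfl

end ChainAlgebraOver

namespace TruncatedAlgebra

variable {A : Type u} [Ring A] (B : TruncatedAlgebra.{w} A)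
  {M : Type t} [AddCommGroup M] [Module A M] [Module Aᵐᵒᵖ M]

/-! ### The secondary invariant -/

section Secondary

variable {B} {p : ℕ}

theorem exists_d_eq_natCast (hA : (p : A) = 0) : ∃ x ∈ B.deg1, B.d x = p :=
  B.exact p (_root_.natCast_mem B.deg0 p) (by rw [map_natCast, hA])

omit [Module Aᵐᵒᵖ M] in
theorem nsmul_eq_zero_of_natCast (hA : (p : A) = 0) (m : M) : p • m = 0 := by
  rw [← Nat.cast_smul_eq_nsmul A, hA, zero_smul]

theorem nsmul_mem_cycles (hB : ((p ^ 2 : ℕ) : B.carrier) = 0) {x : B.carrier} (hx : x ∈ B.deg1)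
    (hdx : B.d x = p) : p • x ∈ B.cycles := by
  refine ⟨B.deg1.nsmul_mem hx p, ?_⟩
  change B.d (p • x) = 0
  rw [map_nsmul, hdx, nsmul_eq_mul, ← Nat.cast_mul, ← pow_two, hB]

omit [Module Aᵐᵒᵖ M] in
/-- For a crossed map `θ` with values in a bimodule that is killed by `p`, the element `θ (p x)`
with `d x = p` does not depend on `x`, since `x` is determined up to a cycle. -/
theorem apply_nsmul_eq (hA : (p : A) = 0) (hB : ((p ^ 2 : ℕ) : B.carrier) = 0)
    (θ : B.cycles →+ M) {x x' : B.carrier} (hx : x ∈ B.deg1) (hdx : B.d x = p)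
    (hx' : x' ∈ B.deg1) (hdx' : B.d x' = p) :
    θ ⟨p • x, nsmul_mem_cycles hB hx hdx⟩ = θ ⟨p • x', nsmul_mem_cycles hB hx' hdx'⟩ := by
  have hc : x - x' ∈ B.cycles := ⟨B.deg1.sub_mem hx hx', show B.d _ = 0 by
    rw [map_sub, hdx, hdx', sub_self]⟩
  rw [← sub_eq_zero, ← map_sub, ← nsmul_eq_zero_of_natCast hA (θ ⟨x - x', hc⟩), ← map_nsmul]
  refine congrArg θ (Subtype.ext ?_)
  exact (smul_sub p x x').symm

theorem apply_nsmul_mem_H0 (hA : (p : A) = 0) (hB : ((p ^ 2 : ℕ) : B.carrier) = 0)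
    {θ : B.cycles →+ M} (hθ : θ ∈ B.crossedMaps M) {x : B.carrier} (hx : x ∈ B.deg1)
    (hdx : B.d x = p) : θ ⟨p • x, nsmul_mem_cycles hB hx hdx⟩ ∈ H0 A M := by
  intro a
  obtain ⟨b, hb, rfl⟩ := B.surjective a
  have hc : b * x - x * b ∈ B.cycles :=
    ⟨B.deg1.sub_mem (B.mul_mem b hb x hx) (B.mul_mem' b hb x hx), show B.d _ = 0 by
      rw [map_sub, B.d_mul b hb x hx, B.d_mul' b hb x hx, hdx, Nat.cast_comm, sub_self]⟩
  have hz := nsmul_mem_cycles hB hx hdx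
  rw [← hθ.1 b hb _ ⟨_, B.mul_mem_cycles hb hz⟩ rfl,
    ← hθ.2.1 b hb _ ⟨_, B.mul_mem_cycles' hb hz⟩ rfl, ← sub_eq_zero, ← map_sub,
    ← nsmul_eq_zero_of_natCast hA (θ ⟨_, hc⟩), ← map_nsmul]
  refine congrArg θ (Subtype.ext ?_)
  change b * p • x - p • x * b = p • (b * x - x * b)
  rw [mul_smul_comm, smul_mul_assoc, smul_sub]

variable (B M) in
/-- The homomorphism that sends a crossed map `θ` to the central element `θ (p x)`, where
`d x = p`. The element `p x` is a cycle as `p ^ 2 = 0` in `B`. -/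
noncomputable def secondary (hA : (p : A) = 0) (hB : ((p ^ 2 : ℕ) : B.carrier) = 0) :
    B.crossedMaps M →+ H0 A M :=
  have h := (exists_d_eq_natCast (B := B) hA).choose_spec
  { toFun := fun θ => ⟨_, apply_nsmul_mem_H0 hA hB θ.2 h.1 h.2⟩
    map_zero' := rfl
    map_add' := fun _ _ => rfl }

theorem secondary_apply (hA : (p : A) = 0) (hB : ((p ^ 2 : ℕ) : B.carrier) = 0)
    (θ : B.crossedMaps M) {x : B.carrier} (hx : x ∈ B.deg1) (hdx : B.d x = p) :
    (secondary B M hA hB θ : M) = θ.1 ⟨p • x, nsmul_mem_cycles hB hx hdx⟩ :=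
  have h := (exists_d_eq_natCast (B := B) hA).choose_spec
  apply_nsmul_eq hA hB θ.1 h.1 h.2 hx hdx

theorem secondary_eq_zero_of_extendable (hA : (p : A) = 0)
    (hB : ((p ^ 2 : ℕ) : B.carrier) = 0) (θ : B.crossedMaps M) (hθ : θ.1 ∈ B.extendable M) :
    secondary B M hA hB θ = 0 := by
  obtain ⟨x, hx, hdx⟩ := exists_d_eq_natCast (B := B) hA
  obtain ⟨D, -, hD⟩ := hθ
  refine Subtype.ext ?_
  rw [secondary_apply hA hB θ hx hdx, ← hD]
  change D _ = (0 : M)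
  rw [← nsmul_eq_zero_of_natCast hA (D ⟨x, hx⟩), ← map_nsmul]
  rfl

end Secondary

/-! ### Reduction modulo an integer -/

section Mod

/-- The ideal `q R` of a ring `R`. -/
abbrev natIdeal (R : Type*) [Ring R] (q : ℕ) : Ideal R := Ideal.span {(q : R)}

theorem mem_natIdeal {R : Type*} [Ring R] {q : ℕ} {x : R} :
    x ∈ natIdeal R q ↔ ∃ y, q • y = x := by
  rw [Ideal.mem_span_singleton']
  simp only [nsmul_eq_mul, Nat.cast_comm]

instance {R : Type*} [Ring R] {q : ℕ} : (natIdeal R q).IsTwoSided := by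
  refine ⟨fun {a} b ha => ?_⟩
  obtain ⟨y, rfl⟩ := mem_natIdeal.1 ha
  exact mem_natIdeal.2 ⟨y * b, (smul_mul_assoc _ _ _).symm⟩

/-- The projection to the quotient by `q`. -/
abbrev mkQ (q : ℕ) : B.carrier →+* B.carrier ⧸ natIdeal B.carrier q :=
  Ideal.Quotient.mk (natIdeal B.carrier q)

theorem mkQ_surjective (q : ℕ) : Function.Surjective (B.mkQ q) := Ideal.Quotient.mk_surjective

variable {B} in
theorem mkQ_eq_zero {q : ℕ} {x : B.carrier} : B.mkQ q x = 0 ↔ ∃ y, q • y = x := by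
  rw [Ideal.Quotient.eq_zero_iff_mem, mem_natIdeal]

/-- The differential on the quotient by `q`. -/
noncomputable def modD (q : ℕ) :
    B.carrier ⧸ natIdeal B.carrier q →+ B.carrier ⧸ natIdeal B.carrier q :=
  AddMonoidHom.liftOfSurjective (B.mkQ q).toAddMonoidHom (B.mkQ_surjective q)
    ⟨(B.mkQ q).toAddMonoidHom.comp B.d, fun x hx => by
      obtain ⟨y, rfl⟩ := mkQ_eq_zero.1 hx
      exact mkQ_eq_zero.2 ⟨B.d y, (map_nsmul B.d q y).symm⟩⟩

theorem modD_mkQ (q : ℕ) (x : B.carrier) : B.modD q (B.mkQ q x) = B.mkQ q (B.d x) :=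
  AddMonoidHom.liftOfRightInverse_comp_apply (B.mkQ q).toAddMonoidHom _ _ _ x

/-- The reduction of `B` modulo an integer `q` with `q A = 0`. -/
@[reducible] noncomputable def mod (q : ℕ) (hA : (q : A) = 0) : TruncatedAlgebra.{w} A where
  carrier := B.carrier ⧸ natIdeal B.carrier q
  deg0 := B.deg0.map (B.mkQ q)
  deg1 := B.deg1.map (B.mkQ q).toAddMonoidHom
  d := B.modD q
  ε := Ideal.Quotient.lift _ B.ε fun x hx => by
    obtain ⟨y, rfl⟩ := mem_natIdeal.1 hx
    rw [map_nsmul, nsmul_eq_mul, hA, zero_mul]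
  mul_mem := by
    rintro _ ⟨a, ha, rfl⟩ _ ⟨x, hx, rfl⟩
    exact ⟨a * x, B.mul_mem a ha x hx, map_mul (B.mkQ q) a x⟩
  mul_mem' := by
    rintro _ ⟨a, ha, rfl⟩ _ ⟨x, hx, rfl⟩
    exact ⟨x * a, B.mul_mem' a ha x hx, map_mul (B.mkQ q) x a⟩
  d_mem := by
    rintro _ ⟨x, hx, rfl⟩
    exact ⟨B.d x, B.d_mem x hx, (B.modD_mkQ q x).symm⟩
  ε_d := by
    rintro _ ⟨x, hx, rfl⟩
    exact (congrArg _ (B.modD_mkQ q x)).trans (B.ε_d x hx)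
  d_mul := by
    rintro _ ⟨a, ha, rfl⟩ _ ⟨x, hx, rfl⟩
    change B.modD q (B.mkQ q a * B.mkQ q x) = B.mkQ q a * B.modD q (B.mkQ q x)
    rw [← map_mul, modD_mkQ, modD_mkQ, B.d_mul a ha x hx, map_mul]
  d_mul' := by
    rintro _ ⟨a, ha, rfl⟩ _ ⟨x, hx, rfl⟩
    change B.modD q (B.mkQ q x * B.mkQ q a) = B.modD q (B.mkQ q x) * B.mkQ q a
    rw [← map_mul, modD_mkQ, modD_mkQ, B.d_mul' a ha x hx, map_mul]
  exact := by
    rintro _ ⟨a, ha, rfl⟩ hε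
    obtain ⟨x, hx, rfl⟩ := B.exact a ha hε
    exact ⟨B.mkQ q x, ⟨x, hx, rfl⟩, B.modD_mkQ q x⟩
  surjective a := by
    obtain ⟨x, hx, rfl⟩ := B.surjective a
    exact ⟨B.mkQ q x, ⟨x, hx, rfl⟩, rfl⟩

variable {B} {q : ℕ} {hA : (q : A) = 0}

theorem natCast_mod : (q : (B.mod q hA).carrier) = 0 := by
  rw [← map_natCast (B.mkQ q), mkQ_eq_zero]
  exact ⟨1, nsmul_one q⟩

variable (B hA) in
/-- The projection of `B` to its reduction. -/
noncomputable def toMod : B.Hom (B.mod q hA) (RingHom.id A) where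
  toRingHom := B.mkQ q
  map_deg0 a ha := ⟨a, ha, rfl⟩
  map_deg1 x hx := ⟨x, hx, rfl⟩
  map_d x _ := (B.modD_mkQ q x).symm
  map_ε _ _ := rfl

variable {A' : Type u'} [Ring A'] {C : TruncatedAlgebra.{w'} A'} {g : A →+* A'}

/-- A morphism to an object in which `q = 0` factors through the reduction. -/
noncomputable def Hom.ofMod (F : B.Hom C g) (hC : (q : C.carrier) = 0) :
    (B.mod q hA).Hom C g where
  toRingHom := Ideal.Quotient.lift _ F.toRingHom fun x hx => by
    obtain ⟨y, rfl⟩ := mem_natIdeal.1 hx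
    rw [map_nsmul, nsmul_eq_mul, hC, zero_mul]
  map_deg0 := by
    rintro _ ⟨a, ha, rfl⟩
    exact F.map_deg0 a ha
  map_deg1 := by
    rintro _ ⟨a, ha, rfl⟩
    exact F.map_deg1 a ha
  map_d := by
    rintro _ ⟨x, hx, rfl⟩
    exact (congrArg _ (B.modD_mkQ q x)).trans (F.map_d x hx)
  map_ε := by
    rintro _ ⟨a, ha, rfl⟩
    exact F.map_ε a ha

variable (B) in
/-- Multiplication by `q` on `B` is injective and reflects the degrees `0` and `1`. -/
structure IsTorsionFree (q : ℕ) : Prop where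
  eq_zero : ∀ x : B.carrier, q • x = 0 → x = 0
  mem_deg0 : ∀ x : B.carrier, q • x ∈ B.deg0 → x ∈ B.deg0
  mem_deg1 : ∀ x : B.carrier, q • x ∈ B.deg1 → x ∈ B.deg1

theorem exists_lift_of_mem_cycles (hB : B.IsTorsionFree q) {y : (B.mod q hA).carrier}
    (hy : y ∈ (B.mod q hA).cycles) :
    ∃ x ∈ B.deg1, ∃ c ∈ B.deg0, B.mkQ q x = y ∧ B.d x = q • c := by
  obtain ⟨⟨x, hx, rfl⟩, hd⟩ := hy
  have hd : B.modD q (B.mkQ q x) = 0 := hd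
  rw [modD_mkQ] at hd
  obtain ⟨c, hc⟩ := mkQ_eq_zero.1 hd
  exact ⟨x, hx, c, hB.mem_deg0 c (by rw [hc]; exact B.d_mem x hx), rfl, hc.symm⟩

theorem mkQ_mem_cycles {x c : B.carrier} (hx : x ∈ B.deg1) (h : B.d x = q • c) :
    B.mkQ q x ∈ (B.mod q hA).cycles :=
  ⟨⟨x, hx, rfl⟩, (B.modD_mkQ q x).trans (mkQ_eq_zero.2 ⟨c, h.symm⟩)⟩

end Mod

section ModSq

variable {B} {p : ℕ} {hA : ((p ^ 2 : ℕ) : A) = 0}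

theorem sub_mul_mem_cycles {x c e : B.carrier} (hx : x ∈ B.deg1) (hdx : B.d x = p)
    (he : e ∈ B.deg1) (hc : c ∈ B.deg0) (h : B.d e = p ^ 2 • c) :
    e - c * p • x ∈ B.cycles := by
  refine ⟨B.deg1.sub_mem he (B.mul_mem c hc _ (B.deg1.nsmul_mem hx p)), ?_⟩
  change B.d _ = 0
  rw [map_sub, h, B.d_mul c hc _ (B.deg1.nsmul_mem hx p), map_nsmul, hdx,
    nsmul_eq_mul p (p : B.carrier), ← Nat.cast_mul, ← pow_two, nsmul_eq_mul, Nat.cast_comm,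
    sub_self]

/-- Let `d x = p`. A crossed map `θ` on a torsion-free `B` with values in a bimodule that is killed
by `p` extends to the reduction modulo `p ^ 2`: a cycle of the reduction is represented by `e` with
`d e = p ^ 2 c`, and it is sent to `θ (e - c (p x))`. -/
theorem exists_mod_crossedMap (hp : (p : A) = 0) (hB : B.IsTorsionFree (p ^ 2))
    {θ : B.cycles →+ M} (hθ : θ ∈ B.crossedMaps M) {x : B.carrier} (hx : x ∈ B.deg1)
    (hdx : B.d x = p) :
    ∃ θ' ∈ (B.mod (p ^ 2) hA).crossedMaps M,
      ∀ e (he : e ∈ B.deg1) c (hc : c ∈ B.deg0) (h : B.d e = p ^ 2 • c),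
        θ' ⟨B.mkQ (p ^ 2) e, mkQ_mem_cycles he h⟩
          = θ ⟨e - c * p • x, sub_mul_mem_cycles hx hdx he hc h⟩ := by
  obtain ⟨h₁, h₂, h₃⟩ := hθ
  have hz : p • x ∈ B.deg1 := B.deg1.nsmul_mem hx p
  have hdz : B.d (p • x) = ((p ^ 2 : ℕ) : B.carrier) := by
    rw [map_nsmul, hdx, nsmul_eq_mul, ← Nat.cast_mul, ← pow_two]
  choose e he c hc hmk hd using fun y : (B.mod (p ^ 2) hA).cycles =>
    exists_lift_of_mem_cycles hB y.2
  -- independence of the choice of a representative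
  have key : ∀ e (he : e ∈ B.deg1) c (hc : c ∈ B.deg0) (h : B.d e = p ^ 2 • c),
      B.mkQ (p ^ 2) e = 0 → θ ⟨e - c * p • x, sub_mul_mem_cycles hx hdx he hc h⟩ = 0 := by
    intro e he c hc h h0
    obtain ⟨y, rfl⟩ := mkQ_eq_zero.1 h0
    have hy := hB.mem_deg1 y he
    have hcy : c = B.d y := by
      rw [← sub_eq_zero]
      refine hB.eq_zero _ ?_
      rw [smul_sub, ← h, map_nsmul, sub_self]
    rw [← neg_eq_zero, ← map_neg]
    refine h₃ y hy _ hz _ ?_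
    change -(p ^ 2 • y - c * p • x) = B.d y * p • x - y * B.d (p • x)
    rw [hdz, hcy, ← Nat.cast_comm, ← nsmul_eq_mul]
    abel
  have val : ∀ (y : (B.mod (p ^ 2) hA).cycles) (e' : B.carrier) (he' : e' ∈ B.deg1)
      (c' : B.carrier) (hc' : c' ∈ B.deg0) (h' : B.d e' = p ^ 2 • c'), B.mkQ (p ^ 2) e' = y →
      θ ⟨e y - c y * p • x, sub_mul_mem_cycles hx hdx (he y) (hc y) (hd y)⟩
        = θ ⟨e' - c' * p • x, sub_mul_mem_cycles hx hdx he' hc' h'⟩ := by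
    intro y e' he' c' hc' h' hy
    rw [← sub_eq_zero, ← map_sub, ← key (e y - e') (B.deg1.sub_mem (he y) he') (c y - c')
      (B.deg0.sub_mem (hc y) hc') (by rw [map_sub, hd, h', smul_sub])
      (by rw [map_sub, hmk, hy, sub_self])]
    refine congrArg θ (Subtype.ext ?_)
    change e y - c y * p • x - (e' - c' * p • x) = e y - e' - (c y - c') * p • x
    rw [sub_mul]
    abel
  let θ' : (B.mod (p ^ 2) hA).cycles →+ M :=
    AddMonoidHom.mk'
      (fun y => θ ⟨e y - c y * p • x, sub_mul_mem_cycles hx hdx (he y) (hc y) (hd y)⟩)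
      fun y y' => by
        rw [val (y + y') (e y + e y') (B.deg1.add_mem (he y) (he y')) (c y + c y')
          (B.deg0.add_mem (hc y) (hc y')) (by rw [map_add, hd, hd, smul_add])
          (by rw [map_add, hmk, hmk]; rfl)]
        refine Eq.trans (congrArg θ (Subtype.ext ?_)) (map_add θ _ _)
        change e y + e y' - (c y + c y') * p • x = e y - c y * p • x + (e y' - c y' * p • x)
        rw [add_mul]
        abel
  have hval : ∀ (y : (B.mod (p ^ 2) hA).cycles) (e' : B.carrier) (he' : e' ∈ B.deg1)
      (c' : B.carrier) (hc' : c' ∈ B.deg0) (h' : B.d e' = p ^ 2 • c'), B.mkQ (p ^ 2) e' = y →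
      θ' y = θ ⟨e' - c' * p • x, sub_mul_mem_cycles hx hdx he' hc' h'⟩ := val
  refine ⟨θ', ⟨?_, ?_, ?_⟩, fun e he c hc h => hval _ e he c hc h rfl⟩
  · rintro _ ⟨a, ha, rfl⟩ y z hyz
    rw [hval z (a * e y) (B.mul_mem a ha _ (he y)) (a * c y) (B.deg0.mul_mem ha (hc y))
      (by rw [B.d_mul a ha _ (he y), hd, mul_smul_comm])
      (by rw [map_mul, hmk, hyz])]
    refine h₁ a ha _ _ ?_
    change a * e y - a * c y * p • x = a * (e y - c y * p • x)
    rw [mul_sub, mul_assoc]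
  · rintro _ ⟨a, ha, rfl⟩ y z hyz
    rw [hval z (e y * a) (B.mul_mem' a ha _ (he y)) (c y * a) (B.deg0.mul_mem (hc y) ha)
      (by rw [B.d_mul' a ha _ (he y), hd, smul_mul_assoc])
      (by rw [map_mul, hmk, hyz])]
    change _ = op (B.ε a) • θ ⟨e y - c y * p • x, _⟩
    have hcom : x * a - a * x ∈ B.cycles :=
      ⟨B.deg1.sub_mem (B.mul_mem' a ha x hx) (B.mul_mem a ha x hx), show B.d _ = 0 by
        rw [map_sub, B.d_mul a ha x hx, B.d_mul' a ha x hx, hdx, Nat.cast_comm, sub_self]⟩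
    rw [← h₂ a ha ⟨e y - c y * p • x, sub_mul_mem_cycles hx hdx (he y) (hc y) (hd y)⟩
      ⟨_, B.mul_mem_cycles' ha (sub_mul_mem_cycles hx hdx (he y) (hc y) (hd y))⟩ rfl,
      ← sub_eq_zero, ← map_sub, ← nsmul_eq_zero_of_natCast hp
        (θ ⟨c y * (x * a - a * x), B.mul_mem_cycles (hc y) hcom⟩), ← map_nsmul]
    refine congrArg θ (Subtype.ext ?_)
    change (e y * a - c y * a * p • x) - (e y - c y * p • x) * a = p • (c y * (x * a - a * x))
    simp only [mul_smul_comm, smul_mul_assoc, sub_mul, mul_sub, smul_sub, mul_assoc]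
    abel
  · rintro _ ⟨y, hy, rfl⟩ _ ⟨y', hy', rfl⟩ z hz'
    have hpf := B.peiffer_mem hy hy'
    rw [hval z _ hpf.1 0 B.deg0.zero_mem (by rw [smul_zero]; exact hpf.2) (by
      rw [hz', map_sub, map_mul, map_mul, ← modD_mkQ, ← modD_mkQ]; rfl)]
    refine h₃ y hy y' hy' _ ?_
    change B.d y * y' - y * B.d y' - 0 * p • x = _
    rw [zero_mul, sub_zero]

/-- Let `F` be a morphism from a torsion-free `B` to an object `C` in which `p ^ 2 = 0`, and let
`θ` be a crossed map on `C` whose secondary invariant vanishes. If the pull-back of `θ` to `B`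
is extendable, then so is its pull-back to the reduction of `B` modulo `p ^ 2`. -/
theorem pull_ofMod_mem_extendable {C : TruncatedAlgebra.{w'} A} (hp : (p : A) = 0)
    (hB : B.IsTorsionFree (p ^ 2)) (hC : ((p ^ 2 : ℕ) : C.carrier) = 0)
    (F : B.Hom C (BimoduleHom.id A M).g) (θ : C.crossedMaps M) (h0 : secondary C M hp hC θ = 0)
    (hF : F.pull (BimoduleHom.id A M) θ.1 ∈ B.extendable M) :
    (F.ofMod (hA := hA) hC).pull (BimoduleHom.id A M) θ.1
      ∈ (B.mod (p ^ 2) hA).extendable M := by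
  obtain ⟨D, ⟨hD₁, hD₂⟩, hD⟩ := hF
  obtain ⟨x, hx, hdx⟩ := exists_d_eq_natCast (B := B) hp
  let π : B.deg1 →+ (B.mod (p ^ 2) hA).deg1 :=
    (B.mkQ (p ^ 2)).toAddMonoidHom.addSubgroupMap B.deg1
  have hπ : Function.Surjective π := AddMonoidHom.addSubgroupMap_surjective _ _
  have hpM : ∀ m : M, p ^ 2 • m = 0 := fun m => nsmul_eq_zero_of_natCast hA m
  have hker : π.ker ≤ D.ker := by
    rintro ⟨y, hy⟩ h
    obtain ⟨z, rfl⟩ := mkQ_eq_zero.1 (show B.mkQ (p ^ 2) y = 0 from congrArg Subtype.val h)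
    have hz := hB.mem_deg1 z hy
    change D _ = 0
    rw [← hpM (D ⟨z, hz⟩), ← map_nsmul]
    rfl
  let D' : (B.mod (p ^ 2) hA).deg1 →+ M := AddMonoidHom.liftOfSurjective π hπ ⟨D, hker⟩
  have hD' : ∀ y (hy : y ∈ B.deg1), D' ⟨B.mkQ (p ^ 2) y, ⟨y, hy, rfl⟩⟩ = D ⟨y, hy⟩ := fun y hy =>
    AddMonoidHom.liftOfRightInverse_comp_apply π _ _ ⟨D, hker⟩ ⟨y, hy⟩
  refine mem_extendable_of D' ?_ ?_ ?_
  · rintro _ ⟨a, ha, rfl⟩ _ ⟨y, hy, rfl⟩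
    refine (hD' (a * y) (B.mul_mem a ha y hy)).trans ?_
    rw [hD₁ a ha ⟨y, hy⟩ _ rfl, ← hD' y hy]
    rfl
  · rintro _ ⟨a, ha, rfl⟩ _ ⟨y, hy, rfl⟩
    refine (hD' (y * a) (B.mul_mem' a ha y hy)).trans ?_
    rw [hD₂ a ha ⟨y, hy⟩ _ rfl, ← hD' y hy]
    rfl
  · intro y hy
    obtain ⟨e, he, c, hc, rfl, hd⟩ := exists_lift_of_mem_cycles hB hy
    have hcyc := sub_mul_mem_cycles hx hdx he hc hd
    have hFd : C.d (F.toRingHom x) = p :=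
      (F.map_d x hx).symm.trans ((congrArg F.toRingHom hdx).trans (map_natCast F.toRingHom p))
    have hz : p • F.toRingHom x ∈ C.cycles := nsmul_mem_cycles hC (F.map_deg1 x hx) hFd
    have h0' : θ.1 ⟨p • F.toRingHom x, hz⟩ = 0 := by
      rw [← secondary_apply hp hC θ (F.map_deg1 x hx) hFd, h0]
      rfl
    have hDe : D ⟨_, hcyc.1⟩ = D ⟨e, he⟩ := by
      have h1 : D ⟨c * p • x, B.mul_mem c hc _ (B.deg1.nsmul_mem hx p)⟩ = 0 := by
        rw [hD₁ c hc ⟨p • x, B.deg1.nsmul_mem hx p⟩ _ rfl,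
          show (⟨p • x, B.deg1.nsmul_mem hx p⟩ : B.deg1) = p • ⟨x, hx⟩ from rfl, map_nsmul,
          nsmul_eq_zero_of_natCast hp, smul_zero]
      rw [← sub_zero (D ⟨e, he⟩), ← h1, ← map_sub]
      rfl
    rw [hD' e he, ← hDe]
    refine Eq.trans ?_ (DFunLike.congr_fun hD ⟨_, hcyc⟩).symm
    have hFe : F.toRingHom e ∈ C.cycles := (F.ofMod (hA := hA) hC).map_mem_cycles hy
    change θ.1 ⟨F.toRingHom e, hFe⟩ = θ.1 ⟨F.toRingHom (e - c * p • x), F.map_mem_cycles hcyc⟩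
    have h2 : θ.1 ⟨F.toRingHom c * p • F.toRingHom x,
        C.mul_mem_cycles (F.map_deg0 c hc) hz⟩ = 0 := by
      rw [θ.2.1 _ (F.map_deg0 c hc) ⟨_, hz⟩ _ rfl, h0', smul_zero]
    rw [← sub_zero (θ.1 ⟨F.toRingHom e, hFe⟩), ← h2, ← map_sub]
    refine congrArg θ.1 (Subtype.ext ?_)
    change F.toRingHom e - F.toRingHom c * p • F.toRingHom x = F.toRingHom (e - c * p • x)
    rw [map_sub, map_mul, map_nsmul]

end ModSq

end TruncatedAlgebra

/-! ### Functoriality of crossed maps -/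

namespace TruncatedAlgebra

variable {A : Type u} [Ring A] {B : TruncatedAlgebra.{w} A} {A' : Type u'} [Ring A']
  {C : TruncatedAlgebra.{w'} A'}
  {M : Type t} [AddCommGroup M] [Module A M] [Module Aᵐᵒᵖ M]
  {M' : Type t'} [AddCommGroup M'] [Module A' M'] [Module A'ᵐᵒᵖ M']

variable (B) in
/-- The identity morphism. -/
def Hom.id : B.Hom B (RingHom.id A) where
  toRingHom := RingHom.id _
  map_deg0 _ h := h
  map_deg1 _ h := h
  map_d _ _ := rfl
  map_ε _ _ := rfl

theorem Hom.pull_mem_extendable (φ : BimoduleHom A M A' M') (F : B.Hom C φ.g)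
    {θ : C.cycles →+ M'} (hθ : θ ∈ C.extendable M') : F.pull φ θ ∈ B.extendable M := by
  obtain ⟨D, ⟨h₁, h₂⟩, rfl⟩ := hθ
  let f : B.deg1 →+ C.deg1 :=
    { toFun := fun x => ⟨F.toRingHom x, F.map_deg1 x x.2⟩
      map_zero' := Subtype.ext (map_zero _)
      map_add' := fun _ _ => Subtype.ext (map_add _ _ _) }
  refine mem_extendable_of ((φ.h.comp D).comp f) (fun a ha x hx => ?_) (fun a ha x hx => ?_)
    fun x hx => rfl
  · change φ.h (D _) = _ • φ.h (D _)
    rw [h₁ _ (F.map_deg0 a ha) (f ⟨x, hx⟩) _ (map_mul F.toRingHom a x), F.map_ε a ha, φ.map_smul]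
  · change φ.h (D _) = _ • φ.h (D _)
    rw [h₂ _ (F.map_deg0 a ha) (f ⟨x, hx⟩) _ (map_mul F.toRingHom x a), F.map_ε a ha,
      φ.map_op_smul]

/-- A morphism carries a solution `x` of `d x = p` to such a solution. -/
theorem secondary_pull {p : ℕ} (hA : (p : A) = 0) (hB : ((p ^ 2 : ℕ) : B.carrier) = 0)
    (hA' : (p : A') = 0) (hC : ((p ^ 2 : ℕ) : C.carrier) = 0) (φ : BimoduleHom A M A' M')
    (F : B.Hom C φ.g) (θ : C.crossedMaps M') :
    secondary B M hA hB ⟨F.pull φ θ.1, F.pull_mem φ θ.2⟩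
      = H0.map φ (secondary C M' hA' hC θ) := by
  obtain ⟨x, hx, hdx⟩ := exists_d_eq_natCast (B := B) hA
  refine Subtype.ext ?_
  change _ = φ.h (secondary C M' hA' hC θ : M')
  rw [secondary_apply hA hB _ hx hdx, secondary_apply hA' hC θ (F.map_deg1 x hx)
    ((F.map_d x hx).symm.trans ((congrArg F.toRingHom hdx).trans (map_natCast F.toRingHom p)))]
  refine congrArg φ.h (congrArg θ.1 (Subtype.ext ?_))
  exact map_nsmul F.toRingHom p x

end TruncatedAlgebra

/-! ### Torsion-freeness over the integers and Shukla classes -/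

namespace ChainAlgebraOver

section TorsionFree

variable {A : Type u} [Ring A] {P : ChainAlgebraOver.{0, w} ℤ A}

theorem IsQuasiFree.eq_zero_of_nsmul (hPf : P.IsQuasiFree) {q : ℕ} (hq : q ≠ 0) {x : P.carrier}
    (hx : q • x = 0) : x = 0 := by
  obtain ⟨S⟩ := hPf.nonempty_freeGenerators
  have h : q • S.equiv.symm x = 0 := by rw [← map_nsmul, hx, map_zero]
  have h' : S.equiv.symm x = 0 := by
    have : (q : ℤ) • S.equiv.symm x = 0 := by rw [natCast_zsmul, h]
    exact (smul_eq_zero.1 this).resolve_left (by exact_mod_cast hq)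
  rwa [map_eq_zero_iff _ S.equiv.symm.injective] at h'

theorem IsQuasiFree.isTorsionFree (hPf : P.IsQuasiFree) (hP : P.IsWeakEquivalence) {q : ℕ}
    (hq : q ≠ 0) : (P.trunc hP).IsTorsionFree q := by
  have key : ∀ n (x : P.carrier), q • x ∈ P.grading n → x ∈ P.grading n := by
    intro n x hx
    have : x - P.proj n x = 0 := hPf.eq_zero_of_nsmul hq (by
      rw [smul_sub, ← map_nsmul, proj_same hx, sub_self])
    rw [sub_eq_zero.1 this]
    exact proj_mem n x
  exact ⟨fun x hx => hPf.eq_zero_of_nsmul hq hx, key 0, key 1⟩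

end TorsionFree

end ChainAlgebraOver

namespace Shukla

open ChainAlgebraOver

variable {K : Type v} [CommRing K] {A : Type u} [Ring A] [Algebra K A]
  {K' : Type v'} [CommRing K'] {A' : Type u'} [Ring A'] [Algebra K' A'] [Algebra K K']
  {M : Type t} [AddCommGroup M] [Module A M] [Module Aᵐᵒᵖ M] [SMulCommClass A Aᵐᵒᵖ M]
  {M' : Type t'} [AddCommGroup M'] [Module A' M'] [Module A'ᵐᵒᵖ M']
  (hK : ∀ k : K, ∃ n : ℤ, (n : K) = k) (hK' : ∀ k : K', ∃ n : ℤ, (n : K') = k)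

variable (K A) in
/-- The truncation of the chosen quasi-free resolution. -/
noncomputable abbrev trunc : TruncatedAlgebra.{max u v} A :=
  (resolution K A).trunc (resolution_isWeakEquivalence K A)

variable (M) in
/-- The class of a crossed map on the chosen resolution. -/
noncomputable abbrev crossedClass : (trunc K A).crossedMaps M →+ Shukla K A M 3 :=
  ChainAlgebraOver.crossedClass (resolution_isWeakEquivalence K A) M hK

theorem crossedClass_eq_iff (θ θ' : (trunc K A).crossedMaps M) :
    crossedClass M hK θ = crossedClass M hK θ' ↔ θ.1 - θ'.1 ∈ (trunc K A).extendable M := by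
  rw [← sub_eq_zero, ← map_sub, crossedClass_eq_zero_iff hK (resolution_isQuasiFree K A)]
  rfl

include hK' in
/-- The induced homomorphism on Shukla cohomology may be computed with any lift of `φ.g` to the
truncations of the resolutions. -/
theorem map_crossedClass (φ : BimoduleHom A M A' M')
    (hφ : ∀ k, φ.g (algebraMap K A k) = algebraMap K' A' (algebraMap K K' k))
    (F : (trunc K A).Hom (trunc K' A') φ.g) (θ : (trunc K' A').crossedMaps M') :
    Shukla.map K K' φ hφ 3 (crossedClass M' hK' θ)
      = crossedClass M hK ⟨F.pull φ θ.1, F.pull_mem φ θ.2⟩ := by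
  refine (Hom.cohomologyMap_crossedClass hK hK' (resolution_isWeakEquivalence K A)
    (resolution_isWeakEquivalence K' A') φ _ θ).trans ?_
  rw [crossedClass_eq_iff]
  exact (resolution_isQuasiFree K A).pull_sub_pull_mem hK _ φ _ F θ.2

end Shukla

/-! ### The class of a crossed extension -/

namespace CrossedExtension

open ChainAlgebraOver

variable {K : Type v} [CommRing K] {A : Type u} [Ring A] [Algebra K A]
  {M : Type t} [AddCommGroup M] [Module A M] [Module Aᵐᵒᵖ M] [SMulCommClass A Aᵐᵒᵖ M]
  (E : CrossedExtension.{v, w, w'} K A M)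

/-- The truncation `C₁ → C₀` of the chain algebra `M → C₁ → C₀`. -/
noncomputable abbrev trunc : TruncatedAlgebra.{max t w w'} A :=
  E.chainAlgebra.trunc E.chainAlgebra_isWeakEquivalence

/-- The component in `C₁`. -/
def toC₁ : E.trunc.carrier →+ E.C₁ where
  toFun z := (show E.Total from z).snd.1
  map_zero' := rfl
  map_add' _ _ := rfl

/-- The component in `C₀`. -/
def toC₀ : E.trunc.carrier →+* E.C₀ :=
  (TrivSqZeroExt.fstHom K E.C₀ E.Pos).toRingHom

theorem toC₀_d (z : E.trunc.carrier) : E.toC₀ (E.trunc.d z) = E.bdry (E.toC₁ z) := rfl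

theorem toC₁_mul (a x : E.trunc.carrier) :
    E.toC₁ (a * x) = E.toC₀ a • E.toC₁ x + op (E.toC₀ x) • E.toC₁ a := rfl

theorem ε_eq (a : E.trunc.carrier) : E.trunc.ε a = E.π (E.toC₀ a) := rfl

variable {E} in
theorem toC₀_eq_zero {x : E.trunc.carrier} (hx : x ∈ E.trunc.deg1) : E.toC₀ x = 0 :=
  hx.1 one_ne_zero

variable {E} in
theorem toC₁_mul_of_mem (a : E.trunc.carrier) {x : E.trunc.carrier} (hx : x ∈ E.trunc.deg1) :
    E.toC₁ (a * x) = E.toC₀ a • E.toC₁ x := by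
  rw [toC₁_mul, toC₀_eq_zero hx, op_zero, zero_smul, add_zero]

variable {E} in
theorem toC₁_mul_of_mem' (a : E.trunc.carrier) {x : E.trunc.carrier} (hx : x ∈ E.trunc.deg1) :
    E.toC₁ (x * a) = op (E.toC₀ a) • E.toC₁ x := by
  rw [toC₁_mul, toC₀_eq_zero hx, zero_smul, zero_add]

theorem exists_i_eq (z : E.trunc.cycles) : ∃ m, E.i m = E.toC₁ z :=
  (E.exact_C₁ _).1 (congrArg E.toC₀ z.2.2)

/-- The identification of the kernel of `∂ : C₁ → C₀` with `M`. -/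
noncomputable def kernelMap : E.trunc.cycles →+ M :=
  AddMonoidHom.mk' (fun z => (E.exists_i_eq z).choose) fun z z' => E.i_injective (by
    rw [map_add, (E.exists_i_eq _).choose_spec, (E.exists_i_eq _).choose_spec,
      (E.exists_i_eq _).choose_spec]
    exact map_add E.toC₁ _ _)

theorem i_kernelMap (z : E.trunc.cycles) : E.i (E.kernelMap z) = E.toC₁ z :=
  (E.exists_i_eq z).choose_spec

theorem kernelMap_mem : E.kernelMap ∈ E.trunc.crossedMaps M := by
  refine ⟨fun a ha x y h => E.i_injective ?_, fun a ha x y h => E.i_injective ?_,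
    fun x hx y hy z h => E.i_injective ?_⟩
  · rw [i_kernelMap, ε_eq, E.i_smul, i_kernelMap, h, toC₁_mul_of_mem a x.2.1]
  · rw [i_kernelMap, ε_eq, E.i_op_smul, i_kernelMap, h, toC₁_mul_of_mem' a x.2.1]
  · rw [i_kernelMap, h, map_sub, toC₁_mul_of_mem _ hy, toC₁_mul_of_mem' _ hx, toC₀_d, toC₀_d,
      E.crossed, sub_self, map_zero]

/-- On the chain algebra `M → C₁ → C₀`, the composite of the crossed map with the differential is
the projection to `M`. -/
theorem kernelMap_bdry₂ (z : E.trunc.carrier) :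
    E.kernelMap (bdry₂ E.chainAlgebra_isWeakEquivalence z) = (show E.Total from z).snd.2 := by
  refine E.i_injective ?_
  rw [i_kernelMap]
  change E.i (show E.Total from E.chainAlgebra.proj 2 z).snd.2 = _
  refine congrArg E.i ?_
  let f : E.chainAlgebra.carrier →+ M :=
    { toFun := fun z => (show E.Total from z).snd.2
      map_zero' := rfl
      map_add' := fun _ _ => rfl }
  refine mem_of_homogeneous ((f.comp (E.chainAlgebra.proj 2)).eqLocus f) (fun n a ha => ?_) z
  change f _ = f _
  by_cases hn : n = 2
  · subst hn
    rw [proj_same ha]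
  · rw [proj_ne ha hn, map_zero]
    exact (ha.2.2 hn).symm

/-- The class of a crossed extension is the class of the crossed map that identifies the kernel of
`∂` with `M`. -/
theorem shuklaClass_eq (hK : ∀ k : K, ∃ n : ℤ, (n : K) = k)
    (F : (Shukla.trunc K A).Hom E.trunc (RingHom.id A)) :
    E.shuklaClass = Shukla.crossedClass M hK
      ⟨F.pull (BimoduleHom.id A M) E.kernelMap,
        F.pull_mem (BimoduleHom.id A M) E.kernelMap_mem⟩ := by
  have h : (QuotientAddGroup.mk' _ ⟨E.cochain, E.cochain_mem_cocycles⟩ :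
      E.chainAlgebra.HochschildCohomology M 3)
      = ChainAlgebraOver.crossedClass E.chainAlgebra_isWeakEquivalence M hK
        ⟨E.kernelMap, E.kernelMap_mem⟩ := by
    refine congrArg (QuotientAddGroup.mk' _) (Subtype.ext ?_)
    funext n r
    match n, r with
    | 0, _ => rfl
    | 1, r => exact (E.kernelMap_bdry₂ (r 0)).symm
    | n + 2, _ => rfl
  refine (congrArg (Hom.cohomologyMap (BimoduleHom.id A M) _ 3) h).trans
    ((Hom.cohomologyMap_crossedClass hK hK (resolution_isWeakEquivalence K A)
      E.chainAlgebra_isWeakEquivalence (BimoduleHom.id A M) _ _).trans ?_)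
  rw [Shukla.crossedClass_eq_iff]
  exact (resolution_isQuasiFree K A).pull_sub_pull_mem hK _ (BimoduleHom.id A M) _ F
    E.kernelMap_mem

open TruncatedAlgebra in
variable {E} in
/-- If `x` in `C₁` has boundary `p`, then the element of `M` that corresponds to `p x` is the
secondary invariant of the crossed extension. -/
theorem secondary_kernelMap {p : ℕ} (hA : (p : A) = 0)
    (hB : ((p ^ 2 : ℕ) : E.trunc.carrier) = 0) {x : E.C₁} (hx : E.bdry x = p) {m : M}
    (hm : E.i m = p • x) : (secondary E.trunc M hA hB ⟨_, E.kernelMap_mem⟩ : M) = m := by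
  have hx' : E.tri 0 x 0 ∈ E.trunc.deg1 :=
    ⟨fun _ => rfl, fun h => absurd rfl h, fun _ => rfl⟩
  have hdx : E.trunc.d (E.tri 0 x 0) = p := by
    have hs : (show E.Total from (p : E.trunc.carrier)).snd = 0 :=
      TrivSqZeroExt.snd_natCast (R := E.C₀) (M := E.Pos) p
    refine E.total_ext (hx.trans (map_natCast E.toC₀ p).symm) ?_ ?_
    · exact (map_zero E.i).trans (congrArg Prod.fst hs).symm
    · exact (congrArg Prod.snd hs).symm
  rw [secondary_apply hA hB _ hx' hdx]
  refine E.i_injective ?_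
  rw [E.i_kernelMap, hm]
  exact map_nsmul E.toC₁ p (E.tri 0 x 0)

/-- The crossed map of a crossed extension becomes extendable when it is pulled back along a
morphism `G` for which `u ↦ ∂⁻¹ (G (d u))` can be chosen as a bimodule homomorphism `r` that
vanishes on cycles: the extension is the difference of the component of `G` in `C₁` and `r`. -/
theorem pull_kernelMap_mem_extendable {A' : Type u'} [Ring A'] {B : TruncatedAlgebra.{v'} A'}
    {N : Type t'} [AddCommGroup N] [Module A' N] [Module A'ᵐᵒᵖ N] (φ : BimoduleHom A' N A M)
    (G : B.Hom E.trunc φ.g) (r : B.deg1 →+ E.C₁)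
    (hr : ∀ u : B.deg1, E.bdry (r u) = E.toC₀ (G.toRingHom (B.d u)))
    (hr₁ : ∀ a (ha : a ∈ B.deg0) x (hx : x ∈ B.deg1),
      r ⟨a * x, B.mul_mem a ha x hx⟩ = E.toC₀ (G.toRingHom a) • r ⟨x, hx⟩)
    (hr₂ : ∀ a (ha : a ∈ B.deg0) x (hx : x ∈ B.deg1),
      r ⟨x * a, B.mul_mem' a ha x hx⟩ = op (E.toC₀ (G.toRingHom a)) • r ⟨x, hx⟩)
    (hr₃ : ∀ x (hx : x ∈ B.cycles), r ⟨x, hx.1⟩ = 0) :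
    G.pull φ E.kernelMap ∈ B.extendable N := by
  have hi : ∀ u : B.deg1, ∃ m, E.i m = E.toC₁ (G.toRingHom u) - r u := by
    rintro ⟨u, hu⟩
    refine (E.exact_C₁ _).1 ?_
    rw [map_sub, ← E.toC₀_d, ← G.map_d u hu, hr, sub_self]
  choose D hD using hi
  let D' : B.deg1 →+ M := AddMonoidHom.mk' D fun u u' => E.i_injective (by
    rw [map_add, hD, hD, hD, AddSubgroup.coe_add, map_add, map_add, map_add]
    abel)
  have hD' : ∀ u hu, E.i (D' ⟨u, hu⟩) = E.toC₁ (G.toRingHom u) - r ⟨u, hu⟩ := fun u hu => hD _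
  refine TruncatedAlgebra.mem_extendable_of (φ.h.comp D') (fun a ha x hx => ?_)
    (fun a ha x hx => ?_) fun x hx => ?_
  · change φ.h (D' _) = _ • φ.h (D' _)
    rw [← φ.map_smul, ← G.map_ε a ha]
    refine congrArg φ.h (E.i_injective ?_)
    rw [E.ε_eq, E.i_smul, hD', hD', map_mul, toC₁_mul_of_mem _ (G.map_deg1 x hx), smul_sub,
      hr₁ a ha x hx]
  · change φ.h (D' _) = _ • φ.h (D' _)
    rw [← φ.map_op_smul, ← G.map_ε a ha]
    refine congrArg φ.h (E.i_injective ?_)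
    rw [E.ε_eq, E.i_op_smul, hD', hD', map_mul, toC₁_mul_of_mem' _ (G.map_deg1 x hx), smul_sub,
      hr₂ a ha x hx]
  · rw [TruncatedAlgebra.Hom.pull_apply]
    change φ.h _ = φ.h (D' _)
    refine congrArg φ.h (E.i_injective ?_)
    rw [E.i_kernelMap, hD', hr₃ x hx, sub_zero]

end CrossedExtension

/-! ### The canonical crossed extension -/

section Canonical

open ChainAlgebraOver TruncatedAlgebra

variable {p : ℕ} [Fact p.Prime] {A : Type u} [Ring A] [Algebra (ZMod p) A]
  [Algebra (ZMod (p ^ 2)) A] {M : Type t} [AddCommGroup M] [Module A M] [Module Aᵐᵒᵖ M]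

theorem natCast_eq_zero_of_algebra {q : ℕ} (B : Type*) [Ring B] [Algebra (ZMod q) B] :
    (q : B) = 0 := by
  rw [← map_natCast (algebraMap (ZMod q) B), ZMod.natCast_self, map_zero]

/-- The canonical crossed extension has secondary invariant `1`: the element `p [1]` of `R(A)` has
boundary `p`, and `p (p [1])` is `i 1`. -/
theorem secondary_kernelMap_canonicalExtension (hA : (p : A) = 0)
    (hB : ((p ^ 2 : ℕ) : (canonicalExtension p (A := A)).trunc.carrier) = 0) :
    (secondary (canonicalExtension p (A := A)).trunc A hA hB
      ⟨_, CrossedExtension.kernelMap_mem _⟩ : A) = 1 := by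
  refine CrossedExtension.secondary_kernelMap hA hB (x := rmk (p ^ 2) (pBracket p 1)) ?_ ?_
  · change Ideal.Quotient.mk (multIdeal A (p ^ 2)) (p • (1 : ZBracket A)) = _
    rw [nsmul_one, map_natCast]
    rfl
  · exact (canonicalIncl_apply p 1).trans (map_nsmul _ _ _)

/-- Over the integers the canonical crossed extension becomes trivial: the component in `(ℤ/p²)[A]`
of a morphism from a quasi-free chain algebra over the integers lifts to a homomorphism `L` to
`ℤ[A]`, and `u ↦ L (d u)` takes values in `R(A)` on elements of degree `1`. -/
theorem pull_kernelMap_canonicalExtension_mem {P : ChainAlgebraOver.{0, w} ℤ A}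
    (hPf : P.IsQuasiFree) (hP : P.IsWeakEquivalence) (φ : BimoduleHom A M A A)
    (G : (P.trunc hP).Hom (canonicalExtension p (A := A)).trunc φ.g) :
    G.pull φ (canonicalExtension p (A := A)).kernelMap ∈ (P.trunc hP).extendable M := by
  have hK : ∀ k : ℤ, ∃ n : ℤ, (n : ℤ) = k := fun k => ⟨k, Int.cast_id⟩
  obtain ⟨S⟩ := hPf.nonempty_freeGenerators
  let π : ZBracket A →+* ZModBracket A (p ^ 2) := Ideal.Quotient.mk (multIdeal A (p ^ 2))
  let G₀ : P.carrier →+* ZModBracket A (p ^ 2) :=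
    (canonicalExtension p (A := A)).toC₀.comp G.toRingHom
  obtain ⟨L, hL⟩ : ∃ L : P.carrier →+* ZBracket A, ∀ a, π (L a) = G₀ a := by
    choose f hf using fun i =>
      Ideal.Quotient.mk_surjective (I := multIdeal A (p ^ 2)) (G₀ (S.x i))
    obtain ⟨L, hL⟩ := S.exists_ringHom hK (Int.castRingHom (ZBracket A)) f
    let V : AddSubgroup P.carrier := AddMonoidHom.eqLocus (π.comp L).toAddMonoidHom
      G₀.toAddMonoidHom
    refine ⟨L, mem_of_homogeneous V fun n a ha => S.grading_le hK (fun _ => V) ?_ ?_ ha⟩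
    · exact (map_one (π.comp L)).trans (map_one G₀).symm
    · intro i _ a _ h
      have h : π (L a) = G₀ a := h
      change π (L (S.x i * a)) = G₀ (S.x i * a)
      rw [map_mul L, map_mul π, map_mul G₀, h, hL, hf]
  let B : TruncatedAlgebra.{w} A := P.trunc hP
  have hker : ∀ u ∈ B.deg1, L (B.d u) ∈ RKer A := by
    intro u hu
    have h : etaMod p A (G₀ (B.d u)) = φ.g (B.ε (B.d u)) := G.map_ε _ (B.d_mem u hu)
    rw [B.ε_d u hu, map_zero] at h
    exact (congrArg (etaMod p A) (hL (B.d u))).trans h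
  let r : B.deg1 →+ RKer A :=
    { toFun := fun u => ⟨L (B.d u), hker u u.2⟩
      map_zero' := Subtype.ext ((congrArg L (map_zero B.d)).trans (map_zero L))
      map_add' := fun u u' =>
        Subtype.ext ((congrArg L (map_add B.d u.1 u'.1)).trans (map_add L _ _)) }
  refine CrossedExtension.pull_kernelMap_mem_extendable _ φ G ((rmk (p ^ 2)).comp r) ?_ ?_ ?_ ?_
  · exact fun u => hL _
  · intro a ha x hx
    refine Eq.trans ?_ (congrArg (fun c : ZModBracket A (p ^ 2) => c • rmk (p ^ 2) (r ⟨x, hx⟩))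
      (hL a))
    refine Eq.trans ?_ (smul_rmk (p ^ 2) (L a) _).symm
    refine congrArg (rmk (p ^ 2)) (Subtype.ext ?_)
    exact (congrArg L (B.d_mul a ha x hx)).trans (map_mul L _ _)
  · intro a ha x hx
    refine Eq.trans ?_ (congrArg
      (fun c : ZModBracket A (p ^ 2) => op c • rmk (p ^ 2) (r ⟨x, hx⟩)) (hL a))
    refine Eq.trans ?_ (op_smul_rmk (p ^ 2) (L a) _).symm
    refine congrArg (rmk (p ^ 2)) (Subtype.ext ?_)
    exact (congrArg L (B.d_mul' a ha x hx)).trans (map_mul L _ _)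
  · intro x hx
    change rmk (p ^ 2) (r _) = 0
    rw [show r ⟨x, hx.1⟩ = 0 from Subtype.ext ((congrArg L hx.2).trans (map_zero L)), map_zero]

end Canonical

/-! ### Base change from the integers -/

namespace FpBimodule

open ChainAlgebraOver TruncatedAlgebra

variable {p : ℕ} (X Y : FpBimodule.{u, t} p)

/-- The truncation of the resolution of `X.A` over the integers. -/
noncomputable abbrev truncInt : TruncatedAlgebra.{u} X.A := Shukla.trunc ℤ X.A

/-- The truncation of the resolution of `X.A` over `ℤ/p²`. -/
noncomputable abbrev truncSq : TruncatedAlgebra.{u} X.A := Shukla.trunc (ZMod (p ^ 2)) X.A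

theorem exists_intCast_eq (k : ℤ) : ∃ n : ℤ, (n : ℤ) = k := ⟨k, Int.cast_id⟩

/-- The class of a crossed map over the integers. -/
noncomputable abbrev classInt : X.truncInt.crossedMaps X.M →+ Shukla ℤ X.A X.M 3 :=
  Shukla.crossedClass X.M exists_intCast_eq

/-- The class of a crossed map over `ℤ/p²`. -/
noncomputable abbrev classSq : X.truncSq.crossedMaps X.M →+ Shukla (ZMod (p ^ 2)) X.A X.M 3 :=
  Shukla.crossedClass X.M ZMod.intCast_surjective

theorem classInt_surjective : Function.Surjective X.classInt :=
  crossedClass_surjective _ (resolution_isQuasiFree ℤ X.A) _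

theorem classSq_surjective : Function.Surjective X.classSq :=
  crossedClass_surjective _ (resolution_isQuasiFree _ X.A) _

theorem classSq_eq_zero_iff (θ : X.truncSq.crossedMaps X.M) :
    X.classSq θ = 0 ↔ θ.1 ∈ X.truncSq.extendable X.M :=
  crossedClass_eq_zero_iff _ (resolution_isQuasiFree _ X.A) _ θ

theorem classInt_eq_zero_iff (θ : X.truncInt.crossedMaps X.M) :
    X.classInt θ = 0 ↔ θ.1 ∈ X.truncInt.extendable X.M :=
  crossedClass_eq_zero_iff _ (resolution_isQuasiFree _ X.A) _ θ

theorem natCast_eq_zero : (p : X.A) = 0 := natCast_eq_zero_of_algebra X.A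

theorem natCast_sq_eq_zero : ((p ^ 2 : ℕ) : X.A) = 0 := natCast_eq_zero_of_algebra X.A

theorem natCast_truncSq : ((p ^ 2 : ℕ) : X.truncSq.carrier) = 0 :=
  natCast_eq_zero_of_algebra (resolution (ZMod (p ^ 2)) X.A).carrier

/-- The secondary invariant of classes of degree `3` over `ℤ/p²`: the class of a crossed map `θ` is
sent to `θ (p x)`, where `d x = p`. -/
noncomputable def secondaryClass : Shukla (ZMod (p ^ 2)) X.A X.M 3 →+ H0 X.A X.M :=
  AddMonoidHom.liftOfSurjective X.classSq X.classSq_surjective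
    ⟨secondary X.truncSq X.M X.natCast_eq_zero X.natCast_truncSq, fun θ hθ =>
      secondary_eq_zero_of_extendable _ _ θ ((X.classSq_eq_zero_iff θ).1 hθ)⟩

theorem secondaryClass_classSq (θ : X.truncSq.crossedMaps X.M) :
    X.secondaryClass (X.classSq θ)
      = secondary X.truncSq X.M X.natCast_eq_zero X.natCast_truncSq θ :=
  AddMonoidHom.liftOfRightInverse_comp_apply X.classSq _ _ _ θ

theorem baseChange_classSq (F : X.truncInt.Hom X.truncSq (BimoduleHom.id X.A X.M).g)
    (θ : X.truncSq.crossedMaps X.M) :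
    X.baseChange 3 (X.classSq θ)
      = X.classInt ⟨F.pull (BimoduleHom.id X.A X.M) θ.1, F.pull_mem _ θ.2⟩ :=
  Shukla.map_crossedClass _ _ _ _ F θ

theorem nonempty_truncInt_hom {A : Type u'} [Ring A] (C : TruncatedAlgebra.{w} A)
    (g : X.A →+* A) : Nonempty (X.truncInt.Hom C g) :=
  (resolution_isQuasiFree ℤ X.A).exists_truncHom exists_intCast_eq
    (resolution_isWeakEquivalence ℤ X.A) (Int.castRingHom _) g

/-- The target need not be a truncation over `ℤ/p²`; only `p² = 0` is required. -/
theorem nonempty_truncSq_hom {A : Type u'} [Ring A] (C : TruncatedAlgebra.{w} A)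
    (g : X.A →+* A) (hC : ((p ^ 2 : ℕ) : C.carrier) = 0) : Nonempty (X.truncSq.Hom C g) :=
  letI := algebraZMod (p ^ 2) C.carrier hC
  (resolution_isQuasiFree (ZMod (p ^ 2)) X.A).exists_truncHom ZMod.intCast_surjective
    (resolution_isWeakEquivalence (ZMod (p ^ 2)) X.A) (algebraMap _ _) g

variable {X Y} in
theorem baseChange_mapZModSq (φ : X.Hom Y) (y : Shukla (ZMod (p ^ 2)) Y.A Y.M 3) :
    X.baseChange 3 (mapZModSq φ 3 y) = mapInt φ 3 (Y.baseChange 3 y) := by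
  obtain ⟨θ, rfl⟩ := Y.classSq_surjective y
  obtain ⟨F⟩ := X.nonempty_truncInt_hom X.truncSq (BimoduleHom.id X.A X.M).g
  obtain ⟨F'⟩ := Y.nonempty_truncInt_hom Y.truncSq (BimoduleHom.id Y.A Y.M).g
  obtain ⟨G⟩ := X.nonempty_truncInt_hom Y.truncInt φ.g
  obtain ⟨G'⟩ := X.nonempty_truncSq_hom Y.truncSq φ.g Y.natCast_truncSq
  rw [baseChange_classSq Y F', mapInt, Shukla.map_crossedClass exists_intCast_eq _ φ _ G,
    mapZModSq,
    Shukla.map_crossedClass ZMod.intCast_surjective ZMod.intCast_surjective φ _ G',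
    baseChange_classSq X F, Shukla.crossedClass_eq_iff]
  let H : X.truncInt.Hom Y.truncSq φ.g := G'.comp F
  let H' : X.truncInt.Hom Y.truncSq φ.g := F'.comp G
  exact (resolution_isQuasiFree ℤ X.A).pull_sub_pull_mem exists_intCast_eq _ φ H H' θ.2

variable {X Y} in
theorem secondaryClass_mapZModSq (φ : X.Hom Y) (y : Shukla (ZMod (p ^ 2)) Y.A Y.M 3) :
    X.secondaryClass (mapZModSq φ 3 y) = H0.map φ (Y.secondaryClass y) := by
  obtain ⟨θ, rfl⟩ := Y.classSq_surjective y
  obtain ⟨G⟩ := X.nonempty_truncSq_hom Y.truncSq φ.g Y.natCast_truncSq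
  rw [mapZModSq, Shukla.map_crossedClass ZMod.intCast_surjective ZMod.intCast_surjective φ _ G,
    secondaryClass_classSq, secondaryClass_classSq]
  exact secondary_pull _ _ _ _ φ G θ

variable [Fact p.Prime]

theorem isTorsionFree_truncInt : X.truncInt.IsTorsionFree (p ^ 2) :=
  (resolution_isQuasiFree ℤ X.A).isTorsionFree _ (pow_ne_zero 2 (Fact.out : p.Prime).ne_zero)

/-- The reduction modulo `p²` of the resolution over the integers. It is not a resolution of `X.A`,
but its truncation receives a morphism from the truncation of the resolution over `ℤ/p²`. -/
noncomputable abbrev modInt : TruncatedAlgebra.{u} X.A :=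
  X.truncInt.mod (p ^ 2) X.natCast_sq_eq_zero

/-- Up to extendable maps, a crossed map over `ℤ/p²` is pulled back from the reduction modulo
`p²` of the resolution over the integers, where it is extendable if its secondary invariant vanishes
and its base change to the integers is extendable. -/
theorem eq_zero_of_baseChange (y : Shukla (ZMod (p ^ 2)) X.A X.M 3)
    (hb : X.baseChange 3 y = 0) (hs : X.secondaryClass y = 0) : y = 0 := by
  obtain ⟨θ, rfl⟩ := X.classSq_surjective y
  obtain ⟨F⟩ := X.nonempty_truncInt_hom X.truncSq (BimoduleHom.id X.A X.M).g
  obtain ⟨σ⟩ := X.nonempty_truncSq_hom X.modInt (BimoduleHom.id X.A X.M).g natCast_mod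
  rw [baseChange_classSq X F, classInt_eq_zero_iff] at hb
  rw [secondaryClass_classSq] at hs
  rw [classSq_eq_zero_iff]
  have h := σ.pull_mem_extendable (BimoduleHom.id X.A X.M) (pull_ofMod_mem_extendable
    (hA := X.natCast_sq_eq_zero) X.natCast_eq_zero X.isTorsionFree_truncInt X.natCast_truncSq F θ
    hs hb)
  let H : X.truncSq.Hom X.truncSq (BimoduleHom.id X.A X.M).g :=
    (F.ofMod (hA := X.natCast_sq_eq_zero) X.natCast_truncSq).comp σ
  have h' := (resolution_isQuasiFree (ZMod (p ^ 2)) X.A).pull_sub_pull_mem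
    ZMod.intCast_surjective _ (BimoduleHom.id X.A X.M) (Hom.id X.truncSq) H θ.2
  have := AddSubgroup.add_mem _ h' h
  rwa [show H.pull (BimoduleHom.id X.A X.M) θ.1 = σ.pull (BimoduleHom.id X.A X.M)
    ((F.ofMod (hA := X.natCast_sq_eq_zero) X.natCast_truncSq).pull (BimoduleHom.id X.A X.M) θ.1)
    from rfl, sub_add_cancel] at this

/-- A crossed map over the integers extends to the reduction modulo `p²`, and the extension with
vanishing secondary invariant is pulled back to the resolution over `ℤ/p²`. -/
theorem exists_baseChange_eq (y : Shukla ℤ X.A X.M 3) :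
    ∃ z, X.baseChange 3 z = y ∧ X.secondaryClass z = 0 := by
  obtain ⟨θ, rfl⟩ := X.classInt_surjective y
  obtain ⟨F⟩ := X.nonempty_truncInt_hom X.truncSq (BimoduleHom.id X.A X.M).g
  obtain ⟨σ⟩ := X.nonempty_truncSq_hom X.modInt (BimoduleHom.id X.A X.M).g natCast_mod
  obtain ⟨x, hx, hdx⟩ := exists_d_eq_natCast (B := X.truncInt) X.natCast_eq_zero
  obtain ⟨θ', hθ', h⟩ := exists_mod_crossedMap (hA := X.natCast_sq_eq_zero) X.natCast_eq_zero
    X.isTorsionFree_truncInt θ.2 hx hdx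
  let τ := toMod X.truncInt X.natCast_sq_eq_zero
  -- a cycle `e` over the integers has `d e = p² 0`, so that `θ'` restricts to `θ`
  have hτ : τ.pull (BimoduleHom.id X.A X.M) θ' = θ.1 := by
    ext ⟨e, he⟩
    refine (h e he.1 0 X.truncInt.deg0.zero_mem
      ((show X.truncInt.d e = 0 from he.2).trans (smul_zero _).symm)).trans ?_
    refine congrArg θ.1 (Subtype.ext ?_)
    change e - 0 * p • x = e
    rw [zero_mul, sub_zero]
  refine ⟨X.classSq ⟨σ.pull (BimoduleHom.id X.A X.M) θ', σ.pull_mem _ hθ'⟩, ?_, ?_⟩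
  · rw [baseChange_classSq X F, Shukla.crossedClass_eq_iff]
    let H : X.truncInt.Hom X.modInt (BimoduleHom.id X.A X.M).g := σ.comp F
    have h' := (resolution_isQuasiFree ℤ X.A).pull_sub_pull_mem exists_intCast_eq _
      (BimoduleHom.id X.A X.M) H τ hθ'
    rwa [hτ] at h'
  · rw [secondaryClass_classSq, secondary_pull X.natCast_eq_zero X.natCast_truncSq
      X.natCast_eq_zero natCast_mod (BimoduleHom.id X.A X.M) σ ⟨θ', hθ'⟩]
    refine Subtype.ext ?_
    change (secondary X.modInt X.M X.natCast_eq_zero natCast_mod ⟨θ', hθ'⟩ : X.M) = 0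
    have hdx' : X.modInt.d (X.truncInt.mkQ (p ^ 2) x) = p :=
      (X.truncInt.modD_mkQ (p ^ 2) x).trans ((congrArg _ hdx).trans (map_natCast _ p))
    have hdp : X.truncInt.d (p • x) = p ^ 2 • 1 := by
      rw [map_nsmul, hdx, nsmul_eq_mul, nsmul_one, ← Nat.cast_mul, ← pow_two]
    have hx' : X.truncInt.mkQ (p ^ 2) x ∈ X.modInt.deg1 := ⟨x, hx, rfl⟩
    -- `p x` has boundary `p² 1`, so that `θ'` sends it to `θ (p x - 1 (p x))`
    rw [secondary_apply _ _ _ hx' hdx']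
    refine Eq.trans ?_ ((h (p • x) (X.truncInt.deg1.nsmul_mem hx p) 1 X.truncInt.deg0.one_mem
      hdp).trans ?_)
    · exact congrArg θ' (Subtype.ext (map_nsmul _ p x).symm)
    · rw [← map_zero θ.1]
      refine congrArg θ.1 (Subtype.ext ?_)
      change p • x - 1 * p • x = 0
      rw [one_mul, sub_self]

/-- The class of the canonical crossed extension, pushed forward along `1 ↦ m`, is the class of the
crossed map of that extension. -/
theorem canonicalMap_eq (m : H0 X.A X.M)
    (F : X.truncSq.Hom (canonicalExtension p (A := X.A)).trunc (RingHom.id X.A)) :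
    X.canonicalMap m = X.classSq ⟨F.pull (BimoduleHom.ofH0 m) (CrossedExtension.kernelMap _),
      F.pull_mem (BimoduleHom.ofH0 m) (CrossedExtension.kernelMap_mem _)⟩ := by
  rw [canonicalMap, canonicalClass, CrossedExtension.shuklaClass_eq _ ZMod.intCast_surjective F]
  exact Shukla.map_crossedClass ZMod.intCast_surjective ZMod.intCast_surjective
    (BimoduleHom.ofH0 m) _ (Hom.id X.truncSq) _

theorem natCast_canonicalExtension :
    ((p ^ 2 : ℕ) : (canonicalExtension p (A := X.A)).trunc.carrier) = 0 :=
  natCast_eq_zero_of_algebra (canonicalExtension p (A := X.A)).chainAlgebra.carrier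

theorem secondaryClass_canonicalMap (m : H0 X.A X.M) :
    X.secondaryClass (X.canonicalMap m) = m := by
  obtain ⟨F⟩ := X.nonempty_truncSq_hom (canonicalExtension p (A := X.A)).trunc (RingHom.id X.A)
    X.natCast_canonicalExtension
  rw [canonicalMap_eq X m F, secondaryClass_classSq]
  refine (secondary_pull X.natCast_eq_zero X.natCast_truncSq X.natCast_eq_zero
    X.natCast_canonicalExtension (BimoduleHom.ofH0 m) F ⟨_, CrossedExtension.kernelMap_mem _⟩).trans
    (Subtype.ext ?_)
  refine (congrArg (BimoduleHom.ofH0 m).h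
    (secondary_kernelMap_canonicalExtension X.natCast_eq_zero
      X.natCast_canonicalExtension)).trans ?_
  exact one_smul X.A (m : X.M)

theorem baseChange_canonicalMap (m : H0 X.A X.M) : X.baseChange 3 (X.canonicalMap m) = 0 := by
  obtain ⟨F⟩ := X.nonempty_truncSq_hom (canonicalExtension p (A := X.A)).trunc (RingHom.id X.A)
    X.natCast_canonicalExtension
  obtain ⟨G⟩ := X.nonempty_truncInt_hom X.truncSq (BimoduleHom.id X.A X.M).g
  rw [canonicalMap_eq X m F, baseChange_classSq X G, classInt_eq_zero_iff]
  let H : X.truncInt.Hom (canonicalExtension p (A := X.A)).trunc (BimoduleHom.ofH0 m).g :=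
    F.comp G
  exact pull_kernelMap_canonicalExtension_mem (resolution_isQuasiFree ℤ X.A) _
    (BimoduleHom.ofH0 m) H

/-- The isomorphism whose components are base change and the secondary invariant. -/
noncomputable def decomposition :
    Shukla (ZMod (p ^ 2)) X.A X.M 3 ≃+ Shukla ℤ X.A X.M 3 × H0 X.A X.M :=
  AddEquiv.ofBijective ((X.baseChange 3).prod X.secondaryClass) <| by
    constructor
    · rw [injective_iff_map_eq_zero]
      intro y hy
      exact X.eq_zero_of_baseChange y (congrArg Prod.fst hy) (congrArg Prod.snd hy)
    · rintro ⟨y, m⟩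
      obtain ⟨z, hz, hz'⟩ := X.exists_baseChange_eq y
      refine ⟨z + X.canonicalMap m, Prod.ext ?_ ?_⟩
      · change X.baseChange 3 _ = y
        rw [map_add, hz, baseChange_canonicalMap, add_zero]
      · change X.secondaryClass _ = m
        rw [map_add, hz', secondaryClass_canonicalMap, zero_add]

theorem decomposition_apply (y : Shukla (ZMod (p ^ 2)) X.A X.M 3) :
    X.decomposition y = (X.baseChange 3 y, X.secondaryClass y) := rfl

theorem decomposition_canonicalMap (m : H0 X.A X.M) :
    X.decomposition (X.canonicalMap m) = (0, m) := by
  rw [decomposition_apply, baseChange_canonicalMap, secondaryClass_canonicalMap]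

end FpBimodule

end ShuklaCohomology

theorem mainTheorem2 (p : ℕ) [Fact p.Prime] :
    ∃ ψ : ∀ X : ShuklaCohomology.FpBimodule.{u, t} p,
        ShuklaCohomology.Shukla (ZMod (p ^ 2)) X.A X.M 3 ≃+
          ShuklaCohomology.Shukla ℤ X.A X.M 3 × ShuklaCohomology.H0 X.A X.M,
      -- the first component is the base change homomorphism
      (∀ X y, (ψ X y).1 = X.baseChange 3 y) ∧
      -- the second summand is detected by the canonical crossed extension
      (∀ X m, ψ X (X.canonicalMap m) = (0, m)) ∧
      -- naturality in the algebra and in the bimodule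
      (∀ (X Y : ShuklaCohomology.FpBimodule.{u, t} p) (φ : X.Hom Y)
        (y : ShuklaCohomology.Shukla (ZMod (p ^ 2)) Y.A Y.M 3),
        ψ X (ShuklaCohomology.FpBimodule.mapZModSq φ 3 y) =
          (ShuklaCohomology.FpBimodule.mapInt φ 3 (ψ Y y).1,
            ShuklaCohomology.H0.map φ (ψ Y y).2)) ∧
      -- base change is split surjective, with kernel the isomorphic image of `H⁰(A, M)`
      (∀ X : ShuklaCohomology.FpBimodule.{u, t} p,
        (∃ d : ShuklaCohomology.Shukla ℤ X.A X.M 3 →+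
            ShuklaCohomology.Shukla (ZMod (p ^ 2)) X.A X.M 3,
          ∀ y, X.baseChange 3 (d y) = y) ∧
        Function.Injective X.canonicalMap ∧
        ∀ y, X.baseChange 3 y = 0 ↔ ∃ m, X.canonicalMap m = y) := by
  refine ⟨fun X => X.decomposition, fun X y => rfl, fun X m => X.decomposition_canonicalMap m,
    fun X Y φ y => ?_, fun X => ⟨⟨X.decomposition.symm.toAddMonoidHom.comp
      (AddMonoidHom.inl _ _), fun y => ?_⟩, fun m m' h => ?_, fun y => ⟨fun hy => ?_, ?_⟩⟩⟩
  · exact Prod.ext (ShuklaCohomology.FpBimodule.baseChange_mapZModSq φ y)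
      (ShuklaCohomology.FpBimodule.secondaryClass_mapZModSq φ y)
  · exact congrArg Prod.fst (X.decomposition.apply_symm_apply (y, 0))
  · rw [← X.secondaryClass_canonicalMap m, h, X.secondaryClass_canonicalMap]
  · refine ⟨X.secondaryClass y, X.decomposition.injective ?_⟩
    rw [X.decomposition_canonicalMap, X.decomposition_apply, hy]
  · rintro ⟨m, rfl⟩
    exact X.baseChange_canonicalMap m
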